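/- Let $V$ be a finite-dimensional real Euclidean space with Gaussian measure $d\mu(v)=\frac1A e^{-\frac12\langle v,v\rangle}dv$, $A=\int_V e^{-\frac12\langle v,v\rangle}dv$, and let $V_{\mathbb C}=V\otimes\mathbb C$ carry the complex-bilinear extension of $\langle\cdot,\cdot\rangle$. Let $T_k:V_{\mathbb C}^{\otimes k}\to\mathbb C$ ($k\ge1$) be linear maps, and put $w_k=k$ if all $T_k$ are cyclically invariant (cyclic algebra), resp. $w_k=k!$ if all $T_k$ are invariant under all permutations of the factors (symmetric algebra). *Partition function and free energy.* Put $$Z(x_*)=\int_V\exp\Big\{\sum_{k\ge1}x_k\frac{T_k(v^{\otimes k})}{w_k}\Big\}\,d\mu(v).$$ As a formal power series in $x_1,x_2,\dots$, this means that the formal series $\exp\{\cdots\}$ is integrated coefficient by coefficient; it has constant term $1$, and $F(x_*)=\log Z(x_*)$ is its formal logarithm. *Graphs.* A closed ribbon (resp. ordinary) graph $\Gamma$ is a finite set of half-edges that is partitioned into pairs (the edges) and is also partitioned into non-empty sets (the vertices, whose sizes are their valences), each vertex being equipped with a cyclic order in the ribbon case; loops and multiple edges are allowed. It is connected if it is non-empty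 and any two half-edges are joined by a chain of half-edges in which consecutive ones share an edge or a vertex. Isomorphisms are bijections of the half-edges preserving this structure, and $\operatorname{Aut}\Gamma$ is the group of automorphisms. For a basis $(e_i)$ of $V$ with $g_{ij}=\langle e_i,e_j\rangle$ and $(g^{ij})=(g_{ij})^{-1}$, let $Z_{x_*}(\Gamma)$ be the full contraction obtained by placing the Casimir element $\sum_{i,j} g^{ij}e_i\otimes e_j$ at each edge and the tensor $x_kT_k$ at each $k$-valent vertex, its arguments being taken in the cyclic order (resp. in any order). *Statement.* In the cyclic case with connected ribbon graphs, and in the symmetric case with connected ordinary graphs, the following hold (sums are over isomorphism classes). 1. As formal power series in $x_1,x_2,\dots$, $$F(x_*)=\sum_{\Gamma\text{ connected}}\frac{Z_{x_*}(\Gamma)}{|\operatorname{Aut}\Gamma|},$$ where only finitely many $\Gamma$ contribute to the coefficient of any given monomial. 2. The same expansion is asymptotic to the logarithm of the integral wherever the latter converges uniformly: let $s$ be a finite set of indices and $D$ a set of complex parameters $x_*$ with $x_k=0$ for $k\notin s$, such that for some constants $a<\frac12$ and $C$ $$\operatorname{Re}\sum_k x_k\frac{T_k(v^{\otimes k})}{w_k}\le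 C+a\|v\|^2\qquad\text{for all }x_*\in D,\ v\in V.$$ Then for every $N\ge0$, as $x_*\to0$ in $D$, $$\log Z(x_*)=\sum_{\substack{\Gamma\text{ connected}\\ \text{with fewer than }N\text{ vertices}}}\frac{Z_{x_*}(\Gamma)}{|\operatorname{Aut}\Gamma|}+O\Big(\big(\textstyle\sum_{k\in s}|x_k|\big)^N\Big),$$ with the principal logarithm; for each $x_*\in D$ only finitely many terms of this sum are non-zero. -/

import Mathlib

open MeasureTheory Filter Topology Asymptotics
open scoped TensorProduct Nat

noncomputable section

namespace FeynmanGraph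

/-! ### Closed graphs, described by their half-edges -/

/-- A closed (no external legs) ordinary graph with set of half-edges `H`. The vertices are the
classes of `vert` (so every vertex carries at least one half-edge: the complex is purely
1-dimensional), the edges are the pairs `{h, flip h}`. Loops and multiple edges are allowed. -/
structure Graph (H : Type*) where
  vert : Setoid H
  flip : H → H
  flip_flip : ∀ h, flip (flip h) = h
  flip_ne : ∀ h, flip h ≠ h

namespace Graph

variable {H H' H'' : Type*}

/-- The set of vertices. -/
def Vertices (Γ : Graph H) : Type _ := Quotient Γ.vert

/-- The half-edges stemming from a vertex. -/
def Leg (Γ : Graph H) (v : Γ.Vertices) : Type _ := {h : H // Quotient.mk Γ.vert h = v}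

instance [Finite H] (Γ : Graph H) (v : Γ.Vertices) : Finite (Γ.Leg v) :=
  inferInstanceAs (Finite {h : H // Quotient.mk Γ.vert h = v})

instance (Γ : Graph H) (v : Γ.Vertices) : Nonempty (Γ.Leg v) :=
  ⟨⟨Quotient.out v, Quotient.out_eq v⟩⟩

/-- The valence of a vertex: the number of half-edges stemming from it. -/
def valence [Finite H] (Γ : Graph H) (v : Γ.Vertices) : ℕ+ :=
  ⟨Nat.card (Γ.Leg v), Nat.card_pos⟩

/-- Two half-edges belong to the same edge. -/
def edgeSetoid (Γ : Graph H) : Setoid H where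
  r h h' := h' = h ∨ h' = Γ.flip h
  iseqv :=
    { refl := fun h => Or.inl rfl
      symm := by
        rintro h h' (rfl | rfl)
        · exact Or.inl rfl
        · exact Or.inr (Γ.flip_flip h).symm
      trans := by
        rintro h h' h'' (rfl | rfl) (rfl | rfl)
        · exact Or.inl rfl
        · exact Or.inr rfl
        · exact Or.inr rfl
        · exact Or.inl (Γ.flip_flip h) }

/-- The set of edges. -/
def Edges (Γ : Graph H) : Type _ := Quotient Γ.edgeSetoid

/-- Connectedness: the graph is nonempty, and any two half-edges are joined by a chain of
half-edges in which consecutive ones share a vertex or an edge. -/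
def Connected (Γ : Graph H) : Prop :=
  Nonempty H ∧ ∀ h h' : H, Relation.EqvGen (fun a b => Γ.vert a b ∨ b = Γ.flip a) h h'

/-- Isomorphisms of graphs, acting on half-edges. -/
def Iso (Γ : Graph H) (Γ' : Graph H') : Type _ :=
  {f : H ≃ H' // (∀ a b, Γ.vert a b ↔ Γ'.vert (f a) (f b)) ∧ ∀ a, f (Γ.flip a) = Γ'.flip (f a)}

end Graph

/-- A closed ribbon graph with set of half-edges `H`: the vertices are the cycles of the
permutation `next` (fixed points included), each one carrying the cyclic order given by `next`;
the edges are the pairs `{h, flip h}`. -/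
structure RibbonGraph (H : Type*) where
  next : Equiv.Perm H
  flip : H → H
  flip_flip : ∀ h, flip (flip h) = h
  flip_ne : ∀ h, flip h ≠ h

namespace RibbonGraph

variable {H H' : Type*}

/-- The ordinary graph obtained by forgetting the cyclic orders. -/
def toGraph (Γ : RibbonGraph H) : Graph H where
  vert := Equiv.Perm.SameCycle.setoid Γ.next
  flip := Γ.flip
  flip_flip := Γ.flip_flip
  flip_ne := Γ.flip_ne

/-- Isomorphisms of ribbon graphs: they preserve the cyclic orders at the vertices. -/
def Iso (Γ : RibbonGraph H) (Γ' : RibbonGraph H') : Type _ :=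
  {f : H ≃ H' // (∀ a, f (Γ.next a) = Γ'.next (f a)) ∧ ∀ a, f (Γ.flip a) = Γ'.flip (f a)}

end RibbonGraph

/-! ### Isomorphism classes

Every finite graph is isomorphic to one whose set of half-edges is `Fin n` for a unique `n`. -/

/-- The relation of isomorphism between ordinary graphs. -/
def graphSetoid : Setoid (Σ n : ℕ, Graph (Fin n)) where
  r Γ Γ' := Nonempty (Γ.2.Iso Γ'.2)
  iseqv :=
    { refl := fun Γ => ⟨⟨Equiv.refl _, fun _ _ => Iff.rfl, fun _ => rfl⟩⟩
      symm := by
        rintro Γ Γ' ⟨⟨f, hf, hf'⟩⟩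
        refine ⟨⟨f.symm, fun a b => ?_, fun a => ?_⟩⟩
        · rw [hf]; simp
        · rw [Equiv.symm_apply_eq, hf']; simp
      trans := by
        rintro Γ Γ' Γ'' ⟨⟨f, hf, hf'⟩⟩ ⟨⟨g, hg, hg'⟩⟩
        refine ⟨⟨f.trans g, fun a b => ?_, fun a => ?_⟩⟩
        · rw [hf, hg]; rfl
        · simp [hf', hg'] }

/-- The relation of isomorphism between ribbon graphs. -/
def ribbonSetoid : Setoid (Σ n : ℕ, RibbonGraph (Fin n)) where
  r Γ Γ' := Nonempty (Γ.2.Iso Γ'.2)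
  iseqv :=
    { refl := fun Γ => ⟨⟨Equiv.refl _, fun _ => rfl, fun _ => rfl⟩⟩
      symm := by
        rintro Γ Γ' ⟨⟨f, hf, hf'⟩⟩
        refine ⟨⟨f.symm, fun a => ?_, fun a => ?_⟩⟩
        · rw [Equiv.symm_apply_eq, hf]; simp
        · rw [Equiv.symm_apply_eq, hf']; simp
      trans := by
        rintro Γ Γ' Γ'' ⟨⟨f, hf, hf'⟩⟩ ⟨⟨g, hg, hg'⟩⟩
        refine ⟨⟨f.trans g, fun a => ?_, fun a => ?_⟩⟩
        · simp [hf, hg]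
        · simp [hf', hg'] }

/-- The set of isomorphism classes of connected closed ordinary graphs. -/
def ConnectedGraphClass : Type := {γ : Quotient graphSetoid // γ.out.2.Connected}

/-- The set of isomorphism classes of connected closed ribbon graphs. -/
def ConnectedRibbonClass : Type := {γ : Quotient ribbonSetoid // γ.out.2.toGraph.Connected}

/-- A graph in the given isomorphism class. -/
def ConnectedGraphClass.rep (γ : ConnectedGraphClass) : Σ n : ℕ, Graph (Fin n) := γ.1.out

/-- A ribbon graph in the given isomorphism class. -/
def ConnectedRibbonClass.rep (γ : ConnectedRibbonClass) : Σ n : ℕ, RibbonGraph (Fin n) := γ.1.out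

/-- The number of vertices. -/
def ConnectedGraphClass.numVertices (γ : ConnectedGraphClass) : ℕ :=
  Nat.card γ.rep.2.Vertices

/-- The number of vertices. -/
def ConnectedRibbonClass.numVertices (γ : ConnectedRibbonClass) : ℕ :=
  Nat.card γ.rep.2.toGraph.Vertices

/-- The order of the automorphism group. -/
def ConnectedGraphClass.cardAut (γ : ConnectedGraphClass) : ℕ :=
  Nat.card (γ.rep.2.Iso γ.rep.2)

/-- The order of the automorphism group. -/
def ConnectedRibbonClass.cardAut (γ : ConnectedRibbonClass) : ℕ :=
  Nat.card (γ.rep.2.Iso γ.rep.2)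

/-! ### Cyclic and symmetric algebras and their graphical calculus -/

/-- A sequence of tensors `T_k : (V_ℂ)^{⊗ k} → ℂ`, `k = 1, 2, …`, where `V_ℂ = ℂ ⊗ V`. -/
abbrev Tensors (V : Type*) [AddCommGroup V] [Module ℝ V] : Type _ :=
  ∀ k : ℕ+, MultilinearMap ℂ (fun _ : Fin k => ℂ ⊗[ℝ] V) ℂ

section Tensors

variable {V : Type*} [AddCommGroup V] [Module ℝ V]

/-- `T_k (X_1, …, X_k) = T_k (X_k, X_1, …, X_{k-1})` for all `k`. -/
def IsCyclic (T : Tensors V) : Prop :=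
  ∀ (k : ℕ+) (X : Fin k → ℂ ⊗[ℝ] V), T k (fun i => X ((finRotate k).symm i)) = T k X

/-- `S_k (X_{σ 1}, …, X_{σ k}) = S_k (X_1, …, X_k)` for all `k` and all permutations `σ`. -/
def IsSymmetric (S : Tensors V) : Prop :=
  ∀ (k : ℕ+) (σ : Equiv.Perm (Fin k)) (X : Fin k → ℂ ⊗[ℝ] V), S k (fun i => X (σ i)) = S k X

/-- The value `T_k (v^{⊗ k})` at a real vector `v`. -/
def Tensors.diag (T : Tensors V) (k : ℕ+) (v : V) : ℂ := T k fun _ => (1 : ℂ) ⊗ₜ[ℝ] v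

end Tensors

section Calculus

variable {V : Type*} [NormedAddCommGroup V] [InnerProductSpace ℝ V]
variable {ι : Type*} [Fintype ι] [DecidableEq ι]
variable {R : Type*} [CommRing R] [Algebra ℂ R]

/-- The coefficients `g^{ij}` of the Casimir element `∑ g^{ij} e_i ⊗ e_j`: the inverse of the
matrix `g_{ij} = ⟪e_i, e_j⟫`. -/
def casimir (e : Module.Basis ι ℝ V) (i j : ι) : ℝ := (Matrix.gram ℝ e)⁻¹ i j

/-- The contribution of the edges, when the half-edge `h` is labelled by the basis index `c h`:
one propagator `g^{c h, c (flip h)}` for each edge. -/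
def edgeFactor {H : Type*} (e : Module.Basis ι ℝ V) (Γ : Graph H) (c : H → ι) : ℂ :=
  ∏ᶠ ε : Γ.Edges, ((casimir e (c (Quotient.out ε)) (c (Γ.flip (Quotient.out ε))) : ℝ) : ℂ)

/-- The value at a closed ordinary graph of the graphical calculus of the symmetric algebra
`(V_ℂ, ⟪·,·⟫, x₁S₁, x₂S₂, …)`: a Casimir element is placed at each edge, and the tensor `x_k S_k`
at each `k`-valent vertex; then all indices are contracted. The half-edges at each vertex are
enumerated arbitrarily. The parameters `x_k` lie in any commutative `ℂ`-algebra (complex numbers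
or formal variables). -/
def graphValue {H : Type*} [Fintype H] [DecidableEq H] (e : Module.Basis ι ℝ V) (S : Tensors V)
    (x : ℕ+ → R) (Γ : Graph H) : R :=
  ∑ c : H → ι, algebraMap ℂ R (edgeFactor e Γ c) *
    ∏ᶠ v : Γ.Vertices, x (Γ.valence v) *
      algebraMap ℂ R (S (Γ.valence v)
        fun i => (1 : ℂ) ⊗ₜ[ℝ] e (c ((Finite.equivFin (Γ.Leg v)).symm i).1))

/-- The value at a closed ribbon graph of the graphical calculus of the cyclic algebra
`(V_ℂ, ⟪·,·⟫, x₁T₁, x₂T₂, …)`. The half-edges at each vertex are enumerated following the cyclic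
order, from an arbitrary first one. -/
def ribbonValue {H : Type*} [Fintype H] [DecidableEq H] (e : Module.Basis ι ℝ V) (T : Tensors V)
    (x : ℕ+ → R) (Γ : RibbonGraph H) : R :=
  ∑ c : H → ι, algebraMap ℂ R (edgeFactor e Γ.toGraph c) *
    ∏ᶠ v : Γ.toGraph.Vertices, x (Γ.toGraph.valence v) *
      algebraMap ℂ R (T (Γ.toGraph.valence v)
        fun i => (1 : ℂ) ⊗ₜ[ℝ] e (c ((Γ.next ^ (i : ℕ)) (Quotient.out v))))

/-- `Z_x(Γ) / |Aut Γ|` for ordinary graphs. -/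
def graphTerm (e : Module.Basis ι ℝ V) (S : Tensors V) (x : ℕ+ → R) (γ : ConnectedGraphClass) : R :=
  ((γ.cardAut : ℂ)⁻¹) • graphValue e S x γ.rep.2

/-- `Z_x(Γ) / |Aut Γ|` for ribbon graphs. -/
def ribbonTerm (e : Module.Basis ι ℝ V) (T : Tensors V) (x : ℕ+ → R)
    (γ : ConnectedRibbonClass) : R :=
  ((γ.cardAut : ℂ)⁻¹) • ribbonValue e T x γ.rep.2

end Calculus

/-! ### Partition function and free energy -/

section Partition

variable {V : Type*} [NormedAddCommGroup V] [InnerProductSpace ℝ V] [FiniteDimensional ℝ V]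
  [MeasurableSpace V] [BorelSpace V]

variable (V) in
/-- The Gaussian measure `A⁻¹ exp (-⟪v, v⟫ / 2) dv`, where `A = ∫ exp (-⟪v, v⟫ / 2) dv`. -/
def gaussian : Measure V := (volume : Measure V).tilted fun v => -(1 / 2) * inner ℝ v v

/-- The exponent `∑ k, x_k T_k (v^{⊗ k}) / w_k` for complex parameters `x`; the weight `w_k` is
`k` for cyclic and `k!` for symmetric algebras. -/
def potential (T : Tensors V) (w : ℕ+ → ℂ) (x : ℕ+ → ℂ) (v : V) : ℂ :=
  ∑' k : ℕ+, x k * (T.diag k v / w k)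

/-- The partition function `∫ exp {∑ k, x_k T_k (v^{⊗ k}) / w_k} dμ(v)` for complex parameters. -/
def partitionIntegral (T : Tensors V) (w : ℕ+ → ℂ) (x : ℕ+ → ℂ) : ℂ :=
  ∫ v, Complex.exp (potential T w x v) ∂(gaussian V)

/-- The exponent `∑ k, x_k T_k (v^{⊗ k}) / w_k` as a formal power series in `x₁, x₂, …`. -/
def potentialSeries (T : Tensors V) (w : ℕ+ → ℂ) (v : V) : MvPowerSeries ℕ+ ℂ :=
  fun m => ∑ᶠ k : ℕ+, MvPowerSeries.coeff m
    (MvPowerSeries.X k * MvPowerSeries.C (T.diag k v / w k))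

/-- The partition function as a formal power series in `x₁, x₂, …`: the formal power series
`exp {∑ k, x_k T_k (v^{⊗ k}) / w_k}` is integrated coefficient by coefficient. -/
def partitionSeries (T : Tensors V) (w : ℕ+ → ℂ) : MvPowerSeries ℕ+ ℂ :=
  fun m => ∫ v, MvPowerSeries.coeff m
    ((PowerSeries.exp ℂ).subst (potentialSeries T w v)) ∂(gaussian V)

/-- The free energy `F = log Z` as a formal power series in `x₁, x₂, …`
(`PowerSeries.log` is `log (1 + X)`). -/
def freeEnergySeries (T : Tensors V) (w : ℕ+ → ℂ) : MvPowerSeries ℕ+ ℂ :=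
  (PowerSeries.log ℂ).subst (partitionSeries T w - 1)

end Partition

/-- The family `a` of formal power series is locally finite (only finitely many members
contribute to any given coefficient) and its sum is `F`. -/
def IsFormalSum {σ G : Type*} (a : G → MvPowerSeries σ ℂ) (F : MvPowerSeries σ ℂ) : Prop :=
  ∀ m : σ →₀ ℕ, (Function.support fun γ => MvPowerSeries.coeff m (a γ)).Finite ∧
    MvPowerSeries.coeff m F = ∑ᶠ γ, MvPowerSeries.coeff m (a γ)

/-- `F` has the asymptotic expansion `∑ γ, a γ` as `x → 0` in `D`, where the parameters `x_k` with
`k ∉ s` vanish on `D` and `a γ` is homogeneous of degree `deg γ` in `x`: for each `N`, the sum of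
the terms of degree less than `N` is finite and approximates `F` up to `O(|x|^N)`. -/
def IsAsymptoticSum {G : Type*} (s : Finset ℕ+) (D : Set (ℕ+ → ℂ)) (deg : G → ℕ)
    (a : (ℕ+ → ℂ) → G → ℂ) (F : (ℕ+ → ℂ) → ℂ) : Prop :=
  ∀ N : ℕ, (∀ x ∈ D, (Function.support fun γ : {γ : G // deg γ < N} => a x γ.1).Finite) ∧
    (fun x => F x - ∑ᶠ γ : {γ : G // deg γ < N}, a x γ.1) =O[𝓝[D] 0]
      fun x => (∑ k ∈ s, ‖x k‖) ^ N

/-- `D` is a set of parameters `x` with `x_k = 0` for `k ∉ s`, on which the Gaussian integral of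
`exp (∑ k, x_k T_k (v^{⊗ k}) / w_k)` converges uniformly: the real part of the exponent is at most
`C + a ‖v‖²` for constants `C` and `a < 1/2`. -/
def IsConvergenceDomain {V : Type*} [NormedAddCommGroup V] [InnerProductSpace ℝ V]
    (T : Tensors V) (w : ℕ+ → ℂ) (s : Finset ℕ+) (D : Set (ℕ+ → ℂ)) : Prop :=
  (∀ x ∈ D, ∀ k, k ∉ s → x k = 0) ∧
    ∃ a < (1 / 2 : ℝ), ∃ C : ℝ, ∀ x ∈ D, ∀ v : V, (potential T w x v).re ≤ C + a * ‖v‖ ^ 2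

end FeynmanGraph

end

/-! Label the half-edges. A ribbon graph on `H` becomes a pair of permutations of `H`: `next`, whose
cycles are the vertices, and the fixed-point-free involution `flip`. A non-empty graph is connected
iff the pair acts transitively. By orbit-stabilizer, a sum over isomorphism classes weighted by
1/|Aut| equals 1/n! times a sum over graphs labelled by `Fin n` (`finsum_isoClasses`).

The engine is the exponential formula `card_mul_totalWeight`. For a weight on families of
permutations that is multiplicative under disjoint unions, the total weights W_n and the weights C_n
of transitive families satisfy n W_n = ∑ binom(n,k) k C_k W_{n-k}. Let E = ∑ k x_k ∂/∂x_k, which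
multiplies a monomial by its number of half-edges. The recursion says E W = W · E C for the
exponential generating series; together with the constant terms this forces W = exp C, once the
empty family is removed from C.

The formula is used twice. For one permutation, whose transitive families are the (k-1)! long
cycles, it writes exp(∑ x_k T_k/k) as ∑ 1/n! times the sum over permutations of n points of the
product of x_k T_k over the cycles (`genSeries_cycleWeight`). Wick's formula `integral_prod_inner`,
proved by integration by parts, turns the Gaussian integral of such a product into a sum over
pairings with a Casimir element at each pair. So Z is the generating series of all labelled ribbon
graphs (`partitionSeries_eq_genSeries`). For pairs of permutations, the formula then identifies log
Z with the series of the connected ones (`freeEnergySeries_eq`).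

The symmetric case follows from the cyclic one with the tensors S_k/(k-1)!: a k-valent vertex
carries (k-1)! cyclic orders, which cancel the denominator on the side of the graphs, while k ·
(k-1)! = k! gives the right weight in the exponent.

For the asymptotic statement, the N-th Taylor remainder of exp at z is at most exp(max(0, Re z))
|z|^N. On a convergence domain this is dominated by a Gaussian-integrable function times |x|^N, so Z
is expanded by the homogeneous parts of its formal series (`norm_partitionIntegral_sub_le`). The
exponential of the truncated free energy has the same expansion (`exp_sum_homPart_isBigO`), and log
is Lipschitz near 1. -/

noncomputable section

namespace FeynmanGraph

/-! ### The exponential formula for families of permutations -/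

section Exponential

variable {J : Type*} {H H' : Type}

/-- Two points lie in the same orbit of the group generated by a family of permutations. -/
def SameOrbit (σ : J → Equiv.Perm H) : H → H → Prop :=
  Relation.EqvGen fun a b => ∃ j, b = σ j a

/-- A family of permutations that has at most one orbit. -/
def IsTransitive (σ : J → Equiv.Perm H) : Prop := ∀ a b, SameOrbit σ a b

/-- Families of permutations of a set and of its complement, glued together. -/
def glue (p : H → Prop) [DecidablePred p] (τ : J → Equiv.Perm {a // p a})
    (ρ : J → Equiv.Perm {a // ¬p a}) (j : J) : Equiv.Perm H :=
  (τ j).subtypeCongr (ρ j)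

theorem glue_apply_of_pos (p : H → Prop) [DecidablePred p] (τ : J → Equiv.Perm {a // p a})
    (ρ : J → Equiv.Perm {a // ¬p a}) (j : J) {a : H} (h : p a) :
    glue p τ ρ j a = τ j ⟨a, h⟩ := by
  simp [glue, Equiv.Perm.subtypeCongr.left_apply, h]

theorem glue_apply_of_neg (p : H → Prop) [DecidablePred p] (τ : J → Equiv.Perm {a // p a})
    (ρ : J → Equiv.Perm {a // ¬p a}) (j : J) {a : H} (h : ¬p a) :
    glue p τ ρ j a = ρ j ⟨a, h⟩ := by
  simp [glue, Equiv.Perm.subtypeCongr.right_apply, h]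

theorem glue_mem_iff (p : H → Prop) [DecidablePred p] (τ : J → Equiv.Perm {a // p a})
    (ρ : J → Equiv.Perm {a // ¬p a}) (j : J) (a : H) : p (glue p τ ρ j a) ↔ p a := by
  by_cases h : p a
  · simp only [glue_apply_of_pos p τ ρ j h, h, iff_true]; exact (τ j ⟨a, h⟩).2
  · simp only [glue_apply_of_neg p τ ρ j h, h, iff_false]; exact (ρ j ⟨a, h⟩).2

theorem SameOrbit.glue {p : H → Prop} [DecidablePred p] {τ : J → Equiv.Perm {a // p a}}
    (ρ : J → Equiv.Perm {a // ¬p a}) {a b : {a // p a}} (h : SameOrbit τ a b) :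
    SameOrbit (glue p τ ρ) a b := by
  induction h with
  | rel a b h =>
    obtain ⟨j, rfl⟩ := h
    exact .rel _ _ ⟨j, by rw [glue_apply_of_pos p τ ρ j a.2]⟩
  | refl a => exact .refl _
  | symm a b _ ih => exact .symm _ _ ih
  | trans a b c _ _ ih ih' => exact .trans _ _ _ ih ih'

/-- A chain for the glued family never leaves `p`. Both claims are proved in a single induction,
because transitivity needs to know that the intermediate point lies in `p`. -/
theorem SameOrbit.of_glue {p : H → Prop} [DecidablePred p] {τ : J → Equiv.Perm {a // p a}}
    {ρ : J → Equiv.Perm {a // ¬p a}} {a b : H} (h : SameOrbit (FeynmanGraph.glue p τ ρ) a b) :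
    (p a ↔ p b) ∧ ∀ (ha : p a) (hb : p b), SameOrbit τ ⟨a, ha⟩ ⟨b, hb⟩ := by
  induction h with
  | rel a b h =>
    obtain ⟨j, rfl⟩ := h
    refine ⟨(glue_mem_iff p τ ρ j a).symm, fun ha hb => .rel _ _ ⟨j, ?_⟩⟩
    ext
    simp [glue_apply_of_pos p τ ρ j ha]
  | refl a => exact ⟨Iff.rfl, fun ha hb => .refl _⟩
  | symm a b _ ih => exact ⟨ih.1.symm, fun ha hb => .symm _ _ (ih.2 hb ha)⟩
  | trans a b c _ _ ih ih' =>
    exact ⟨ih.1.trans ih'.1, fun ha hc =>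
      .trans _ _ _ (ih.2 ha (ih.1.1 ha)) (ih'.2 (ih.1.1 ha) hc)⟩

theorem exists_glue_eq {p : H → Prop} [DecidablePred p] {σ : J → Equiv.Perm H}
    (h : ∀ j a, p (σ j a) ↔ p a) :
    ∃ (τ : J → Equiv.Perm {a // p a}) (ρ : J → Equiv.Perm {a // ¬p a}), glue p τ ρ = σ := by
  refine ⟨fun j => (σ j).subtypePerm (h j), fun j => (σ j).subtypePerm fun a => not_congr (h j a),
    ?_⟩
  funext j
  ext a
  by_cases ha : p a
  · rw [glue_apply_of_pos _ _ _ _ ha]; rfl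
  · rw [glue_apply_of_neg _ _ _ _ ha]; rfl

theorem glue_injective {p : H → Prop} [DecidablePred p] {τ τ' : J → Equiv.Perm {a // p a}}
    {ρ ρ' : J → Equiv.Perm {a // ¬p a}} (h : glue p τ ρ = glue p τ' ρ') : τ = τ' ∧ ρ = ρ' := by
  constructor
  · funext j
    ext ⟨a, ha⟩
    rw [← glue_apply_of_pos p τ ρ j ha, h, glue_apply_of_pos p τ' ρ' j ha]
  · funext j
    ext ⟨a, ha⟩
    rw [← glue_apply_of_neg p τ ρ j ha, h, glue_apply_of_neg p τ' ρ' j ha]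

open Classical in
-- Gluing is a bijection from pairs (transitive family on `p`, arbitrary family on the complement)
-- onto the families for which the orbit of `h` is exactly `p`.
theorem sum_sameOrbit_eq [Fintype J] [DecidableEq J] [Fintype H] [DecidableEq H] {R : Type*}
    [CommRing R] {p : H → Prop} [DecidablePred p] [Fintype {a // p a}] [Fintype {a // ¬p a}] {h : H}
    (hp : p h) {F : (J → Equiv.Perm H) → R} {G : (J → Equiv.Perm {a // p a}) → R}
    {G' : (J → Equiv.Perm {a // ¬p a}) → R} (hF : ∀ τ ρ, F (glue p τ ρ) = G τ * G' ρ) :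
    ∑ σ with (∀ b, SameOrbit σ h b ↔ p b), F σ = (∑ τ with IsTransitive τ, G τ) * ∑ ρ, G' ρ := by
  rw [Finset.sum_mul_sum, ← Finset.sum_product']
  symm
  refine Finset.sum_bij (fun x _ => glue p x.1 x.2) ?_ ?_ ?_ ?_
  · rintro ⟨τ, ρ⟩ hx
    simp only [Finset.mem_product, Finset.mem_filter, Finset.mem_univ, true_and, and_true] at hx ⊢
    refine fun b => ⟨fun hb => hb.of_glue.1.1 hp, fun hb => ?_⟩
    exact SameOrbit.glue ρ (hx ⟨h, hp⟩ ⟨b, hb⟩)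
  · rintro ⟨τ, ρ⟩ _ ⟨τ', ρ'⟩ _ hx
    exact Prod.ext_iff.2 (glue_injective hx)
  · intro σ hσ
    simp only [Finset.mem_filter, Finset.mem_univ, true_and] at hσ
    -- An orbit is stable under every member of the family, so the family splits.
    obtain ⟨τ, ρ, rfl⟩ := exists_glue_eq (p := p) (σ := σ) fun j a => by
      rw [← hσ, ← hσ]
      have : SameOrbit σ a (σ j a) := .rel _ _ ⟨j, rfl⟩
      exact ⟨fun h => .trans _ _ _ h (.symm _ _ this), fun h => .trans _ _ _ h this⟩
    refine ⟨(τ, ρ), ?_, rfl⟩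
    simp only [Finset.mem_product, Finset.mem_filter, Finset.mem_univ, true_and, and_true]
    rintro ⟨a, ha⟩ ⟨b, hb⟩
    have ha' := (hσ a).2 ha
    have hb' := (hσ b).2 hb
    exact SameOrbit.of_glue (.trans _ _ _ (.symm _ _ ha') hb') |>.2 ha hb
  · rintro ⟨τ, ρ⟩ _
    exact (hF τ ρ).symm

/-- A weight on families of permutations that depends only on the isomorphism class and is
multiplicative on disjoint unions. -/
structure IsMultiplicative {R : Type*} [CommRing R] (w : ∀ H : Type, (J → Equiv.Perm H) → R) :
    Prop where
  equiv : ∀ {H H' : Type} [Finite H] (e : H ≃ H') (σ : J → Equiv.Perm H),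
    w H' (fun j => e.permCongr (σ j)) = w H σ
  glue : ∀ {H : Type} [Finite H] (p : H → Prop) [DecidablePred p]
    (τ : J → Equiv.Perm {a // p a}) (ρ : J → Equiv.Perm {a // ¬p a}),
    w H (glue p τ ρ) = w _ τ * w _ ρ

theorem SameOrbit.permCongr (e : H ≃ H') {σ : J → Equiv.Perm H} {a b : H} (h : SameOrbit σ a b) :
    SameOrbit (fun j => e.permCongr (σ j)) (e a) (e b) := by
  induction h with
  | rel a b h =>
    obtain ⟨j, rfl⟩ := h
    exact .rel _ _ ⟨j, by simp⟩
  | refl a => exact .refl _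
  | symm a b _ ih => exact .symm _ _ ih
  | trans a b c _ _ ih ih' => exact .trans _ _ _ ih ih'

theorem isTransitive_permCongr (e : H ≃ H') (σ : J → Equiv.Perm H) :
    IsTransitive (fun j => e.permCongr (σ j)) ↔ IsTransitive σ := by
  constructor
  · intro h a b
    have := (h (e a) (e b)).permCongr e.symm
    have h' : (fun j => e.symm.permCongr (e.permCongr (σ j))) = σ := by
      funext j
      ext x
      simp
    simpa [h'] using this
  · intro h a b
    simpa using (h (e.symm a) (e.symm b)).permCongr e

variable [Fintype J] [DecidableEq J] {R : Type*} [CommRing R]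
  (w : ∀ H : Type, (J → Equiv.Perm H) → R)

open Classical in
/-- The total weight of the families of permutations of `n` points. -/
def totalWeight (n : ℕ) : R := ∑ σ : J → Equiv.Perm (Fin n), w _ σ

open Classical in
/-- The total weight of the transitive families of permutations of `n` points. -/
def transitiveWeight (n : ℕ) : R := ∑ σ : J → Equiv.Perm (Fin n) with IsTransitive σ, w _ σ

variable {w}

open Classical in
theorem sum_eq_totalWeight (hw : IsMultiplicative w) [Fintype H] [DecidableEq H] :
    ∑ σ : J → Equiv.Perm H, w H σ = totalWeight w (Fintype.card H) := by
  refine Fintype.sum_equiv (Equiv.piCongrRight fun _ => (Fintype.equivFin H).permCongr) _ _ ?_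
  exact fun σ => (hw.equiv _ σ).symm

open Classical in
theorem sum_eq_transitiveWeight (hw : IsMultiplicative w) [Fintype H] [DecidableEq H] :
    ∑ σ : J → Equiv.Perm H with IsTransitive σ, w H σ = transitiveWeight w (Fintype.card H) := by
  refine Finset.sum_equiv (Equiv.piCongrRight fun _ => (Fintype.equivFin H).permCongr) ?_ ?_
  · intro σ
    simp only [Finset.mem_filter, Finset.mem_univ, true_and]
    exact (isTransitive_permCongr (Fintype.equivFin H) σ).symm
  · exact fun σ _ => (hw.equiv _ σ).symm

open Classical in
-- Mark a point `h` and sort the families by the orbit `S` of `h`. A set `S` with `k` elements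
-- contributes the transitive weight on `S` times the total weight on the complement, and it occurs
-- for `k` choices of `h`.
theorem card_mul_totalWeight (hw : IsMultiplicative w) (n : ℕ) :
    (n : R) * totalWeight w n = ∑ k ∈ Finset.range (n + 1),
      n.choose k • (k * transitiveWeight w k * totalWeight w (n - k)) := by
  have key : ∀ h : Fin n, totalWeight w n = ∑ S : Finset (Fin n), if h ∈ S then
      transitiveWeight w S.card * totalWeight w (n - S.card) else 0 := by
    intro h
    have h1 := Finset.sum_fiberwise (Finset.univ : Finset (J → Equiv.Perm (Fin n)))
      (fun σ => Finset.univ.filter fun b => SameOrbit σ h b) (w (Fin n))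
    rw [totalWeight, ← h1]
    refine Finset.sum_congr rfl fun S _ => ?_
    split_ifs with hS
    · have h2 := sum_sameOrbit_eq (p := (· ∈ S)) hS (F := w (Fin n)) (G := w _) (G' := w _)
        fun τ ρ => hw.glue _ τ ρ
      rw [sum_eq_transitiveWeight hw, sum_eq_totalWeight hw] at h2
      rw [Fintype.card_coe, Fintype.card_subtype_compl, Fintype.card_coe, Fintype.card_fin] at h2
      rw [← h2]
      refine Finset.sum_congr ?_ fun _ _ => rfl
      ext σ
      simp [Finset.ext_iff]
    · refine Finset.sum_eq_zero fun σ hσ => absurd ?_ hS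
      rw [← (Finset.mem_filter.1 hσ).2]
      simp only [Finset.mem_filter, Finset.mem_univ, true_and]
      exact Relation.EqvGen.refl h
  have h1 : (n : R) * totalWeight w n = ∑ _h : Fin n, totalWeight w n := by simp
  rw [h1, Finset.sum_congr rfl fun h _ => key h, Finset.sum_comm]
  -- The summand depends only on the size of `S`; this produces the binomial coefficients.
  have h2 := Finset.sum_powerset_apply_card (f := fun k => (k : R) * transitiveWeight w k *
    totalWeight w (n - k)) (x := (Finset.univ : Finset (Fin n)))
  rw [Finset.card_univ, Fintype.card_fin, Finset.powerset_univ] at h2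
  rw [← h2]
  refine Finset.sum_congr rfl fun S _ => ?_
  rw [← Finset.sum_filter]
  simp [mul_assoc]

end Exponential

/-! ### Products over the classes of an equivalence relation -/

section ClassProd

variable {H H' : Type*} {M : Type*} [CommMonoid M]

/-- The product over the classes of `r` of the values of `f` at representatives. -/
def classProd (r : Setoid H) (f : H → M) : M := ∏ᶠ q : Quotient r, f q.out

theorem classProd_eq_prod (r : Setoid H) [Fintype (Quotient r)] (f : H → M) :
    classProd r f = ∏ q : Quotient r, f q.out :=
  finprod_eq_prod_of_fintype _

/-- Invariance of `f'` on classes is needed because the bijection need not carry chosen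
representatives to chosen representatives. -/
theorem classProd_equiv (e : H ≃ H') {r : Setoid H} {r' : Setoid H'}
    (hr : ∀ a b, r a b ↔ r' (e a) (e b)) {f : H → M} {f' : H' → M}
    (hf : ∀ a, f a = f' (e a)) (hf' : ∀ a b, r' a b → f' a = f' b) :
    classProd r f = classProd r' f' := by
  rw [classProd, classProd, ← finprod_comp_equiv (Quotient.congr e hr)]
  refine finprod_congr fun q => ?_
  rw [hf]
  apply hf'
  induction q using Quotient.inductionOn with | _ a
  rw [Quotient.congr_mk]
  exact Setoid.trans' _ ((hr _ _).1 (Quotient.mk_out a)) (Setoid.symm' _ (Quotient.mk_out (e a)))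

theorem classProd_eq_of_rel {r : Setoid H} {f g : H → M} (h : ∀ a, f a = g a) :
    classProd r f = classProd r g :=
  finprod_congr fun _ => h _

/-- Each class lies wholly inside `p` or wholly outside it, so the product over all classes splits
in two. -/
theorem classProd_mul_classProd [Finite H] {r : Setoid H} (p : H → Prop)
    (hp : ∀ a b, r a b → (p a ↔ p b)) {f : H → M} (hf : ∀ a b, r a b → f a = f b) :
    classProd (r.comap (Subtype.val : {a // p a} → H)) (fun a => f a) *
      classProd (r.comap (Subtype.val : {a // ¬p a} → H)) (fun a => f a) = classProd r f := by
  classical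
  have := Fintype.ofFinite H
  have aux : ∀ (p : H → Prop) (P : Quotient r → Prop) (_ : ∀ a, p a ↔ P ⟦a⟧),
      classProd (r.comap (Subtype.val : {a // p a} → H)) (fun a => f a) =
        ∏ q : {q : Quotient r // P q}, f q.1.out := by
    intro p P hP
    rw [classProd_eq_prod]
    refine (Fintype.prod_equiv (Equiv.subtypeQuotientEquivQuotientSubtype p P hP
      fun a b => Iff.rfl) _ _ ?_).symm
    rintro ⟨q, hq⟩
    induction q using Quotient.inductionOn with | _ a
    rw [Equiv.subtypeQuotientEquivQuotientSubtype_mk]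
    apply hf
    exact Setoid.trans' _ (Quotient.mk_out a) (Setoid.symm' _
      (Quotient.mk_out (s := r.comap (Subtype.val : {a // p a} → H)) ⟨a, (hP a).2 hq⟩))
  have hP : ∀ a, p a ↔ p (⟦a⟧ : Quotient r).out := fun a =>
    (hp _ _ (Quotient.mk_out (s := r) a)).symm
  rw [aux p (fun q => p q.out) hP, aux (fun a => ¬p a) (fun q => ¬p q.out)
    fun a => not_congr (hP a), classProd_eq_prod]
  convert Fintype.prod_subtype_mul_prod_subtype (fun q : Quotient r => p q.out) (fun q => f q.out)

end ClassProd

/-! ### Orbits of a permutation -/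

section Orbits

variable {H H' : Type*}

/-- The number of elements of a class of an equivalence relation. -/
def classSize (r : Setoid H) (h : H) : ℕ+ := (Nat.card {b // r b h}).toPNat'

/-- The equivalence relation of lying in the same cycle. -/
abbrev cycleSetoid (σ : Equiv.Perm H) : Setoid H := Equiv.Perm.SameCycle.setoid σ

/-- `toPNat'` would send an infinite class, of `Nat.card` zero, to 1; a finite class is non-empty,
so no truncation takes place. -/
theorem coe_classSize [Finite H] (r : Setoid H) (h : H) :
    (classSize r h : ℕ) = Nat.card {b // r b h} := by
  have : Nonempty {b // r b h} := ⟨⟨h, r.refl' h⟩⟩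
  simp [classSize, Nat.card_pos]

theorem classSize_eq_of_rel (r : Setoid H) {a b : H} (h : r a b) :
    classSize r a = classSize r b := by
  have : ∀ c, r c a ↔ r c b := fun c =>
    ⟨fun hc => r.trans' hc h, fun hc => r.trans' hc (r.symm' h)⟩
  simp only [classSize, this]

theorem classSize_equiv (e : H ≃ H') {r : Setoid H} {r' : Setoid H'}
    (hr : ∀ a b, r a b ↔ r' (e a) (e b)) (a : H) : classSize r' (e a) = classSize r a := by
  rw [classSize, classSize]
  congr 1
  exact (Nat.card_congr (e.subtypeEquiv fun b => hr b a)).symm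

theorem classSize_comap {r : Setoid H} {p : H → Prop} (hp : ∀ a b, r a b → (p a ↔ p b))
    (a : {a // p a}) :
    classSize (r.comap (Subtype.val : {a // p a} → H)) a = classSize r a := by
  rw [classSize, classSize]
  congr 1
  refine Nat.card_congr ⟨fun b => ⟨b.1.1, b.2⟩, fun b => ⟨⟨b.1, (hp _ _ b.2).2 a.2⟩, b.2⟩,
    fun _ => rfl, fun _ => rfl⟩

theorem sameCycle_permCongr (e : H ≃ H') (σ : Equiv.Perm H) (a b : H) :
    (e.permCongr σ).SameCycle (e a) (e b) ↔ σ.SameCycle a b := by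
  have : ∀ i : ℤ, ((e.permCongr σ) ^ i) (e a) = e ((σ ^ i) a) := fun i => by
    have := map_zpow e.permCongrHom σ i
    change e.permCongr (σ ^ i) = (e.permCongr σ) ^ i at this
    rw [← this]
    simp
  simp [Equiv.Perm.SameCycle, this]

theorem permCongr_pow_apply (e : H ≃ H') (σ : Equiv.Perm H) (i : ℕ) (a : H) :
    ((e.permCongr σ) ^ i) (e a) = e ((σ ^ i) a) := by
  have := map_pow e.permCongrHom σ i
  change e.permCongr (σ ^ i) = (e.permCongr σ) ^ i at this
  rw [← this]
  simp

theorem cycleSetoid_subtypePerm {σ : Equiv.Perm H} {p : H → Prop} (h : ∀ a, p (σ a) ↔ p a) :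
    cycleSetoid (σ.subtypePerm h) = (cycleSetoid σ).comap Subtype.val := by
  ext a b
  exact Equiv.Perm.sameCycle_subtypePerm

theorem eq_of_sameCycle {σ : Equiv.Perm H} {α : Type*} {f : H → α} (h : ∀ a, f (σ a) = f a)
    {a b : H} (hab : σ.SameCycle a b) : f a = f b := by
  obtain ⟨i, rfl⟩ := hab
  induction i using Int.induction_on with
  | zero => simp
  | succ i ih => rw [ih, add_comm, zpow_add, zpow_one, Equiv.Perm.mul_apply, h]
  | pred i ih =>
    rw [ih, ← h ((σ ^ (-(i : ℤ) - 1)) a), ← Equiv.Perm.mul_apply, ← zpow_one_add]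
    congr 3
    ring

theorem prop_iff_of_sameCycle {σ : Equiv.Perm H} {p : H → Prop} (h : ∀ a, p (σ a) ↔ p a) {a b : H}
    (hab : σ.SameCycle a b) : p a ↔ p b :=
  iff_of_eq (eq_of_sameCycle (f := p) (fun a => propext (h a)) hab)

theorem card_sameCycle [Finite H] (σ : Equiv.Perm H) (a : H) :
    (classSize (cycleSetoid σ) a : ℕ) = Function.minimalPeriod σ a := by
  classical
  have := Fintype.ofFinite H
  rw [coe_classSize]
  have h := MulAction.minimalPeriod_eq_card (a := σ) (b := a)
  rw [show Function.minimalPeriod σ a = Function.minimalPeriod (σ • · : H → H) a from rfl, h,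
    ← Nat.card_eq_fintype_card]
  refine Nat.card_congr (Equiv.subtypeEquivRight fun b => ?_)
  rw [MulAction.mem_orbit_iff]
  constructor
  · intro h
    obtain ⟨i, hi⟩ := Setoid.symm' _ h
    exact ⟨⟨σ ^ i, i, rfl⟩, hi⟩
  · rintro ⟨⟨_, i, rfl⟩, hi⟩
    exact Setoid.symm' _ ⟨i, hi⟩

theorem pow_classSize_apply [Finite H] (σ : Equiv.Perm H) (a : H) :
    (σ ^ (classSize (cycleSetoid σ) a : ℕ)) a = a := by
  rw [card_sameCycle, ← Equiv.Perm.iterate_eq_pow]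
  exact Function.isPeriodicPt_minimalPeriod σ a

/-- The elements of the cycle of `a`, enumerated from `a` on. -/
def cycleEquiv [Finite H] (σ : Equiv.Perm H) (a : H) :
    Fin (classSize (cycleSetoid σ) a) ≃ {b // cycleSetoid σ b a} :=
  Equiv.ofBijective (fun i => ⟨(σ ^ (i : ℕ)) a, Setoid.symm' _ ⟨i, by simp⟩⟩) <| by
    have := Fintype.ofFinite {b // cycleSetoid σ b a}
    rw [Fintype.bijective_iff_injective_and_card]
    constructor
    · intro i j hij
      have h := congrArg Subtype.val hij
      simp only [← Equiv.Perm.iterate_eq_pow] at h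
      exact Fin.ext (Function.iterate_injOn_Iio_minimalPeriod
        (by simp [← card_sameCycle]) (by simp [← card_sameCycle]) h)
    · rw [Fintype.card_fin, coe_classSize, Nat.card_eq_fintype_card]

end Orbits

/-! ### Multiplicative weights -/

/-- Splitting along an invariant subset is easier to verify than gluing: restricting a glued family
to the two pieces gives back the two given families. -/
theorem IsMultiplicative.of_subtypePerm {J R : Type*} [CommRing R]
    {w : ∀ H : Type, (J → Equiv.Perm H) → R}
    (h1 : ∀ {H H' : Type} [Finite H] (e : H ≃ H') (σ : J → Equiv.Perm H),
      w H' (fun j => e.permCongr (σ j)) = w H σ)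
    (h2 : ∀ {H : Type} [Finite H] (p : H → Prop) (σ : J → Equiv.Perm H)
      (h : ∀ j a, p (σ j a) ↔ p a),
      w H σ = w {a // p a} (fun j => (σ j).subtypePerm (h j)) *
        w {a // ¬p a} (fun j => (σ j).subtypePerm fun a => not_congr (h j a))) :
    IsMultiplicative w where
  equiv := h1
  glue p _ τ ρ := by
    rw [h2 p _ fun j a => glue_mem_iff p τ ρ j a]
    congr 2
    · funext j
      ext ⟨a, ha⟩
      simp [glue_apply_of_pos p τ ρ j ha]
    · funext j
      ext ⟨a, ha⟩
      simp [glue_apply_of_neg p τ ρ j ha]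

section CycleWeight

variable {R : Type*} [CommRing R]

/-- The product over the cycles of a permutation of a variable attached to their lengths. -/
def cycleWeight (y : ℕ+ → R) (H : Type) (σ : Unit → Equiv.Perm H) : R :=
  classProd (cycleSetoid (σ ())) fun h => y (classSize (cycleSetoid (σ ())) h)

theorem isMultiplicative_cycleWeight (y : ℕ+ → R) : IsMultiplicative (cycleWeight y) := by
  refine .of_subtypePerm ?_ ?_
  · intro H H' _ e σ
    have hr : ∀ a b, cycleSetoid (σ ()) a b ↔ cycleSetoid (e.permCongr (σ ())) (e a) (e b) :=
      fun a b => (sameCycle_permCongr e _ _ _).symm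
    refine (classProd_equiv e hr (fun a => ?_) fun a b h => ?_).symm
    · rw [classSize_equiv e hr]
    · rw [classSize_eq_of_rel _ h]
  · intro H _ p σ h
    have hp : ∀ a b, cycleSetoid (σ ()) a b → (p a ↔ p b) := fun a b h' =>
      prop_iff_of_sameCycle (h ()) h'
    rw [cycleWeight, ← classProd_mul_classProd p hp fun a b h' => by rw [classSize_eq_of_rel _ h']]
    simp only [cycleWeight, cycleSetoid_subtypePerm]
    congr 1
    · exact classProd_eq_of_rel fun a => by rw [classSize_comap hp]
    · exact classProd_eq_of_rel fun a => by rw [classSize_comap fun a b h' => not_congr (hp a b h')]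

end CycleWeight

/-! ### The value of a ribbon graph as a multiplicative weight on pairs of permutations -/

section RibbonWeight

variable {V : Type*} [NormedAddCommGroup V] [InnerProductSpace ℝ V]
variable {ι : Type*} [Fintype ι] [DecidableEq ι]
variable {R : Type*} [CommRing R] [Algebra ℂ R]
variable {H H' : Type*}

/-- The propagator of the edge of a half-edge. -/
def edgeValue (e : Module.Basis ι ℝ V) (f : H → H) (c : H → ι) (h : H) : ℂ :=
  ((casimir e (c h) (c (f h)) : ℝ) : ℂ)

/-- The contribution of the vertex of a half-edge. -/
def vertexValue (e : Module.Basis ι ℝ V) (T : Tensors V) (x : ℕ+ → R) (σ : Equiv.Perm H)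
    (c : H → ι) (h : H) : R :=
  x (classSize (cycleSetoid σ) h) * algebraMap ℂ R
    (T (classSize (cycleSetoid σ) h) fun i => (1 : ℂ) ⊗ₜ[ℝ] e (c ((σ ^ (i : ℕ)) h)))

/-- The value of a ribbon graph with coloured half-edges. -/
def colouredValue (e : Module.Basis ι ℝ V) (T : Tensors V) (x : ℕ+ → R) (σ f : Equiv.Perm H)
    (c : H → ι) : R :=
  algebraMap ℂ R (classProd (cycleSetoid f) (edgeValue e f c)) *
    classProd (cycleSetoid σ) (vertexValue e T x σ c)

/-- Involutions without fixed points. -/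
def IsPairing (f : Equiv.Perm H) : Prop := ∀ h, f (f h) = h ∧ f h ≠ h

open Classical in
/-- The value of the ribbon graph given by a permutation `σ false` of the half-edges and an
involution `σ true` without fixed points; other pairs of permutations have weight zero. -/
def ribbonWeight (e : Module.Basis ι ℝ V) (T : Tensors V) (x : ℕ+ → R) (H : Type)
    (σ : Bool → Equiv.Perm H) : R :=
  if IsPairing (σ true) then ∑ᶠ c : H → ι, colouredValue e T x (σ false) (σ true) c else 0

theorem casimir_comm (e : Module.Basis ι ℝ V) (i j : ι) : casimir e i j = casimir e j i := by
  have h : (Matrix.gram ℝ e).transpose = Matrix.gram ℝ e := by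
    ext i j
    simp [Matrix.gram, real_inner_comm]
  rw [casimir, casimir]
  conv_lhs => rw [← h, ← Matrix.transpose_nonsing_inv]
  rfl

theorem edgeValue_apply {e : Module.Basis ι ℝ V} {f : H → H} (hf : ∀ h, f (f h) = h) (c : H → ι)
    (h : H) : edgeValue e f c (f h) = edgeValue e f c h := by
  rw [edgeValue, edgeValue, hf, casimir_comm]

/-- Shifting a sequence with `g k = g 0` by one place rotates its first `k` terms. -/
theorem IsCyclic.apply_succ {T : Tensors V} (hT : IsCyclic T) (k : ℕ+) (g : ℕ → ℂ ⊗[ℝ] V)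
    (hg : g k = g 0) : (T k fun i => g (i + 1)) = T k fun i => g i := by
  rw [← hT k fun i => g (i + 1)]
  congr 1
  funext i
  obtain ⟨j, rfl⟩ := (finRotate k).surjective i
  rw [Equiv.symm_apply_apply]
  obtain ⟨k, hk⟩ := k
  obtain ⟨k, rfl⟩ := Nat.exists_eq_succ_of_ne_zero hk.ne'
  change Fin (k + 1) at j
  change g (k + 1) = g 0 at hg
  change g (j + 1) = g (finRotate (k + 1) j)
  -- Only the last index wraps around, and there `hg` closes the cycle.
  rcases eq_or_ne j (Fin.last k) with rfl | hj
  · simp [hg]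
  · rw [coe_finRotate_of_ne_last hj]

omit [Fintype ι] [DecidableEq ι] in
theorem vertexValue_congr (e : Module.Basis ι ℝ V) (T : Tensors V) (x : ℕ+ → R)
    {σ : Equiv.Perm H} {σ' : Equiv.Perm H'} {c : H → ι} {c' : H' → ι} {h : H} {h' : H'}
    (hs : classSize (cycleSetoid σ) h = classSize (cycleSetoid σ') h')
    (hc : ∀ i : ℕ, c ((σ ^ i) h) = c' ((σ' ^ i) h')) :
    vertexValue e T x σ c h = vertexValue e T x σ' c' h' := by
  -- The number of arguments of `T k` depends on `k`. Indexing the arguments by all of `ℕ` frees the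
  -- expression from this dependence, so that equal class sizes can be rewritten.
  let F : ℕ+ → (ℕ → ι) → R := fun k g =>
    x k * algebraMap ℂ R (T k fun i => (1 : ℂ) ⊗ₜ[ℝ] e (g i))
  change F _ (fun i => c ((σ ^ i) h)) = F _ fun i => c' ((σ' ^ i) h')
  rw [hs, funext hc]

omit [Fintype ι] [DecidableEq ι] in
-- Cyclic invariance: the contribution of a vertex does not depend on the half-edge from which the
-- enumeration starts.
theorem vertexValue_apply [Finite H] {e : Module.Basis ι ℝ V} {T : Tensors V} (hT : IsCyclic T)
    (x : ℕ+ → R) (σ : Equiv.Perm H) (c : H → ι) (h : H) :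
    vertexValue e T x σ c (σ h) = vertexValue e T x σ c h := by
  have h1 : classSize (cycleSetoid σ) (σ h) = classSize (cycleSetoid σ) h :=
    classSize_eq_of_rel _ (Equiv.Perm.sameCycle_apply_left.2 (Equiv.Perm.SameCycle.refl σ h))
  simp only [vertexValue]
  rw [h1, ← hT.apply_succ _ (fun i => (1 : ℂ) ⊗ₜ[ℝ] e (c ((σ ^ i) h)))
    (by simp only [pow_classSize_apply, pow_zero, Equiv.Perm.one_apply])]
  simp [pow_succ]

theorem colouredValue_equiv [Finite H'] {e : Module.Basis ι ℝ V} {T : Tensors V} (hT : IsCyclic T)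
    (x : ℕ+ → R) (g : H ≃ H') (σ : Equiv.Perm H) {f : Equiv.Perm H} (hf : ∀ h, f (f h) = h)
    (c : H' → ι) :
    colouredValue e T x (g.permCongr σ) (g.permCongr f) c = colouredValue e T x σ f (c ∘ g) := by
  have hr : ∀ (σ : Equiv.Perm H) a b,
      cycleSetoid σ a b ↔ cycleSetoid (g.permCongr σ) (g a) (g b) :=
    fun σ a b => (sameCycle_permCongr g _ _ _).symm
  rw [colouredValue, colouredValue]
  congr 2
  · refine (classProd_equiv g (hr f) (fun a => ?_) fun a b => eq_of_sameCycle fun a => ?_).symm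
    · simp [edgeValue]
    · exact edgeValue_apply (fun h => by simp [hf]) _ _
  · refine (classProd_equiv g (hr σ) (fun a => ?_) fun a b => eq_of_sameCycle fun a => ?_).symm
    · exact vertexValue_congr e T x (classSize_equiv g (hr σ) a).symm fun i => by
        simp [permCongr_pow_apply]
    · exact vertexValue_apply hT _ _ _ _

theorem colouredValue_subtypePerm [Finite H] {e : Module.Basis ι ℝ V} {T : Tensors V}
    (hT : IsCyclic T) (x : ℕ+ → R) (p : H → Prop) (σ : Equiv.Perm H) {f : Equiv.Perm H}
    (hf : ∀ h, f (f h) = h) (hp : ∀ a, p (σ a) ↔ p a) (hp' : ∀ a, p (f a) ↔ p a) (c : H → ι) :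
    colouredValue e T x σ f c =
      colouredValue e T x (σ.subtypePerm hp) (f.subtypePerm hp') (fun a : {a // p a} => c a) *
      colouredValue e T x (σ.subtypePerm fun a => not_congr (hp a))
        (f.subtypePerm fun a => not_congr (hp' a)) (fun a : {a // ¬p a} => c a) := by
  have h1 : ∀ {p : H → Prop} (hp : ∀ a, p (f a) ↔ p a),
      classProd (cycleSetoid (f.subtypePerm hp)) (edgeValue e (f.subtypePerm hp)
        (fun a : {a // p a} => c a)) =
      classProd ((cycleSetoid f).comap (Subtype.val : {a // p a} → H))
        fun a => edgeValue e f c a := by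
    intro p hp
    rw [cycleSetoid_subtypePerm]
    rfl
  have h2 : ∀ {p : H → Prop} (hp : ∀ a, p (σ a) ↔ p a),
      classProd (cycleSetoid (σ.subtypePerm hp)) (vertexValue e T x (σ.subtypePerm hp)
        (fun a : {a // p a} => c a)) =
      classProd ((cycleSetoid σ).comap (Subtype.val : {a // p a} → H))
        fun a => vertexValue e T x σ c a := by
    intro p hp
    refine classProd_equiv (Equiv.refl _) (fun a b => ?_) (fun a => ?_) fun a b h => ?_
    · rw [cycleSetoid_subtypePerm]; rfl
    · have hs : classSize (cycleSetoid (σ.subtypePerm hp)) a = classSize (cycleSetoid σ) a := by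
        rw [cycleSetoid_subtypePerm,
          classSize_comap (r := cycleSetoid σ) fun a b => prop_iff_of_sameCycle hp]
      exact vertexValue_congr e T x hs fun i => by simp
    · exact eq_of_sameCycle (vertexValue_apply hT x σ c) h
  rw [colouredValue, colouredValue, colouredValue, h1 hp', h1 fun a => not_congr (hp' a), h2 hp,
    h2 fun a => not_congr (hp a), mul_mul_mul_comm, ← map_mul,
    classProd_mul_classProd p (fun a b => prop_iff_of_sameCycle hp') fun a b =>
      eq_of_sameCycle (edgeValue_apply hf c),
    classProd_mul_classProd p (fun a b => prop_iff_of_sameCycle hp) fun a b =>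
      eq_of_sameCycle (vertexValue_apply hT x σ c)]

/-- A colouring of a disjoint union is a pair of colourings, so the contraction factorizes; likewise
an involution is a pairing iff both of its restrictions are. -/
theorem isMultiplicative_ribbonWeight (e : Module.Basis ι ℝ V) {T : Tensors V} (hT : IsCyclic T)
    (x : ℕ+ → R) : IsMultiplicative (ribbonWeight e T x) := by
  classical
  refine .of_subtypePerm ?_ ?_
  · intro H H' _ g σ
    have := Finite.of_equiv H g
    have h : IsPairing (g.permCongr (σ true)) ↔ IsPairing (σ true) := by
      rw [IsPairing, ← g.forall_congr_right]
      simp [IsPairing]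
    rw [ribbonWeight, ribbonWeight]
    by_cases hσ : IsPairing (σ true)
    · rw [if_pos hσ, if_pos (h.2 hσ), ← finsum_comp_equiv (g.arrowCongr (Equiv.refl ι))]
      refine finsum_congr fun c => ?_
      rw [colouredValue_equiv hT x g _ fun h => (hσ h).1]
      congr 1
      funext a
      simp
    · rw [if_neg hσ, if_neg (mt h.1 hσ)]
  · intro H _ p σ h
    have := Fintype.ofFinite H
    have h' : IsPairing (σ true) ↔ IsPairing ((σ true).subtypePerm (h true)) ∧
        IsPairing ((σ true).subtypePerm (p := fun a => ¬p a) fun a => not_congr (h true a)) := by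
      simp only [IsPairing, Subtype.forall, Subtype.ext_iff, Equiv.Perm.subtypePerm_apply, ne_eq]
      exact ⟨fun h => ⟨fun a _ => h a, fun a _ => h a⟩, fun h a => by
        by_cases ha : p a
        exacts [h.1 a ha, h.2 a ha]⟩
    rw [ribbonWeight, ribbonWeight, ribbonWeight]
    by_cases hσ : IsPairing (σ true)
    · rw [if_pos hσ, if_pos (h'.1 hσ).1, if_pos (h'.1 hσ).2]
      simp only [finsum_eq_sum_of_fintype]
      rw [Finset.sum_mul_sum, ← Finset.sum_product', Finset.univ_product_univ]
      refine Fintype.sum_equiv (Equiv.piEquivPiSubtypeProd p fun _ => ι) _ _ fun c => ?_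
      exact colouredValue_subtypePerm hT x p (σ false) (fun h => (hσ h).1) (h false) (h true) c
    · rw [if_neg hσ]
      rw [h', not_and_or] at hσ
      rcases hσ with hσ | hσ <;> simp [hσ]

end RibbonWeight

/-! ### Wick's formula -/

section Wick

variable {V : Type*} [NormedAddCommGroup V] [InnerProductSpace ℝ V] [FiniteDimensional ℝ V]
  [MeasurableSpace V] [BorelSpace V]

theorem integrable_exp_neg_mul_norm_sq {b : ℝ} (hb : 0 < b) :
    Integrable (fun v : V => Real.exp (-b * ‖v‖ ^ 2)) := by
  have h := GaussianFourier.integrable_cexp_neg_mul_sq_norm_add (V := V) (b := b)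
    (by simpa using hb) 0 0
  refine (h.norm).congr (.of_forall fun v => ?_)
  simp only [inner_zero_left, zero_mul, add_zero, Complex.norm_exp]
  congr 1
  norm_cast

omit [FiniteDimensional ℝ V] [MeasurableSpace V] [BorelSpace V] in
theorem exp_gaussian_eq (v : V) :
    Real.exp (-(1 / 2) * inner ℝ v v) = Real.exp (-(1 / 2 : ℝ) * ‖v‖ ^ 2) := by
  rw [real_inner_self_eq_norm_sq]

theorem integrable_exp_gaussian :
    Integrable (fun v : V => Real.exp (-(1 / 2) * inner ℝ v v)) := by
  simp_rw [exp_gaussian_eq]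
  exact integrable_exp_neg_mul_norm_sq (by norm_num)

instance : IsProbabilityMeasure (gaussian V) :=
  isProbabilityMeasure_tilted integrable_exp_gaussian

theorem integrable_gaussian_iff {E : Type*} [NormedAddCommGroup E] [NormedSpace ℝ E] {g : V → E} :
    Integrable g (gaussian V) ↔
      Integrable (fun v : V => Real.exp (-(1 / 2) * inner ℝ v v) • g v) :=
  integrable_tilted_iff integrable_exp_gaussian _

theorem pow_mul_exp_bounded (n : ℕ) {b : ℝ} (hb : 0 < b) :
    ∃ M : ℝ, ∀ t : ℝ, 0 ≤ t → t ^ n * Real.exp (-b * t ^ 2) ≤ M := by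
  obtain ⟨M, hM⟩ : ∃ M : ℝ, ∀ s : ℝ, 0 ≤ s → s ^ n * Real.exp (-b * s) ≤ M := by
    refine ⟨n ! / b ^ n, fun s hs => ?_⟩
    have h1 := Real.pow_div_factorial_le_exp (b * s) (by positivity) n
    rw [neg_mul, Real.exp_neg, ← div_eq_mul_inv, div_le_div_iff₀ (Real.exp_pos _) (by positivity)]
    rw [div_le_iff₀ (by positivity), mul_pow] at h1
    linarith
  refine ⟨1 + M, fun t ht => ?_⟩
  have hM' := hM (t ^ 2) (by positivity)
  have he := Real.exp_pos (-b * t ^ 2)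
  have he1 : Real.exp (-b * t ^ 2) ≤ 1 := Real.exp_le_one_iff.2 (by nlinarith [sq_nonneg t])
  -- This reduces to the bound in `s = t ^ 2`; it follows from `(t ^ n - 1) ^ 2 ≥ 0`.
  have h2 : t ^ n ≤ 1 + (t ^ 2) ^ n := by
    rw [← pow_mul, mul_comm, pow_mul]
    nlinarith [sq_nonneg (t ^ n - 1), pow_nonneg ht n]
  nlinarith

theorem integrable_pow_mul_exp (n : ℕ) {a : ℝ} (ha : a < 1 / 2) :
    Integrable (fun v : V => ‖v‖ ^ n * Real.exp (a * ‖v‖ ^ 2)) (gaussian V) := by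
  rw [integrable_gaussian_iff]
  -- Half of the gap between `a` and 1/2 absorbs the power of the norm; the other half keeps the
  -- integrand Gaussian.
  set b := (1 / 2 - a) / 2 with hb
  have hb0 : 0 < b := by rw [hb]; linarith
  obtain ⟨M, hM⟩ := pow_mul_exp_bounded n hb0
  refine ((integrable_exp_neg_mul_norm_sq (V := V) hb0).const_mul M).mono'
    (by fun_prop) (.of_forall fun v => ?_)
  rw [exp_gaussian_eq, smul_eq_mul, Real.norm_of_nonneg (by positivity)]
  have h1 : Real.exp (-(1 / 2 : ℝ) * ‖v‖ ^ 2) * (‖v‖ ^ n * Real.exp (a * ‖v‖ ^ 2)) =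
      ‖v‖ ^ n * Real.exp (-b * ‖v‖ ^ 2) * Real.exp (-b * ‖v‖ ^ 2) := by
    rw [mul_left_comm, mul_assoc, ← Real.exp_add, ← Real.exp_add]
    congr 2
    rw [hb]
    ring
  rw [h1]
  exact mul_le_mul_of_nonneg_right (hM _ (norm_nonneg v)) (Real.exp_pos _).le

theorem integrable_prod_inner {H : Type*} (u : H → V) (I : Finset H) :
    Integrable (fun v : V => ∏ h ∈ I, inner ℝ (u h) v) (gaussian V) := by
  have h0 := (integrable_pow_mul_exp (V := V) I.card (a := 0) (by norm_num)).const_mul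
    (∏ h ∈ I, ‖u h‖)
  refine h0.mono' (by fun_prop) (.of_forall fun v => ?_)
  rw [norm_prod]
  refine (Finset.prod_le_prod (fun _ _ => norm_nonneg _)
    fun h _ => norm_inner_le_norm (u h) v).trans ?_
  simp [Finset.prod_mul_distrib]

open Classical in
-- Gaussian integration by parts: the derivative of the density along `u₀` is `-⟪u₀, v⟫` times the
-- density, so the factor `⟪u₀, v⟫` can be traded for a derivative of the remaining product along
-- `u₀`.
theorem integral_inner_mul_prod_inner {H : Type*} (u : H → V) (u₀ : V) (I : Finset H) :
    ∫ v, inner ℝ u₀ v * ∏ h ∈ I, inner ℝ (u h) v ∂(gaussian V) =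
      ∑ h ∈ I, inner ℝ u₀ (u h) * ∫ v, ∏ h ∈ I.erase h, inner ℝ (u h) v ∂(gaussian V) := by
  set G : V → ℝ := fun v => Real.exp (-(1 / 2) * inner ℝ v v) with hG
  have hP : ∀ v, HasFDerivAt (fun v => ∏ h ∈ I, inner ℝ (u h) v)
      (∑ h ∈ I, (∏ j ∈ I.erase h, inner ℝ (u j) v) • innerSL ℝ (u h)) v := fun v =>
    HasFDerivAt.finsetProd fun h _ => (innerSL ℝ (u h)).hasFDerivAt
  have hGd : ∀ v, HasFDerivAt G (G v • -(innerSL ℝ v)) v := fun v => by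
    have h1 : HasFDerivAt (fun v : V => -(1 / 2) * (inner ℝ v v : ℝ)) (-(innerSL ℝ v)) v := by
      have h2 := ((hasFDerivAt_id v).inner ℝ (hasFDerivAt_id v)).const_mul (-(1 / 2 : ℝ))
      refine h2.congr_fderiv ?_
      ext w
      simp [fderivInnerCLM_apply, real_inner_comm]
      ring
    exact h1.exp
  have hint : ∀ {g : V → ℝ}, Integrable g (gaussian V) → Integrable fun v => g v * G v := by
    intro g hg
    refine (integrable_gaussian_iff.1 hg).congr (.of_forall fun v => ?_)
    simp [hG, mul_comm]
  have hi1 : Integrable (fun v => inner ℝ u₀ v * ∏ h ∈ I, inner ℝ (u h) v) (gaussian V) := by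
    -- The vector `u₀` is adjoined to the family under the extra index `none`.
    have := integrable_prod_inner (fun o : Option H => o.elim u₀ u) (Finset.insertNone I)
    simpa [Finset.prod_insertNone] using this
  have hi2 : Integrable (fun v => ∑ h ∈ I, inner ℝ u₀ (u h) *
      ∏ h ∈ I.erase h, inner ℝ (u h) v) (gaussian V) :=
    integrable_finsetSum _ fun h _ => (integrable_prod_inner u _).const_mul _
  have key := integral_bilinear_hasFDerivAt_right_eq_neg_left_of_integrable
    (μ := (volume : Measure V)) (v := u₀) (B := ContinuousLinearMap.mul ℝ ℝ)
    (f := fun v => ∏ h ∈ I, inner ℝ (u h) v) (g := G)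
    (f' := fun v => ∑ h ∈ I, (∏ j ∈ I.erase h, inner ℝ (u j) v) • innerSL ℝ (u h))
    (g' := fun v => G v • -(innerSL ℝ v))
    ((hint hi2).congr (.of_forall fun v => by
      simp [real_inner_comm, mul_comm, Finset.mul_sum]))
    ((hint hi1).neg.congr (.of_forall fun v => by
      simp [real_inner_comm]; ring))
    (hint (integrable_prod_inner u I)) (fun v _ => hP v) fun v _ => hGd v
  have hgauss : ∀ g : V → ℝ, ∫ v, g v ∂(gaussian V) = (∫ v, G v)⁻¹ * ∫ v, g v * G v := by
    intro g
    rw [gaussian, integral_tilted, ← integral_const_mul]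
    refine integral_congr_ae (.of_forall fun v => ?_)
    simp only [smul_eq_mul]
    ring
  have h3 : ∫ v, inner ℝ u₀ v * ∏ h ∈ I, inner ℝ (u h) v ∂(gaussian V) =
      ∫ v, ∑ h ∈ I, inner ℝ u₀ (u h) * ∏ h ∈ I.erase h, inner ℝ (u h) v ∂(gaussian V) := by
    rw [hgauss, hgauss]
    congr 1
    rw [← neg_inj, ← integral_neg]
    refine Eq.trans (integral_congr_ae (.of_forall fun v => ?_)) (key.trans ?_)
    · simp [real_inner_comm]; ring
    · congr 1
      refine integral_congr_ae (.of_forall fun v => ?_)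
      simp [real_inner_comm, mul_comm, Finset.mul_sum]
  rw [h3, integral_finsetSum _ fun h _ => (integrable_prod_inner u _).const_mul _]
  simp_rw [integral_const_mul]

theorem classProd_of_forall_rel {H M : Type*} [CommMonoid M] {r : Setoid H} (h : ∀ a b, r a b)
    {f : H → M} (hf : ∀ a b, r a b → f a = f b) (a : H) : classProd r f = f a := by
  have : Unique (Quotient r) :=
    { default := ⟦a⟧
      uniq := fun q => by
        induction q using Quotient.inductionOn with | _ b
        exact Quotient.sound (h b a) }
  rw [classProd, finprod_unique]
  exact hf _ _ (h _ _)

theorem IsPairing.subtypePerm_mem {H : Type*} {f : Equiv.Perm H} (hf : IsPairing f) {a b : H}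
    (hab : f a = b) (x : H) : ¬(f x = a ∨ f x = b) ↔ ¬(x = a ∨ x = b) := by
  have h1 : f b = a := by rw [← hab, (hf a).1]
  have h2 : f x = a ↔ x = b := by rw [← h1, f.apply_eq_iff_eq]
  have h3 : f x = b ↔ x = a := by rw [← hab, f.apply_eq_iff_eq]
  rw [h2, h3, or_comm]

open Classical in
-- A pairing that matches `a` with `b` is the same as a pairing of the remaining points. The
-- symmetry of `g` makes the factor of the removed pair independent of its chosen representative.
theorem sum_isPairing_apply_eq {H M : Type*} [Fintype H] [DecidableEq H] [CommRing M]
    (g : H → H → M)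
    (hg : ∀ a b, g a b = g b a) {a b : H} (hab : a ≠ b) :
    ∑ f : Equiv.Perm H with IsPairing f ∧ f a = b, classProd (cycleSetoid f) (fun h => g h (f h)) =
      g a b * ∑ f : Equiv.Perm {x // ¬(x = a ∨ x = b)} with IsPairing f,
        classProd (cycleSetoid f) (fun h => g h (f h)) := by
  rw [Finset.mul_sum]
  refine Finset.sum_bij (fun f hf => f.subtypePerm
    ((Finset.mem_filter.1 hf).2.1.subtypePerm_mem (Finset.mem_filter.1 hf).2.2)) ?_ ?_ ?_ ?_
  · intro f hf
    simp only [Finset.mem_filter, Finset.mem_univ, true_and] at hf ⊢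
    rintro ⟨x, hx⟩
    simpa [Subtype.ext_iff] using hf.1 x
  · intro f hf f' hf' hff
    simp only [Finset.mem_filter, Finset.mem_univ, true_and] at hf hf'
    ext x
    by_cases hx : x = a ∨ x = b
    · rcases hx with rfl | rfl
      · rw [hf.2, hf'.2]
      · rw [← hf.2, (hf.1 a).1, hf.2, ← hf'.2, (hf'.1 a).1]
    · simpa using congrArg Subtype.val (DFunLike.congr_fun hff ⟨x, hx⟩)
  · intro ρ hρ
    simp only [Finset.mem_filter, Finset.mem_univ, true_and] at hρ
    have h1 : ∀ x (hx : ¬(x = a ∨ x = b)),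
        (Equiv.swap a b * Equiv.Perm.ofSubtype ρ) x = ρ ⟨x, hx⟩ := by
      intro x hx
      have h2 := not_or.1 (ρ ⟨x, hx⟩).2
      rw [Equiv.Perm.mul_apply, Equiv.Perm.ofSubtype_apply_of_mem ρ hx,
        Equiv.swap_apply_of_ne_of_ne h2.1 h2.2]
    have ha : (Equiv.swap a b * Equiv.Perm.ofSubtype ρ) a = b := by
      rw [Equiv.Perm.mul_apply, Equiv.Perm.ofSubtype_apply_of_not_mem ρ (by simp),
        Equiv.swap_apply_left]
    have hb : (Equiv.swap a b * Equiv.Perm.ofSubtype ρ) b = a := by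
      rw [Equiv.Perm.mul_apply, Equiv.Perm.ofSubtype_apply_of_not_mem ρ (by simp),
        Equiv.swap_apply_right]
    -- The inverse construction extends `ρ` by the identity and then exchanges `a` and `b`.
    refine ⟨Equiv.swap a b * Equiv.Perm.ofSubtype ρ, ?_, ?_⟩
    · simp only [Finset.mem_filter, Finset.mem_univ, true_and]
      refine ⟨fun x => ?_, ha⟩
      by_cases hx : x = a ∨ x = b
      · rcases hx with rfl | rfl
        · rw [ha, hb]; exact ⟨rfl, hab.symm⟩
        · rw [hb, ha]; exact ⟨rfl, hab⟩
      · rw [h1 x hx, h1 _ (ρ ⟨x, hx⟩).2]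
        exact ⟨congrArg Subtype.val (hρ ⟨x, hx⟩).1,
          fun h => (hρ ⟨x, hx⟩).2 (Subtype.ext h)⟩
    · ext ⟨x, hx⟩
      rw [Equiv.Perm.subtypePerm_apply]
      exact h1 x hx
  · intro f hf
    simp only [Finset.mem_filter, Finset.mem_univ, true_and] at hf
    have hfb : f b = a := by rw [← hf.2, (hf.1 a).1]
    have hp := hf.1.subtypePerm_mem hf.2
    have hc : ∀ x y, f.SameCycle x y → g x (f x) = g y (f y) := fun x y =>
      eq_of_sameCycle (f := fun x => g x (f x)) fun x => by rw [(hf.1 x).1, hg]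
    rw [← classProd_mul_classProd (fun x => x = a ∨ x = b)
      (fun x y h => not_iff_not.1 (prop_iff_of_sameCycle (σ := f)
        (p := fun x => ¬(x = a ∨ x = b)) hp h)) hc]
    congr 1
    · rw [classProd_of_forall_rel (r := (cycleSetoid f).comap Subtype.val) (fun x y => ?_)
        (fun x y h => hc _ _ h) ⟨a, Or.inl rfl⟩]
      · rw [hf.2]
      · change f.SameCycle x y
        have h1 : f.SameCycle a b := ⟨1, by simp [hf.2]⟩
        obtain ⟨x, rfl | rfl⟩ := x <;> obtain ⟨y, rfl | rfl⟩ := y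
        exacts [.refl _ _, h1, h1.symm, .refl _ _]
    · rw [cycleSetoid_subtypePerm]
      rfl

open Classical in
-- Wick's formula. Integration by parts in the factor of a fixed point `a` chooses its partner `b`;
-- the rest is the same integral over the complement of `{a, b}`. The induction ranges over all
-- finite types, since this complement is a subtype.
theorem integral_prod_inner (n : ℕ) : ∀ {H : Type} [Fintype H] [DecidableEq H]
    (_ : Fintype.card H = n) (u : H → V),
    ∫ v, ∏ h, inner ℝ (u h) v ∂(gaussian V) =
      ∑ f : Equiv.Perm H with IsPairing f,
        classProd (cycleSetoid f) (fun h => (inner ℝ (u h) (u (f h)) : ℝ)) := by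
  induction n using Nat.strong_induction_on with | _ n ih
  intro H _ _ hn u
  rcases isEmpty_or_nonempty H with hH | ⟨⟨a⟩⟩
  · have h1 : ∀ f : Equiv.Perm H, IsPairing f := fun f h => hH.elim h
    have h2 : IsEmpty (Quotient (cycleSetoid (default : Equiv.Perm H))) :=
      ⟨fun q => hH.elim q.out⟩
    simp [h1, classProd, finprod_of_isEmpty]
  · have h1 : ∀ v, ∏ h, inner ℝ (u h) v =
        inner ℝ (u a) v * ∏ h ∈ Finset.univ.erase a, inner ℝ (u h) v := fun v =>
      (Finset.mul_prod_erase _ _ (Finset.mem_univ a)).symm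
    simp_rw [h1]
    rw [integral_inner_mul_prod_inner]
    rw [← Finset.sum_fiberwise (Finset.univ.filter fun f : Equiv.Perm H => IsPairing f)
      (fun f => f a), ← Finset.add_sum_erase _ _ (Finset.mem_univ a)]
    -- A pairing has no fixed point, so the term `b = a` is absent.
    have h2 : (Finset.univ.filter fun f : Equiv.Perm H => IsPairing f).filter
        (fun f => f a = a) = ∅ := by
      ext f
      simp only [Finset.mem_filter, Finset.mem_univ, true_and, Finset.notMem_empty, iff_false,
        not_and]
      exact fun hf => (hf a).2
    rw [h2, Finset.sum_empty, zero_add]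
    refine Finset.sum_congr rfl fun b hb => ?_
    have hab : a ≠ b := (Finset.ne_of_mem_erase hb).symm
    have hcard : Fintype.card {x // ¬(x = a ∨ x = b)} < n := by
      rw [← hn]
      exact Fintype.card_subtype_lt (x := a) (by simp)
    rw [Finset.filter_filter, sum_isPairing_apply_eq
      (fun x y => (inner ℝ (u x) (u y) : ℝ)) (fun x y => real_inner_comm _ _) hab,
      ← ih _ hcard rfl fun x => u x]
    congr 1
    refine integral_congr_ae (.of_forall fun v => ?_)
    refine Finset.prod_subtype _ (fun x => ?_) _
    simp [and_comm]

end Wick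

/-! ### The sum over all ribbon graphs as a Gaussian integral -/

section Integral

variable {V : Type*} [NormedAddCommGroup V] [InnerProductSpace ℝ V]
variable {ι : Type*} [Fintype ι] [DecidableEq ι]
variable {R : Type*} [CommRing R] [Algebra ℂ R]
variable {H : Type}

theorem classProd_mul_distrib {H M : Type*} [CommMonoid M] [Finite H] (r : Setoid H) (f g : H → M) :
    classProd r (fun h => f h * g h) = classProd r f * classProd r g := by
  have := Fintype.ofFinite H
  classical
  simp only [classProd_eq_prod, Finset.prod_mul_distrib]

theorem map_classProd {H M N F : Type*} [CommMonoid M] [CommMonoid N] [FunLike F M N]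
    [MonoidHomClass F M N] [Finite H] (φ' : F) (r : Setoid H) (f : H → M) :
    φ' (classProd r f) = classProd r fun h => φ' (f h) := by
  have := Fintype.ofFinite H
  classical
  simp only [classProd_eq_prod, map_prod]

theorem colouredValue_eq [Finite H] (e : Module.Basis ι ℝ V) (T : Tensors V) (x : ℕ+ → R)
    (σ f : Equiv.Perm H) (c : H → ι) :
    colouredValue e T x σ f c = classProd (cycleSetoid σ) (fun h => x (classSize (cycleSetoid σ) h))
      * algebraMap ℂ R (colouredValue e T 1 σ f c) := by
  have h : classProd (cycleSetoid σ) (vertexValue e T x σ c) =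
      classProd (cycleSetoid σ) (fun h => x (classSize (cycleSetoid σ) h)) *
        algebraMap ℂ R (classProd (cycleSetoid σ) (vertexValue e T 1 σ c)) := by
    rw [map_classProd (algebraMap ℂ R), ← classProd_mul_distrib]
    exact classProd_eq_of_rel fun h => by simp [vertexValue]
  simp only [colouredValue, h, Algebra.algebraMap_self, RingHom.id_apply, map_mul]
  ring

/-- The basis dual to `e` for the scalar product. -/
def dualVector (e : Module.Basis ι ℝ V) (i : ι) : V := ∑ j, casimir e i j • e j

theorem isUnit_gram (e : Module.Basis ι ℝ V) : IsUnit (Matrix.gram ℝ e).det := by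
  rw [← Matrix.isUnit_iff_isUnit_det]
  exact (Matrix.posDef_gram_of_linearIndependent e.linearIndependent).isUnit

theorem inner_dualVector_basis (e : Module.Basis ι ℝ V) (i k : ι) :
    inner ℝ (dualVector e i) (e k) = if i = k then 1 else 0 := by
  have h := congrFun (congrFun (Matrix.nonsing_inv_mul _ (isUnit_gram e)) i) k
  rw [Matrix.mul_apply, Matrix.one_apply] at h
  rw [← h, dualVector, sum_inner]
  refine Finset.sum_congr rfl fun j _ => ?_
  rw [real_inner_smul_left]
  rfl

theorem inner_dualVector (e : Module.Basis ι ℝ V) (i : ι) (v : V) :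
    inner ℝ (dualVector e i) v = e.repr v i := by
  conv_lhs => rw [← e.sum_repr v]
  simp only [inner_sum, real_inner_smul_right, inner_dualVector_basis]
  simp

/-- Coordinates are scalar products with dual vectors, so this makes the Casimir coefficient the
covariance of two coordinates, as Wick's formula requires. -/
theorem inner_dualVector_dualVector (e : Module.Basis ι ℝ V) (i j : ι) :
    inner ℝ (dualVector e i) (dualVector e j) = casimir e i j := by
  change inner ℝ (dualVector e i) (∑ k, casimir e j k • e k) = _
  simp [inner_sum, real_inner_smul_right, inner_dualVector_basis, casimir_comm e j i]

omit [DecidableEq ι] in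
theorem Tensors.diag_eq_sum (e : Module.Basis ι ℝ V) (T : Tensors V) (k : ℕ+) (v : V) :
    T.diag k v = ∑ d : Fin k → ι, (T k fun i => (1 : ℂ) ⊗ₜ[ℝ] e (d i)) *
      ∏ i, ((e.repr v (d i) : ℝ) : ℂ) := by
  classical
  have h : (1 : ℂ) ⊗ₜ[ℝ] v = ∑ i, ((e.repr v i : ℝ) : ℂ) • ((1 : ℂ) ⊗ₜ[ℝ] e i) := by
    conv_lhs => rw [← e.sum_repr v]
    rw [TensorProduct.tmul_sum]
    refine Finset.sum_congr rfl fun i _ => ?_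
    rw [TensorProduct.smul_tmul', TensorProduct.tmul_smul, TensorProduct.smul_tmul']
    congr 1
  rw [Tensors.diag, h, MultilinearMap.map_sum]
  refine Finset.sum_congr rfl fun d _ => ?_
  rw [MultilinearMap.map_smul_univ, smul_eq_mul, mul_comm]

/-- The points of a set, enumerated along the cycles of a permutation. -/
def cyclesEquiv [Finite H] (σ : Equiv.Perm H) :
    (Σ q : Quotient (cycleSetoid σ), Fin (classSize (cycleSetoid σ) q.out)) ≃ H :=
  (Equiv.sigmaCongrRight fun q => (cycleEquiv σ q.out).trans
    (Equiv.subtypeEquivRight fun b => by rw [← Quotient.eq, Quotient.out_eq])).trans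
  (Equiv.sigmaFiberEquiv (Quotient.mk (cycleSetoid σ)))

omit [DecidableEq ι] in
-- Expand each factor in coordinates and distribute the product over the cycles: one index tuple per
-- cycle is the same as one colouring of all the points.
theorem classProd_diag_eq_sum [Fintype H] [DecidableEq H] (e : Module.Basis ι ℝ V) (T : Tensors V)
    (σ : Equiv.Perm H) (v : V) :
    classProd (cycleSetoid σ) (fun h => T.diag (classSize (cycleSetoid σ) h) v) =
      ∑ c : H → ι, classProd (cycleSetoid σ) (vertexValue e T (1 : ℕ+ → ℂ) σ c) *
        ∏ h, ((e.repr v (c h) : ℝ) : ℂ) := by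
  classical
  rw [classProd_eq_prod]
  simp_rw [T.diag_eq_sum e]
  rw [Finset.prod_univ_sum, Fintype.piFinset_univ]
  symm
  refine Fintype.sum_equiv (((cyclesEquiv σ).symm.arrowCongr (Equiv.refl ι)).trans
    (Equiv.piCurry fun _ _ => ι)) _ _ fun c => ?_
  rw [classProd_eq_prod, ← (cyclesEquiv σ).prod_comp, Fintype.prod_sigma, ← Finset.prod_mul_distrib]
  refine Finset.prod_congr rfl fun q _ => ?_
  simp only [vertexValue, Pi.one_apply, one_mul, Algebra.algebraMap_self, RingHom.id_apply]
  rfl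

theorem prod_repr_eq [Fintype H] (e : Module.Basis ι ℝ V) (c : H → ι) (v : V) :
    ∏ h, ((e.repr v (c h) : ℝ) : ℂ) =
      ((∏ h, inner ℝ (dualVector e (c h)) v : ℝ) : ℂ) := by
  simp [inner_dualVector]

variable [FiniteDimensional ℝ V] [MeasurableSpace V] [BorelSpace V]

theorem integrable_classProd_diag [Fintype H] (e : Module.Basis ι ℝ V) (T : Tensors V)
    (σ : Equiv.Perm H) :
    Integrable (fun v => classProd (cycleSetoid σ)
      fun h => T.diag (classSize (cycleSetoid σ) h) v) (gaussian V) := by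
  classical
  simp_rw [classProd_diag_eq_sum e, prod_repr_eq]
  refine integrable_finsetSum _ fun c _ => Integrable.const_mul ?_ _
  exact (integrable_prod_inner (fun h => dualVector e (c h)) Finset.univ).ofReal

open Classical in
-- For each colouring, Wick's formula integrates the monomial in the coordinates to the sum over
-- pairings of products of propagators.
theorem sum_colouredValue_eq_integral [Fintype H] [DecidableEq H] (e : Module.Basis ι ℝ V)
    (T : Tensors V)
    (σ : Equiv.Perm H) :
    ∑ f : Equiv.Perm H with IsPairing f, ∑ c : H → ι, colouredValue e T (1 : ℕ+ → ℂ) σ f c =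
      ∫ v, classProd (cycleSetoid σ)
        (fun h => T.diag (classSize (cycleSetoid σ) h) v) ∂(gaussian V) := by
  simp_rw [classProd_diag_eq_sum e, prod_repr_eq]
  rw [integral_finsetSum _ fun c _ => Integrable.const_mul
    (integrable_prod_inner (fun h => dualVector e (c h)) Finset.univ).ofReal _, Finset.sum_comm]
  refine Finset.sum_congr rfl fun c _ => ?_
  rw [integral_const_mul, integral_complex_ofReal, integral_prod_inner _ rfl, Complex.ofReal_sum,
    Finset.mul_sum]
  refine Finset.sum_congr rfl fun f _ => ?_
  simp only [colouredValue, Algebra.algebraMap_self, RingHom.id_apply]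
  rw [mul_comm]
  congr 1
  rw [show ∀ x : ℝ, (x : ℂ) = Complex.ofRealHom x from fun _ => rfl,
    map_classProd Complex.ofRealHom]
  refine classProd_eq_of_rel fun h => ?_
  rw [inner_dualVector_dualVector]
  rfl

open Classical in
-- The sum over pairs of permutations is a sum over `σ false` of a sum over pairings, and the inner
-- sum is a Gaussian integral.
theorem coeff_totalWeight_ribbonWeight (e : Module.Basis ι ℝ V) (T : Tensors V) (n : ℕ)
    (m : ℕ+ →₀ ℕ) :
    MvPowerSeries.coeff m (totalWeight
      (ribbonWeight e T fun k => (MvPowerSeries.X k : MvPowerSeries ℕ+ ℂ)) n) =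
    ∫ v, MvPowerSeries.coeff m (totalWeight (cycleWeight fun k =>
      (MvPowerSeries.X k * MvPowerSeries.C (T.diag k v) : MvPowerSeries ℕ+ ℂ)) n)
      ∂(gaussian V) := by
  set y : Equiv.Perm (Fin n) → ℂ := fun σ => MvPowerSeries.coeff m
    (classProd (cycleSetoid σ) fun h => (MvPowerSeries.X (classSize (cycleSetoid σ) h) :
      MvPowerSeries ℕ+ ℂ)) with hy
  have h1 : ∀ v, MvPowerSeries.coeff m (totalWeight (cycleWeight fun k =>
      (MvPowerSeries.X k * MvPowerSeries.C (T.diag k v) : MvPowerSeries ℕ+ ℂ)) n) =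
      ∑ σ : Equiv.Perm (Fin n), y σ *
        classProd (cycleSetoid σ) fun h => T.diag (classSize (cycleSetoid σ) h) v := by
    intro v
    rw [totalWeight, map_sum]
    refine Fintype.sum_equiv (Equiv.funUnique Unit _) _ _ fun σ => ?_
    simp only [cycleWeight]
    rw [classProd_mul_distrib, ← map_classProd MvPowerSeries.C, MvPowerSeries.coeff_mul_C]
    rfl
  simp_rw [h1]
  rw [integral_finsetSum _ fun σ _ => (integrable_classProd_diag e T σ).const_mul _]
  simp_rw [integral_const_mul, ← sum_colouredValue_eq_integral e]
  rw [totalWeight, map_sum]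
  simp_rw [Finset.sum_filter, Finset.mul_sum]
  rw [← Fintype.sum_prod_type']
  refine Fintype.sum_equiv (Equiv.boolArrowEquivProd _) _ _ fun σ => ?_
  change _ = y (σ false) * if IsPairing (σ true) then
    ∑ c, colouredValue e T 1 (σ false) (σ true) c else 0
  rw [ribbonWeight]
  split_ifs with h
  · rw [finsum_eq_sum_of_fintype, map_sum, Finset.mul_sum]
    refine Finset.sum_congr rfl fun c _ => ?_
    rw [colouredValue_eq, MvPowerSeries.algebraMap_apply, Algebra.algebraMap_self,
      RingHom.id_apply, MvPowerSeries.coeff_mul_C]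
  · simp

end Integral

/-! ### The Euler operator on formal power series -/

section Euler

open MvPowerSeries

/-- The weight of a monomial, where `x_k` has weight `k`. -/
abbrev wt : (ℕ+ →₀ ℕ) →+ ℕ := Finsupp.weight fun k : ℕ+ => (k : ℕ)

theorem wt_eq_zero_iff {m : ℕ+ →₀ ℕ} : wt m = 0 ↔ m = 0 := by
  refine ⟨fun h => ?_, fun h => by simp [h]⟩
  rw [Finsupp.weight_apply, Finsupp.sum, Finset.sum_eq_zero_iff] at h
  ext k
  by_contra hk
  have h1 := h k (Finsupp.mem_support_iff.2 hk)
  simp only [smul_eq_mul, mul_eq_zero, PNat.ne_zero, or_false] at h1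
  exact hk h1

theorem wt_single (k : ℕ+) : wt (Finsupp.single k 1) = k := by
  simp [Finsupp.weight_single]

/-- The Euler operator `∑ k, k x_k ∂/∂x_k`. -/
def euler (f : MvPowerSeries ℕ+ ℂ) : MvPowerSeries ℕ+ ℂ := fun m => (wt m : ℂ) * coeff m f

theorem coeff_euler (f : MvPowerSeries ℕ+ ℂ) (m : ℕ+ →₀ ℕ) :
    coeff m (euler f) = (wt m : ℂ) * coeff m f := rfl

theorem euler_mul (f g : MvPowerSeries ℕ+ ℂ) : euler (f * g) = euler f * g + f * euler g := by
  classical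
  ext m
  rw [coeff_euler, map_add, coeff_mul, coeff_mul, coeff_mul, Finset.mul_sum,
    ← Finset.sum_add_distrib]
  refine Finset.sum_congr rfl fun x hx => ?_
  rw [← Finset.HasAntidiagonal.mem_antidiagonal.1 hx, map_add, coeff_euler, coeff_euler]
  push_cast
  ring

theorem euler_pow (f : MvPowerSeries ℕ+ ℂ) (n : ℕ) :
    euler (f ^ (n + 1)) = ((n + 1 : ℕ) : ℂ) • (f ^ n * euler f) := by
  induction n with
  | zero => simp
  | succ n ih =>
    rw [pow_succ, euler_mul, ih]
    simp only [Nat.cast_smul_eq_nsmul, nsmul_eq_mul]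
    push_cast
    ring

theorem euler_one : euler 1 = 0 := by
  classical
  ext m
  rw [coeff_euler, coeff_one]
  split_ifs with h <;> simp [h]

theorem euler_injective {f g : MvPowerSeries ℕ+ ℂ} (h0 : constantCoeff f = constantCoeff g)
    (h : euler f = euler g) : f = g := by
  ext m
  rcases eq_or_ne m 0 with rfl | hm
  · exact h0
  · have h1 := congrArg (coeff m) h
    rw [coeff_euler, coeff_euler] at h1
    exact mul_left_cancel₀ (Nat.cast_ne_zero.2 (mt wt_eq_zero_iff.1 hm)) h1

/-- Induction on the weight: since `h` has no constant term, the right-hand coefficient at `m`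
involves only coefficients of `f` of smaller weight, while the left one is a non-zero multiple of
that of `f` at `m`. -/
theorem eq_zero_of_euler_eq_mul {f h : MvPowerSeries ℕ+ ℂ} (h0 : constantCoeff f = 0)
    (hh : constantCoeff h = 0) (hf : euler f = f * h) : f = 0 := by
  classical
  have key : ∀ n : ℕ, ∀ m, wt m = n → coeff m f = 0 := by
    intro n
    induction n using Nat.strong_induction_on with | _ n ih
    intro m hm
    rcases eq_or_ne m 0 with rfl | hm0
    · exact h0
    have h1 := congrArg (coeff m) hf
    rw [coeff_euler, coeff_mul, Finset.sum_eq_zero] at h1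
    · exact (mul_eq_zero.1 h1).resolve_left
        (Nat.cast_ne_zero.2 (mt wt_eq_zero_iff.1 hm0))
    · rintro ⟨a, b⟩ hab
      rw [Finset.HasAntidiagonal.mem_antidiagonal] at hab
      simp only at hab ⊢
      rcases eq_or_ne b 0 with rfl | hb
      · rw [show coeff 0 h = 0 from hh, mul_zero]
      · rw [ih (wt a) _ a rfl, zero_mul]
        rw [← hm, ← hab, map_add]
        have : wt b ≠ 0 := mt wt_eq_zero_iff.1 hb
        lia
  ext m
  simpa using key _ m rfl

theorem eq_of_euler_eq_mul {f g h : MvPowerSeries ℕ+ ℂ} (h0 : constantCoeff f = constantCoeff g)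
    (hh : constantCoeff h = 0) (hf : euler f = f * h) (hg : euler g = g * h) : f = g := by
  rw [← sub_eq_zero]
  refine eq_zero_of_euler_eq_mul (h := h) (by simp [h0]) hh ?_
  rw [sub_mul, ← hf, ← hg]
  ext m
  simp [coeff_euler, mul_sub]

theorem constantCoeff_euler (f : MvPowerSeries ℕ+ ℂ) : constantCoeff (euler f) = 0 := by
  change coeff 0 (euler f) = 0
  simp [coeff_euler]

theorem coeff_pow_eq_zero {a : MvPowerSeries ℕ+ ℂ} (ha : constantCoeff a = 0) {m : ℕ+ →₀ ℕ}
    {n : ℕ} (h : m.degree < n) : coeff m (a ^ n) = 0 := by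
  refine coeff_of_lt_order ?_
  refine lt_of_lt_of_le (Nat.cast_lt.2 h) ?_
  have h1 : (1 : ℕ∞) ≤ a.order := one_le_order_iff_constCoeff_eq_zero.2 ha
  calc (n : ℕ∞) = n • 1 := by simp
    _ ≤ n • a.order := nsmul_le_nsmul_right h1 n
    _ ≤ (a ^ n).order := le_order_pow n

theorem coeff_subst_eq_sum {a : MvPowerSeries ℕ+ ℂ} (ha : constantCoeff a = 0)
    (f : PowerSeries ℂ) {m : ℕ+ →₀ ℕ} {n : ℕ} (h : m.degree < n) :
    coeff m (f.subst a) = coeff m (∑ d ∈ Finset.range n, PowerSeries.coeff d f • a ^ d) := by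
  rw [PowerSeries.coeff_subst (PowerSeries.HasSubst.of_constantCoeff_zero ha), map_sum]
  rw [finsum_eq_sum_of_support_subset (s := Finset.range n)]
  · simp
  · intro d hd
    simp only [Finset.coe_range, Set.mem_Iio]
    by_contra hd'
    exact hd (by simp [coeff_pow_eq_zero ha (h.trans_le (not_lt.1 hd'))])

/-- The chain rule. A given coefficient involves only finitely many powers of `a`, so it suffices to
differentiate a polynomial in `a`. -/
theorem euler_subst {a : MvPowerSeries ℕ+ ℂ} (ha : constantCoeff a = 0) (f : PowerSeries ℂ) :
    euler (f.subst a) = (PowerSeries.derivative ℂ f).subst a * euler a := by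
  classical
  ext m
  set n := m.degree + 1
  have hsum : ∀ (s : Finset ℕ) (g : ℕ → MvPowerSeries ℕ+ ℂ),
      euler (∑ d ∈ s, g d) = ∑ d ∈ s, euler (g d) := fun s g => by
    ext m
    simp [coeff_euler, Finset.mul_sum]
  have hsmul : ∀ (c : ℂ) (g : MvPowerSeries ℕ+ ℂ), euler (c • g) = c • euler g := fun c g => by
    ext m
    simp only [coeff_euler, map_smul, smul_eq_mul]
    ring
  have h1 : coeff m (euler (f.subst a)) = coeff m ((∑ d ∈ Finset.range n,
      PowerSeries.coeff d (PowerSeries.derivative ℂ f) • a ^ d) * euler a) := by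
    rw [coeff_euler, coeff_subst_eq_sum ha f (show m.degree < n + 1 by lia), ← coeff_euler, hsum,
      Finset.sum_range_succ', pow_zero, hsmul, euler_one, smul_zero, add_zero, Finset.sum_mul]
    congr 1
    refine Finset.sum_congr rfl fun d _ => ?_
    rw [hsmul, euler_pow, smul_smul, PowerSeries.coeff_derivative, smul_mul_assoc]
    push_cast
    rfl
  rw [h1, coeff_mul, coeff_mul]
  refine Finset.sum_congr rfl fun x hx => ?_
  rw [coeff_subst_eq_sum ha _ (show x.1.degree < n from ?_)]
  have : m.degree = x.1.degree + x.2.degree := by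
    rw [← Finset.HasAntidiagonal.mem_antidiagonal.1 hx, map_add]
  lia

theorem constantCoeff_exp_subst {a : MvPowerSeries ℕ+ ℂ} (ha : constantCoeff a = 0) :
    constantCoeff ((PowerSeries.exp ℂ).subst a) = 1 := by
  rw [← coeff_zero_eq_constantCoeff_apply, coeff_subst_eq_sum ha (n := 1) _ (by simp)]
  simp

/-- Both sides solve the linear equation `euler f = f * euler a` with constant term 1, and the
solution is unique. -/
theorem eq_exp_subst {a f : MvPowerSeries ℕ+ ℂ} (ha : constantCoeff a = 0)
    (hf : constantCoeff f = 1) (h : euler f = f * euler a) :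
    f = (PowerSeries.exp ℂ).subst a := by
  refine eq_of_euler_eq_mul (by rw [hf, constantCoeff_exp_subst ha]) (constantCoeff_euler a) h ?_
  rw [euler_subst ha, PowerSeries.derivative_exp]

theorem derivative_log_mul :
    PowerSeries.derivative ℂ (PowerSeries.log ℂ) * (1 + PowerSeries.X) = 1 := by
  ext n
  rw [PowerSeries.deriv_log, mul_add, mul_one, map_add]
  cases n with
  | zero => simp
  | succ n =>
    rw [PowerSeries.coeff_succ_mul_X]
    simp [pow_succ, PowerSeries.coeff_one]

/-- The logarithmic derivative of `f` is `euler a`; the Euler operator determines a series up to its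
constant term. -/
theorem eq_log_subst {a f : MvPowerSeries ℕ+ ℂ} (ha : constantCoeff a = 0)
    (hf : constantCoeff f = 1) (h : euler f = f * euler a) :
    a = (PowerSeries.log ℂ).subst (f - 1) := by
  have hf1 : constantCoeff (f - 1) = 0 := by simp [hf]
  have hs := PowerSeries.HasSubst.of_constantCoeff_zero hf1
  refine euler_injective ?_ ?_
  · rw [ha]
    rw [← coeff_zero_eq_constantCoeff_apply, coeff_subst_eq_sum hf1 (n := 1) _ (by simp)]
    simp
  · have h1 := congrArg (PowerSeries.subst (f - 1)) derivative_log_mul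
    rw [PowerSeries.subst_mul hs, PowerSeries.subst_add hs, PowerSeries.subst_X hs,
      ← PowerSeries.coe_substAlgHom hs, map_one, PowerSeries.coe_substAlgHom hs] at h1
    have h2 : euler (f - 1) = euler f := by
      ext m
      rcases eq_or_ne m 0 with rfl | hm
      · simp [coeff_euler]
      · classical simp [coeff_euler, coeff_one, hm]
    rw [euler_subst hf1, h2, h, ← mul_assoc]
    rw [show 1 + (f - 1) = f by ring] at h1
    rw [h1, one_mul]

/-- The exponential generating series of a sequence of series of which the `n`-th is homogeneous
of weight `n`. -/
def genSeries (A : ℕ → MvPowerSeries ℕ+ ℂ) : MvPowerSeries ℕ+ ℂ :=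
  fun m => ((wt m)! : ℂ)⁻¹ * coeff m (A (wt m))

theorem coeff_genSeries (A : ℕ → MvPowerSeries ℕ+ ℂ) (m : ℕ+ →₀ ℕ) :
    coeff m (genSeries A) = ((wt m)! : ℂ)⁻¹ * coeff m (A (wt m)) := rfl

/-- The recursion divided by factorials is a product of generating series. Homogeneity of `A` leaves
only `k = wt x.1` for each splitting `x` of `m`, so that `n - k` is automatically `wt x.2`. -/
theorem euler_genSeries {A B : ℕ → MvPowerSeries ℕ+ ℂ}
    (hA : ∀ n m, wt m ≠ n → coeff m (A n) = 0)
    (h : ∀ n : ℕ, (n : MvPowerSeries ℕ+ ℂ) * B n = ∑ k ∈ Finset.range (n + 1),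
      n.choose k • (k * A k * B (n - k))) :
    euler (genSeries B) = genSeries B * euler (genSeries A) := by
  classical
  have hn : ∀ (n : ℕ) (f : MvPowerSeries ℕ+ ℂ) (m), coeff m ((n : MvPowerSeries ℕ+ ℂ) * f) =
      n * coeff m f := fun n f m => by
    rw [← nsmul_eq_mul, map_nsmul, nsmul_eq_mul]
  ext m
  have h1 := congrArg (coeff m) (h (wt m))
  rw [hn, map_sum] at h1
  rw [mul_comm (genSeries B), coeff_euler, coeff_genSeries, mul_left_comm, h1, coeff_mul,
    Finset.mul_sum]
  simp_rw [map_nsmul, mul_assoc, hn, coeff_mul, Finset.mul_sum, Finset.smul_sum, Finset.mul_sum]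
  rw [Finset.sum_comm]
  refine Finset.sum_congr rfl fun x hx => ?_
  have hx' : wt x.1 + wt x.2 = wt m := by
    rw [← map_add, Finset.HasAntidiagonal.mem_antidiagonal.1 hx]
  rw [Finset.sum_eq_single (wt x.1)]
  · have hsub : wt m - wt x.1 = wt x.2 := by lia
    have hc := Nat.choose_mul_factorial_mul_factorial (show wt x.1 ≤ wt m by lia)
    rw [hsub] at hc ⊢
    rw [coeff_euler, coeff_genSeries, coeff_genSeries, ← hc, nsmul_eq_mul]
    push_cast
    have hc0 : ((wt m).choose (wt x.1) : ℂ) ≠ 0 :=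
      Nat.cast_ne_zero.2 (Nat.choose_pos (by lia)).ne'
    have h2 : ((wt x.1)! : ℂ) ≠ 0 := Nat.cast_ne_zero.2 (Nat.factorial_ne_zero _)
    have h3 : ((wt x.2)! : ℂ) ≠ 0 := Nat.cast_ne_zero.2 (Nat.factorial_ne_zero _)
    field_simp
  · intro k _ hk
    rw [hA k x.1 hk.symm]
    simp
  · intro hk
    exact absurd (Finset.mem_range.2 (by lia)) hk

end Euler

/-! ### The free energy as a sum over labelled connected ribbon graphs -/

/-! ### The monomial recording the class sizes: its degree counts vertices, its weight counts
half-edges -/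

section ClassType

variable {H : Type*} [Finite H]

open Classical in
/-- The monomial `∏ x_k` over the sizes `k` of the classes of an equivalence relation. -/
def classType (r : Setoid H) : ℕ+ →₀ ℕ :=
  ∑ᶠ q : Quotient r, Finsupp.single (classSize r q.out) 1

omit [Finite H] in
theorem classType_eq_sum (r : Setoid H) [Fintype (Quotient r)] :
    classType r = ∑ q : Quotient r, Finsupp.single (classSize r q.out) 1 :=
  finsum_eq_sum_of_fintype _

theorem degree_classType (r : Setoid H) : (classType r).degree = Nat.card (Quotient r) := by
  classical
  have := Fintype.ofFinite (Quotient r)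
  rw [classType_eq_sum, map_sum]
  simp

theorem wt_classType (r : Setoid H) : wt (classType r) = Nat.card H := by
  classical
  have := Fintype.ofFinite (Quotient r)
  have := Fintype.ofFinite H
  rw [classType_eq_sum, map_sum, ← Nat.card_congr (Equiv.sigmaFiberEquiv (Quotient.mk r)),
    Nat.card_sigma]
  refine Finset.sum_congr rfl fun q _ => ?_
  rw [wt_single, coe_classSize]
  exact Nat.card_congr (Equiv.subtypeEquivRight fun b => by rw [← Quotient.eq, Quotient.out_eq])

theorem classProd_classSize {M : Type*} [CommMonoid M] (r : Setoid H) (x : ℕ+ → M) :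
    classProd r (fun h => x (classSize r h)) = (classType r).prod fun k n => x k ^ n := by
  classical
  have := Fintype.ofFinite (Quotient r)
  rw [classType_eq_sum, classProd_eq_prod, ← Finsupp.prod_finsetSum_index (by simp)
    (by simp [pow_add])]
  simp

theorem classProd_X (r : Setoid H) :
    classProd r (fun h => (MvPowerSeries.X (classSize r h) : MvPowerSeries ℕ+ ℂ)) =
      MvPowerSeries.monomial (classType r) 1 := by
  rw [classProd_classSize, MvPowerSeries.monomial_one_eq]

end ClassType

/-! ### Partition function and free energy as generating series -/

section FreeEnergy

open MvPowerSeries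

variable {V : Type*} [NormedAddCommGroup V] [InnerProductSpace ℝ V]
variable {ι : Type*} [Fintype ι] [DecidableEq ι]

theorem sum_coeff_eq_zero {α : Type*} {s : Finset α} {f : α → MvPowerSeries ℕ+ ℂ} {m : ℕ+ →₀ ℕ}
    (h : ∀ a ∈ s, coeff m (f a) = 0) : coeff m (∑ a ∈ s, f a) = 0 := by
  rw [map_sum]
  exact Finset.sum_eq_zero h

theorem coeff_cycleWeight (y : ℕ+ → ℂ) {n : ℕ} (σ : Unit → Equiv.Perm (Fin n)) {m : ℕ+ →₀ ℕ}
    (hm : wt m ≠ n) :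
    coeff m (cycleWeight (fun k => (X k * C (y k) : MvPowerSeries ℕ+ ℂ)) _ σ) = 0 := by
  classical
  rw [cycleWeight, classProd_mul_distrib, ← map_classProd MvPowerSeries.C, coeff_mul_C,
    classProd_X, coeff_monomial, if_neg, zero_mul]
  rintro rfl
  exact hm (by rw [wt_classType, Nat.card_fin])

theorem coeff_ribbonWeight (e : Module.Basis ι ℝ V) (T : Tensors V) {n : ℕ}
    (σ : Bool → Equiv.Perm (Fin n)) (m : ℕ+ →₀ ℕ) :
    coeff m (ribbonWeight e T (fun k => (X k : MvPowerSeries ℕ+ ℂ)) _ σ) =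
      if m = classType (cycleSetoid (σ false)) then ribbonWeight e T (1 : ℕ+ → ℂ) _ σ else 0 := by
  classical
  rw [ribbonWeight, ribbonWeight]
  split_ifs with h1 h2 h2
  · rw [finsum_eq_sum_of_fintype, map_sum, finsum_eq_sum_of_fintype]
    refine Finset.sum_congr rfl fun c _ => ?_
    rw [colouredValue_eq, MvPowerSeries.algebraMap_apply, Algebra.algebraMap_self, RingHom.id_apply,
      coeff_mul_C,
      classProd_X, coeff_monomial, if_pos h2, one_mul]
  · rw [finsum_eq_sum_of_fintype, map_sum]
    refine Finset.sum_eq_zero fun c _ => ?_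
    rw [colouredValue_eq, MvPowerSeries.algebraMap_apply, Algebra.algebraMap_self, RingHom.id_apply,
      coeff_mul_C,
      classProd_X, coeff_monomial, if_neg h2, zero_mul]
  · simp
  · simp

theorem sameOrbit_unit {H : Type} {σ : Unit → Equiv.Perm H} {a b : H} :
    SameOrbit σ a b ↔ (σ ()).SameCycle a b := by
  constructor
  · intro h
    induction h with
    | rel a b h =>
      obtain ⟨_, rfl⟩ := h
      exact Equiv.Perm.sameCycle_apply_right.2 (.refl _ _)
    | refl a => exact .refl _ _
    | symm a b _ ih => exact ih.symm
    | trans a b c _ _ ih ih' => exact ih.trans ih'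
  · intro h
    exact (iff_of_eq (eq_of_sameCycle (σ := σ ()) (f := fun b => SameOrbit σ a b) (fun c =>
      propext ⟨fun h => .trans _ _ _ h (.symm _ _ (.rel _ _ ⟨(), rfl⟩)),
        fun h => .trans _ _ _ h (.rel _ _ ⟨(), rfl⟩)⟩) h)).1 (.refl _)

theorem cycleWeight_of_isTransitive {R : Type*} [CommRing R] (y : ℕ+ → R) {n : ℕ}
    {σ : Unit → Equiv.Perm (Fin (n + 1))} (hσ : IsTransitive σ) :
    cycleWeight y _ σ = y n.succPNat := by
  have h : ∀ a b, cycleSetoid (σ ()) a b := fun a b => sameOrbit_unit.1 (hσ a b)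
  rw [cycleWeight, classProd_of_forall_rel h (fun a b hab => by rw [classSize_eq_of_rel _ hab]) 0]
  congr 1
  apply PNat.eq
  rw [coe_classSize, Nat.succPNat_coe]
  have : Nat.card {b // cycleSetoid (σ ()) b 0} = Nat.card (Fin (n + 1)) :=
    Nat.card_congr (Equiv.subtypeUnivEquiv fun b => h b 0)
  rw [this, Nat.card_fin]

open Classical in
theorem transitiveWeight_cycleWeight_succ {R : Type*} [CommRing R] (y : ℕ+ → R) (n : ℕ) :
    transitiveWeight (cycleWeight y) (n + 1) =
      (Finset.univ.filter fun σ : Unit → Equiv.Perm (Fin (n + 1)) => IsTransitive σ).card •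
        y n.succPNat := by
  rw [transitiveWeight, Finset.sum_congr rfl fun σ hσ =>
    cycleWeight_of_isTransitive y (Finset.mem_filter.1 hσ).2, Finset.sum_const]

open Classical in
-- Apply the exponential formula to the weight 1. The totals are `n !`, so the recursion becomes n =
-- ∑ k N_k / k!, and subtracting consecutive instances gives N_{n+1} = n!.
theorem card_isTransitive (n : ℕ) :
    (Finset.univ.filter fun σ : Unit → Equiv.Perm (Fin (n + 1)) => IsTransitive σ).card = n ! := by
  set N : ℕ → ℕ := fun n =>
    (Finset.univ.filter fun σ : Unit → Equiv.Perm (Fin n) => IsTransitive σ).card with hN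
  have h1 : ∀ (H : Type) (σ : Unit → Equiv.Perm H), cycleWeight (1 : ℕ+ → ℚ) H σ = 1 :=
    fun H σ => by simp [cycleWeight, classProd]
  have htot : ∀ n, totalWeight (cycleWeight (1 : ℕ+ → ℚ)) n = (n ! : ℚ) := fun n => by
    simp [totalWeight, h1, Fintype.card_perm]
  have htr : ∀ n, transitiveWeight (cycleWeight (1 : ℕ+ → ℚ)) n = (N n : ℚ) := fun n => by
    simp [transitiveWeight, h1, hN]
  have key : ∀ n : ℕ, (n : ℚ) = ∑ k ∈ Finset.range (n + 1), (k : ℚ) * N k / k ! := by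
    intro n
    have h := card_mul_totalWeight (isMultiplicative_cycleWeight (1 : ℕ+ → ℚ)) n
    have hn : (n ! : ℚ) ≠ 0 := Nat.cast_ne_zero.2 (Nat.factorial_ne_zero n)
    rw [← mul_left_inj' hn, ← htot, h, Finset.sum_mul]
    refine Finset.sum_congr rfl fun k hk => ?_
    have hk' : k ≤ n := Nat.lt_succ_iff.1 (Finset.mem_range.1 hk)
    have hk0 : (k ! : ℚ) ≠ 0 := Nat.cast_ne_zero.2 (Nat.factorial_ne_zero k)
    rw [htot, htot, htr, nsmul_eq_mul, ← Nat.choose_mul_factorial_mul_factorial hk']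
    push_cast
    field_simp
  have h2 := key (n + 1)
  rw [Finset.sum_range_succ, ← key n, Nat.factorial_succ] at h2
  have hn : (n ! : ℚ) ≠ 0 := Nat.cast_ne_zero.2 (Nat.factorial_ne_zero n)
  have h3 : (n : ℚ) + 1 ≠ 0 := by positivity
  push_cast at h2
  field_simp at h2
  have h4 : (N (n + 1) : ℚ) = n ! := by linarith
  exact_mod_cast h4

theorem single_pnat_injective : Function.Injective fun k : ℕ+ => (Finsupp.single k 1 : ℕ+ →₀ ℕ) :=
  Finsupp.single_left_injective one_ne_zero

theorem coeff_potentialSeries_single (T : Tensors V) (w : ℕ+ → ℂ) (v : V) (k : ℕ+) :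
    coeff (Finsupp.single k 1) (potentialSeries T w v) = T.diag k v / w k := by
  classical
  change ∑ᶠ j : ℕ+, coeff (Finsupp.single k 1) (X j * C (T.diag j v / w j)) = _
  rw [finsum_eq_single _ k]
  · simp [coeff_mul_C]
  · intro j hj
    rw [coeff_mul_C, coeff_X, if_neg, zero_mul]
    exact fun h => hj (single_pnat_injective h.symm)

theorem coeff_potentialSeries_eq_zero (T : Tensors V) (w : ℕ+ → ℂ) (v : V) {m : ℕ+ →₀ ℕ}
    (hm : ∀ k, m ≠ Finsupp.single k 1) : coeff m (potentialSeries T w v) = 0 := by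
  classical
  change ∑ᶠ j : ℕ+, coeff m (X j * C (T.diag j v / w j)) = _
  rw [finsum_eq_zero_of_forall_eq_zero]
  intro j
  rw [coeff_mul_C, coeff_X, if_neg (hm j), zero_mul]

theorem constantCoeff_potentialSeries (T : Tensors V) (w : ℕ+ → ℂ) (v : V) :
    constantCoeff (potentialSeries T w v) = 0 := by
  rw [← coeff_zero_eq_constantCoeff_apply]
  exact coeff_potentialSeries_eq_zero T w v fun k h =>
    k.ne_zero (by simpa only [wt_single, map_zero, eq_comm] using congrArg wt h)

/-- The exponential formula for a single permutation. The n! long cycles on n + 1 points, divided by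
(n + 1)!, give the coefficient 1/(n + 1) of the potential. -/
theorem genSeries_cycleWeight (T : Tensors V) (v : V) :
    genSeries (totalWeight (cycleWeight fun k =>
      (X k * C (T.diag k v) : MvPowerSeries ℕ+ ℂ))) =
      (PowerSeries.exp ℂ).subst (potentialSeries T (fun k => ((k : ℕ) : ℂ)) v) := by
  classical
  set y : ℕ+ → MvPowerSeries ℕ+ ℂ := fun k => X k * C (T.diag k v) with hy
  have hA : ∀ n m, wt m ≠ n → coeff m (transitiveWeight (cycleWeight y) n) = 0 := fun n m hm =>
    sum_coeff_eq_zero fun σ _ => coeff_cycleWeight (fun k => T.diag k v) σ hm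
  refine eq_exp_subst (constantCoeff_potentialSeries _ _ _) ?_ ?_
  · rw [← coeff_zero_eq_constantCoeff_apply, coeff_genSeries, map_zero]
    have h0 : IsEmpty (Quotient (cycleSetoid (1 : Equiv.Perm (Fin 0)))) :=
      ⟨fun q => isEmptyElim q.out⟩
    simp [totalWeight, cycleWeight, classProd, Subsingleton.elim _ (1 : Equiv.Perm (Fin 0)),
      finprod_of_isEmpty]
  · rw [euler_genSeries hA (card_mul_totalWeight (isMultiplicative_cycleWeight y))]
    congr 1
    ext m
    rw [coeff_euler, coeff_euler]
    rcases Nat.eq_zero_or_pos (wt m) with h0 | hpos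
    · simp [h0]
    congr 1
    obtain ⟨n, hn⟩ := Nat.exists_eq_succ_of_ne_zero hpos.ne'
    rw [coeff_genSeries, hn, Nat.succ_eq_add_one, transitiveWeight_cycleWeight_succ,
      card_isTransitive, map_nsmul, nsmul_eq_mul, hy]
    simp only
    rw [coeff_mul_C]
    by_cases hm : m = Finsupp.single n.succPNat 1
    · rw [hm, coeff_X, if_pos rfl, coeff_potentialSeries_single, Nat.factorial_succ,
        Nat.succPNat_coe]
      have : (n ! : ℂ) ≠ 0 := Nat.cast_ne_zero.2 (Nat.factorial_ne_zero n)
      have : (n : ℂ) + 1 ≠ 0 := by exact_mod_cast n.succ_ne_zero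
      push_cast
      field_simp
    · rw [coeff_X, if_neg hm, coeff_potentialSeries_eq_zero]
      · simp
      · rintro k rfl
        refine hm ?_
        rw [wt_single] at hn
        rw [show k = n.succPNat from PNat.eq hn]

variable [FiniteDimensional ℝ V] [MeasurableSpace V] [BorelSpace V]

theorem partitionSeries_eq_genSeries (e : Module.Basis ι ℝ V) (T : Tensors V) :
    partitionSeries T (fun k => ((k : ℕ) : ℂ)) =
      genSeries (totalWeight (ribbonWeight e T fun k => (X k : MvPowerSeries ℕ+ ℂ))) := by
  ext m
  rw [coeff_genSeries, coeff_totalWeight_ribbonWeight, ← integral_const_mul]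
  simp_rw [← coeff_genSeries, genSeries_cycleWeight]
  rfl

theorem constantCoeff_partitionSeries (T : Tensors V) (w : ℕ+ → ℂ) :
    constantCoeff (partitionSeries T w) = 1 := by
  rw [← coeff_zero_eq_constantCoeff_apply]
  change ∫ v, coeff 0 ((PowerSeries.exp ℂ).subst (potentialSeries T w v)) ∂(gaussian V) = 1
  simp_rw [coeff_zero_eq_constantCoeff_apply,
    constantCoeff_exp_subst (constantCoeff_potentialSeries T w _)]
  simp

theorem integrable_coeff_exp_potentialSeries (e : Module.Basis ι ℝ V) (T : Tensors V)
    (m : ℕ+ →₀ ℕ) : Integrable (fun v => coeff m ((PowerSeries.exp ℂ).subst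
      (potentialSeries T (fun k => ((k : ℕ) : ℂ)) v))) (gaussian V) := by
  classical
  simp_rw [← genSeries_cycleWeight, coeff_genSeries, totalWeight, map_sum]
  refine (integrable_finsetSum _ fun σ _ => ?_).const_mul _
  simp_rw [cycleWeight, classProd_mul_distrib, ← map_classProd MvPowerSeries.C, coeff_mul_C]
  exact (integrable_classProd_diag e T _).const_mul _

/-- The sum over the connected ribbon graphs with labelled half-edges. -/
def connectedSeries (e : Module.Basis ι ℝ V) (T : Tensors V) : MvPowerSeries ℕ+ ℂ :=
  genSeries (transitiveWeight (ribbonWeight e T fun k => (X k : MvPowerSeries ℕ+ ℂ))) - 1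

omit [FiniteDimensional ℝ V] [MeasurableSpace V] [BorelSpace V] in
-- The empty family is transitive in the sense of `IsTransitive` and has weight 1; subtracting 1
-- removes it, in agreement with connected graphs being non-empty.
theorem constantCoeff_connectedSeries (e : Module.Basis ι ℝ V) (T : Tensors V) :
    constantCoeff (connectedSeries e T) = 0 := by
  classical
  rw [connectedSeries, map_sub, ← coeff_zero_eq_constantCoeff_apply, coeff_genSeries, map_zero]
  have h0 : IsEmpty (Quotient (cycleSetoid (1 : Equiv.Perm (Fin 0)))) :=
    ⟨fun q => isEmptyElim q.out⟩
  have h1 : ∀ σ : Bool → Equiv.Perm (Fin 0), IsTransitive σ := fun σ a => isEmptyElim a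
  have h2 : IsPairing (1 : Equiv.Perm (Fin 0)) := fun a => isEmptyElim a
  simp [transitiveWeight, ribbonWeight, classProd, colouredValue, h1, h2,
    Subsingleton.elim _ (1 : Equiv.Perm (Fin 0)), finprod_of_isEmpty,
    finsum_eq_sum_of_fintype]

theorem euler_partitionSeries (e : Module.Basis ι ℝ V) {T : Tensors V} (hT : IsCyclic T) :
    euler (partitionSeries T (fun k => ((k : ℕ) : ℂ))) =
      partitionSeries T (fun k => ((k : ℕ) : ℂ)) * euler (connectedSeries e T) := by
  classical
  have h : euler (connectedSeries e T) = euler (genSeries (transitiveWeight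
      (ribbonWeight e T fun k => (X k : MvPowerSeries ℕ+ ℂ)))) := by
    ext m
    rcases eq_or_ne m 0 with rfl | hm
    · simp [coeff_euler]
    · simp [coeff_euler, connectedSeries, coeff_one, hm]
  rw [h, partitionSeries_eq_genSeries e]
  refine euler_genSeries (fun n m hm => ?_)
    (card_mul_totalWeight (isMultiplicative_ribbonWeight e hT _))
  refine sum_coeff_eq_zero fun σ _ => ?_
  rw [coeff_ribbonWeight, if_neg]
  rintro rfl
  exact hm (by rw [wt_classType, Nat.card_fin])

theorem freeEnergySeries_eq (e : Module.Basis ι ℝ V) {T : Tensors V} (hT : IsCyclic T) :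
    freeEnergySeries T (fun k => ((k : ℕ) : ℂ)) = connectedSeries e T :=
  (eq_log_subst (constantCoeff_connectedSeries e T) (constantCoeff_partitionSeries T _)
    (euler_partitionSeries e hT)).symm

theorem partitionSeries_eq (e : Module.Basis ι ℝ V) {T : Tensors V} (hT : IsCyclic T) :
    partitionSeries T (fun k => ((k : ℕ) : ℂ)) =
      (PowerSeries.exp ℂ).subst (connectedSeries e T) :=
  eq_exp_subst (constantCoeff_connectedSeries e T) (constantCoeff_partitionSeries T _)
    (euler_partitionSeries e hT)

end FreeEnergy

/-! ### Sums over isomorphism classes -/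

section IsoClasses

variable {X : ℕ → Type} [∀ n, Finite (X n)] [∀ n, MulAction (Equiv.Perm (Fin n)) (X n)]
  {s : Setoid (Σ n, X n)}

omit [∀ n, MulAction (Equiv.Perm (Fin n)) (X n)] in
theorem finite_isoClasses (n : ℕ) : {γ : Quotient s | γ.out.1 = n}.Finite := by
  refine (Set.finite_range fun a : X n => (Quotient.mk s ⟨n, a⟩)).subset ?_
  rintro γ rfl
  exact ⟨γ.out.2, Quotient.out_eq γ⟩

/-- Orbit-stabilizer: isomorphism classes on `n` points are orbits of the symmetric group, and the
orbit of `b` has `n !` divided by the order of the stabilizer many elements. Here `f` vanishes off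
the level `n`. -/
theorem finsum_isoClasses (hs : ∀ p q, s p q → p.1 = q.1)
    (hs' : ∀ n (a b : X n), s ⟨n, a⟩ ⟨n, b⟩ ↔ ∃ g : Equiv.Perm (Fin n), g • a = b)
    {f : (Σ n, X n) → ℂ} (hf : ∀ p q, s p q → f p = f q) {n : ℕ} (hn : ∀ p, f p ≠ 0 → p.1 = n) :
    ∑ᶠ γ : Quotient s, (Nat.card (MulAction.stabilizer (Equiv.Perm (Fin γ.out.1)) γ.out.2) : ℂ)⁻¹ *
      f γ.out = (n ! : ℂ)⁻¹ * ∑ᶠ a : X n, f ⟨n, a⟩ := by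
  classical
  have := Fintype.ofFinite (X n)
  rw [finsum_eq_sum_of_fintype fun a : X n => f ⟨n, a⟩]
  set Q := Finset.univ.image fun a : X n => (Quotient.mk s ⟨n, a⟩) with hQ
  rw [finsum_eq_sum_of_support_subset (s := Q)]
  · rw [← Finset.sum_fiberwise_of_maps_to (s := Finset.univ) (t := Q)
      (g := fun a : X n => (Quotient.mk s ⟨n, a⟩)) (fun a _ => Finset.mem_image_of_mem _
        (Finset.mem_univ a)), Finset.mul_sum]
    refine Finset.sum_congr rfl fun γ hγ => ?_
    obtain ⟨b, hb⟩ : ∃ b : X n, γ.out = ⟨n, b⟩ := by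
      obtain ⟨a, -, rfl⟩ := Finset.mem_image.1 hγ
      have h1 := hs _ _ (Quotient.mk_out (s := s) ⟨n, a⟩)
      generalize (⟦⟨n, a⟩⟧ : Quotient s).out = p at h1
      obtain ⟨k, b⟩ := p
      obtain rfl : k = n := h1
      exact ⟨b, rfl⟩
    have hγb : γ = ⟦⟨n, b⟩⟧ := by rw [← hb, Quotient.out_eq]
    have hfib : ∀ a : X n, (⟦⟨n, a⟩⟧ : Quotient s) = γ ↔
        a ∈ MulAction.orbit (Equiv.Perm (Fin n)) b := by
      intro a
      rw [hγb, Quotient.eq, Setoid.comm', hs', MulAction.mem_orbit_iff]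
    rw [hb, Finset.sum_congr rfl fun a ha => hf ⟨n, a⟩ ⟨n, b⟩ ?_, Finset.sum_const, nsmul_eq_mul,
      ← mul_assoc]
    · congr 1
      have hcard : (Finset.univ.filter fun a : X n => (⟦⟨n, a⟩⟧ : Quotient s) = γ).card =
          Nat.card (MulAction.orbit (Equiv.Perm (Fin n)) b) := by
        simp_rw [hfib]
        rw [Nat.card_eq_fintype_card, Fintype.card_of_subtype]
        simp
      rw [hcard]
      have h1 := MulAction.card_orbit_mul_card_stabilizer_eq_card_group (Equiv.Perm (Fin n)) b
      rw [← Nat.card_eq_fintype_card, ← Nat.card_eq_fintype_card, Fintype.card_perm,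
        Fintype.card_fin] at h1
      have h2 : (Nat.card (MulAction.stabilizer (Equiv.Perm (Fin n)) b) : ℂ) ≠ 0 :=
        Nat.cast_ne_zero.2 Nat.card_pos.ne'
      have h3 : (n ! : ℂ) ≠ 0 := Nat.cast_ne_zero.2 (Nat.factorial_ne_zero n)
      rw [eq_comm, inv_mul_eq_div, div_eq_iff h3, eq_comm, inv_mul_eq_div, div_eq_iff h2]
      exact_mod_cast h1.symm
    · rw [← Quotient.eq (r := s), (Finset.mem_filter.1 ha).2, hγb]
  · intro γ hγ
    have h1 := hn γ.out (right_ne_zero_of_mul hγ)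
    subst h1
    exact Finset.mem_coe.2 (Finset.mem_image.2 ⟨γ.out.2, Finset.mem_univ _, Quotient.out_eq γ⟩)

end IsoClasses

/-! ### Ribbon graphs as pairs of permutations; passage to isomorphism classes -/

section Ribbon

namespace RibbonGraph

variable {H H' : Type*}

theorem ext' {Γ Γ' : RibbonGraph H} (h : ∀ a, Γ.next a = Γ'.next a)
    (h' : ∀ a, Γ.flip a = Γ'.flip a) : Γ = Γ' := by
  obtain ⟨next, flip, _, _⟩ := Γ
  obtain ⟨next', flip', _, _⟩ := Γ'
  obtain rfl : next = next' := Equiv.ext h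
  obtain rfl : flip = flip' := funext h'
  rfl

/-- The involution that exchanges the two half-edges of each edge. -/
def flipPerm (Γ : RibbonGraph H) : Equiv.Perm H := Function.Involutive.toPerm Γ.flip Γ.flip_flip

theorem isPairing_flipPerm (Γ : RibbonGraph H) : IsPairing Γ.flipPerm :=
  fun h => ⟨Γ.flip_flip h, Γ.flip_ne h⟩

/-- The two permutations that describe a ribbon graph. -/
def perms (Γ : RibbonGraph H) (j : Bool) : Equiv.Perm H := bif j then Γ.flipPerm else Γ.next

theorem perms_injective : Function.Injective (perms : RibbonGraph H → Bool → Equiv.Perm H) := by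
  intro Γ Γ' h
  exact ext' (fun a => DFunLike.congr_fun (congrFun h false) a)
    fun a => DFunLike.congr_fun (congrFun h true) a

theorem exists_perms_eq {σ : Bool → Equiv.Perm H} (h : IsPairing (σ true)) :
    ∃ Γ : RibbonGraph H, Γ.perms = σ := by
  refine ⟨⟨σ false, σ true, fun a => (h a).1, fun a => (h a).2⟩, ?_⟩
  funext j
  cases j
  · rfl
  · exact Equiv.ext fun a => rfl

instance [Finite H] : Finite (RibbonGraph H) := Finite.of_injective _ perms_injective

instance : MulAction (Equiv.Perm H) (RibbonGraph H) where
  smul g Γ :=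
    { next := g.permCongr Γ.next
      flip := fun h => g (Γ.flip (g.symm h))
      flip_flip := fun h => by simp [Γ.flip_flip]
      flip_ne := fun h => by
        rw [Ne, ← Equiv.eq_symm_apply]
        exact Γ.flip_ne _ }
  one_smul Γ := rfl
  mul_smul g g' Γ := rfl

theorem smul_next (g : Equiv.Perm H) (Γ : RibbonGraph H) (h : H) :
    (g • Γ).next h = g (Γ.next (g.symm h)) := rfl

theorem smul_flip (g : Equiv.Perm H) (Γ : RibbonGraph H) (h : H) :
    (g • Γ).flip h = g (Γ.flip (g.symm h)) := rfl

theorem smul_eq_iff (g : Equiv.Perm H) (Γ Γ' : RibbonGraph H) :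
    g • Γ = Γ' ↔ (∀ a, g (Γ.next a) = Γ'.next (g a)) ∧ ∀ a, g (Γ.flip a) = Γ'.flip (g a) := by
  constructor
  · rintro rfl
    exact ⟨fun a => by simp [smul_next], fun a => by simp [smul_flip]⟩
  · rintro ⟨h, h'⟩
    exact ext' (fun a => by rw [smul_next, h, Equiv.apply_symm_apply])
      fun a => by rw [smul_flip, h', Equiv.apply_symm_apply]

theorem card_stabilizer (Γ : RibbonGraph H) :
    Nat.card (MulAction.stabilizer (Equiv.Perm H) Γ) = Nat.card (Γ.Iso Γ) :=
  Nat.card_congr (Equiv.subtypeEquivRight fun g => by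
    rw [MulAction.mem_stabilizer_iff, smul_eq_iff])

theorem perms_permCongr {Γ : RibbonGraph H} {Γ' : RibbonGraph H'} (f : Γ.Iso Γ') :
    (fun j => f.1.permCongr (Γ.perms j)) = Γ'.perms := by
  funext j
  ext a
  obtain ⟨a, rfl⟩ := f.1.surjective a
  cases j
  · simpa [perms] using f.2.1 a
  · rw [Equiv.permCongr_apply, Equiv.symm_apply_apply]
    exact f.2.2 a

theorem edgeSetoid_eq (Γ : RibbonGraph H) : Γ.toGraph.edgeSetoid = cycleSetoid Γ.flipPerm := by
  ext a b
  constructor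
  · rintro (rfl | rfl)
    · exact .refl _ _
    · exact Equiv.Perm.sameCycle_apply_right.2 (.refl Γ.flipPerm a)
  · intro h
    refine (iff_of_eq (eq_of_sameCycle (σ := Γ.flipPerm)
      (f := fun b => b = a ∨ b = Γ.flip a) (fun c => propext ?_) h)).1 (Or.inl rfl)
    change Γ.flip c = a ∨ Γ.flip c = Γ.flip a ↔ _
    rw [or_comm]
    refine or_congr ⟨fun h => ?_, fun h => h ▸ rfl⟩ ⟨?_, ?_⟩
    · rw [← Γ.flip_flip c, h, Γ.flip_flip]
    · rintro rfl; rw [Γ.flip_flip]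
    · rintro rfl; rw [Γ.flip_flip]

theorem connected_iff (Γ : RibbonGraph H) :
    Γ.toGraph.Connected ↔ Nonempty H ∧
      ∀ a b, Relation.EqvGen (fun a b => ∃ j, b = Γ.perms j a) a b := by
  refine and_congr_right fun _ => forall₂_congr fun a b => ⟨fun h => ?_, fun h => ?_⟩
  · induction h with
    | rel a b h =>
      rcases h with h | rfl
      · refine (iff_of_eq (eq_of_sameCycle (σ := Γ.next)
          (f := fun b => Relation.EqvGen (fun a b => ∃ j, b = Γ.perms j a) a b)
          (fun c => propext ?_) h)).1 (.refl _)
        have hc : Relation.EqvGen (fun a b => ∃ j, b = Γ.perms j a) c (Γ.next c) :=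
          .rel _ _ ⟨false, rfl⟩
        exact ⟨fun h => .trans _ _ _ h (.symm _ _ hc), fun h => .trans _ _ _ h hc⟩
      · exact .rel _ _ ⟨true, rfl⟩
    | refl a => exact .refl _
    | symm a b _ ih => exact .symm _ _ ih
    | trans a b c _ _ ih ih' => exact .trans _ _ _ ih ih'
  · induction h with
    | rel a b h =>
      obtain ⟨j, rfl⟩ := h
      refine .rel _ _ ?_
      cases j
      · exact Or.inl (Equiv.Perm.sameCycle_apply_right.2 (.refl Γ.next a))
      · exact Or.inr rfl
    | refl a => exact .refl _
    | symm a b _ ih => exact .symm _ _ ih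
    | trans a b c _ _ ih ih' => exact .trans _ _ _ ih ih'

end RibbonGraph

variable {V : Type*} [NormedAddCommGroup V] [InnerProductSpace ℝ V]
variable {ι : Type*} [Fintype ι] [DecidableEq ι]
variable {R : Type*} [CommRing R] [Algebra ℂ R]

theorem Graph.valence_eq {H : Type*} [Finite H] (Γ : Graph H) (v : Γ.Vertices) :
    Γ.valence v = classSize Γ.vert (Quotient.out v) := by
  apply PNat.eq
  rw [coe_classSize]
  exact Nat.card_congr (Equiv.subtypeEquivRight fun b => Quotient.mk_eq_iff_out (s := Γ.vert))

theorem ribbonValue_eq_sum {H : Type*} [Fintype H] [DecidableEq H] (e : Module.Basis ι ℝ V)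
    (T : Tensors V) (x : ℕ+ → R) (Γ : RibbonGraph H) :
    ribbonValue e T x Γ = ∑ c : H → ι, colouredValue e T x Γ.next Γ.flipPerm c := by
  refine Finset.sum_congr rfl fun c _ => ?_
  have h1 : edgeFactor e Γ.toGraph c = classProd Γ.toGraph.edgeSetoid (edgeValue e Γ.flip c) := rfl
  rw [h1, Γ.edgeSetoid_eq, colouredValue]
  congr 1
  refine finprod_congr fun v => ?_
  -- Stated as a function of the valence, since the domain of `T k` depends on it.
  let F : ℕ+ → R := fun k =>
    x k * algebraMap ℂ R (T k fun i => (1 : ℂ) ⊗ₜ[ℝ] e (c ((Γ.next ^ (i : ℕ)) (Quotient.out v))))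
  exact congrArg F (Γ.toGraph.valence_eq v)

theorem ribbonValue_eq_ribbonWeight {H : Type} [Fintype H] [DecidableEq H]
    (e : Module.Basis ι ℝ V) (T : Tensors V) (x : ℕ+ → R) (Γ : RibbonGraph H) :
    ribbonValue e T x Γ = ribbonWeight e T x H Γ.perms := by
  rw [ribbonValue_eq_sum, ribbonWeight,
    if_pos (show IsPairing (Γ.perms true) from Γ.isPairing_flipPerm), finsum_eq_sum_of_fintype]
  rfl

theorem ribbonValue_eq_prod {H : Type} [Fintype H] [DecidableEq H] (e : Module.Basis ι ℝ V)
    (T : Tensors V) (x : ℕ+ → R) (Γ : RibbonGraph H) :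
    ribbonValue e T x Γ = ((classType Γ.toGraph.vert).prod fun k n => x k ^ n) *
      algebraMap ℂ R (ribbonValue e T 1 Γ) := by
  simp_rw [ribbonValue_eq_sum, map_sum, Finset.mul_sum]
  refine Finset.sum_congr rfl fun c _ => ?_
  rw [colouredValue_eq, classProd_classSize]
  rfl

theorem coeff_ribbonValue {H : Type} [Fintype H] [DecidableEq H] (e : Module.Basis ι ℝ V)
    (T : Tensors V) (Γ : RibbonGraph H) (m : ℕ+ →₀ ℕ) :
    MvPowerSeries.coeff m (ribbonValue e T (fun k => (MvPowerSeries.X k : MvPowerSeries ℕ+ ℂ)) Γ) =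
      if m = classType Γ.toGraph.vert then ribbonValue e T 1 Γ else 0 := by
  classical
  rw [ribbonValue_eq_prod, ← MvPowerSeries.monomial_one_eq, MvPowerSeries.algebraMap_apply,
    Algebra.algebraMap_self, RingHom.id_apply, MvPowerSeries.coeff_mul_C,
    MvPowerSeries.coeff_monomial]
  split_ifs <;> simp

theorem ribbonValue_iso {H H' : Type} [Fintype H] [DecidableEq H] [Fintype H'] [DecidableEq H']
    (e : Module.Basis ι ℝ V) {T : Tensors V} (hT : IsCyclic T) (x : ℕ+ → R) {Γ : RibbonGraph H}
    {Γ' : RibbonGraph H'} (f : Γ.Iso Γ') : ribbonValue e T x Γ = ribbonValue e T x Γ' := by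
  rw [ribbonValue_eq_ribbonWeight, ribbonValue_eq_ribbonWeight, ← RibbonGraph.perms_permCongr f]
  exact ((isMultiplicative_ribbonWeight e hT x).equiv f.1 Γ.perms).symm

theorem RibbonGraph.Iso.connected {H H' : Type} {Γ : RibbonGraph H}
    {Γ' : RibbonGraph H'} (f : Γ.Iso Γ') (h : Γ.toGraph.Connected) : Γ'.toGraph.Connected := by
  rw [RibbonGraph.connected_iff] at h ⊢
  obtain ⟨⟨a⟩, h⟩ := h
  refine ⟨⟨f.1 a⟩, ?_⟩
  rw [← RibbonGraph.perms_permCongr f]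
  exact (isTransitive_permCongr f.1 Γ.perms).2 h

theorem ribbonSetoid_fst {p q : Σ n : ℕ, RibbonGraph (Fin n)} (h : ribbonSetoid p q) :
    p.1 = q.1 := by
  obtain ⟨f⟩ := h
  simpa using Fintype.card_congr f.1

theorem ribbonSetoid_iff (n : ℕ) (a b : RibbonGraph (Fin n)) :
    ribbonSetoid ⟨n, a⟩ ⟨n, b⟩ ↔ ∃ g : Equiv.Perm (Fin n), g • a = b := by
  simp_rw [RibbonGraph.smul_eq_iff]
  exact ⟨fun ⟨f⟩ => ⟨f.1, f.2⟩, fun ⟨g, hg⟩ => ⟨⟨g, hg⟩⟩⟩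

open Classical in
theorem coeff_connectedSeries (e : Module.Basis ι ℝ V) (T : Tensors V) (m : ℕ+ →₀ ℕ) :
    MvPowerSeries.coeff m (connectedSeries e T) = ((wt m)! : ℂ)⁻¹ *
      ∑ᶠ Γ : RibbonGraph (Fin (wt m)), if Γ.toGraph.Connected then MvPowerSeries.coeff m
        (ribbonValue e T (fun k => (MvPowerSeries.X k : MvPowerSeries ℕ+ ℂ)) Γ) else 0 := by
  rcases eq_or_ne m 0 with rfl | hm
  · rw [MvPowerSeries.coeff_zero_eq_constantCoeff_apply, constantCoeff_connectedSeries,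
      finsum_eq_zero_of_forall_eq_zero, mul_zero]
    -- Weight zero means no half-edges, and the empty graph is not connected.
    intro Γ
    rw [if_neg]
    rintro ⟨⟨a⟩, -⟩
    rw [map_zero] at a
    exact a.elim0
  · have hne : Nonempty (Fin (wt m)) :=
      Fin.pos_iff_nonempty.1 (Nat.pos_of_ne_zero (mt wt_eq_zero_iff.1 hm))
    rw [connectedSeries, map_sub, MvPowerSeries.coeff_one, if_neg hm, sub_zero, coeff_genSeries]
    congr 1
    have := Fintype.ofFinite (RibbonGraph (Fin (wt m)))
    rw [finsum_eq_sum_of_fintype, transitiveWeight, map_sum, ← Finset.sum_filter]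
    symm
    refine Finset.sum_of_injOn RibbonGraph.perms RibbonGraph.perms_injective.injOn ?_ ?_ ?_
    · intro Γ hΓ
      simp only [Finset.coe_filter, Finset.mem_univ, true_and, Set.mem_ofPred_eq] at hΓ ⊢
      exact (Γ.connected_iff.1 hΓ).2
    -- Transitive pairs that come from no ribbon graph fail to be pairings, hence have weight zero.
    · intro σ hσ hσ'
      simp only [Finset.mem_filter, Finset.mem_univ, true_and] at hσ
      rw [ribbonWeight, if_neg, map_zero]
      intro h
      obtain ⟨Γ, rfl⟩ := RibbonGraph.exists_perms_eq h
      exact hσ' ⟨Γ, by simpa using Γ.connected_iff.2 ⟨hne, hσ⟩, rfl⟩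
    · intro Γ _
      rw [ribbonValue_eq_ribbonWeight]

open Classical in
-- Disconnected graphs are given the value 0, so that orbit-stabilizer applies to all classes at
-- once; a graph that contributes at `m` has exactly `wt m` half-edges.
theorem finsum_ribbonTerm (e : Module.Basis ι ℝ V) {T : Tensors V} (hT : IsCyclic T)
    (m : ℕ+ →₀ ℕ) :
    ∑ᶠ γ, MvPowerSeries.coeff m
      (ribbonTerm e T (fun k => (MvPowerSeries.X k : MvPowerSeries ℕ+ ℂ)) γ) =
      MvPowerSeries.coeff m (connectedSeries e T) := by
  set f : (Σ n : ℕ, RibbonGraph (Fin n)) → ℂ := fun p => if p.2.toGraph.Connected then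
    MvPowerSeries.coeff m
      (ribbonValue e T (fun k => (MvPowerSeries.X k : MvPowerSeries ℕ+ ℂ)) p.2) else 0 with hf
  have hinv : ∀ p q, ribbonSetoid p q → f p = f q := by
    rintro p q ⟨g⟩
    have hg : Nonempty (q.2.Iso p.2) := ribbonSetoid.symm' ⟨g⟩
    rw [hf]
    refine if_congr ⟨g.connected, hg.some.connected⟩ ?_ rfl
    rw [ribbonValue_iso e hT _ g]
  have hn : ∀ p, f p ≠ 0 → p.1 = wt m := by
    intro p hp
    simp only [hf, coeff_ribbonValue] at hp
    split_ifs at hp with h1 h2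
    · rw [h2, wt_classType, Nat.card_fin]
    · exact absurd rfl hp
    · exact absurd rfl hp
  have key := finsum_isoClasses (fun p q => ribbonSetoid_fst) ribbonSetoid_iff hinv hn
  rw [coeff_connectedSeries, ← key]
  refine Eq.trans (finsum_congr fun γ => ?_) ((finsum_subtype_eq_finsum_cond
    (f := fun γ : Quotient ribbonSetoid => (Nat.card (γ.out.2.Iso γ.out.2) : ℂ)⁻¹ *
      MvPowerSeries.coeff m
        (ribbonValue e T (fun k => (MvPowerSeries.X k : MvPowerSeries ℕ+ ℂ)) γ.out.2))
    (p := fun γ => γ.out.2.toGraph.Connected)).trans (finsum_congr fun γ => ?_))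
  · rw [ribbonTerm, map_smul, smul_eq_mul]
    rfl
  · by_cases hγ : γ.out.2.toGraph.Connected
    · simp only [hγ, hf, if_true, finsum_true, RibbonGraph.card_stabilizer]
    · simp [hγ, hf]

end Ribbon

/-! ### Permutations with given orbits -/

section Counting

variable {H : Type}

open Classical in
theorem card_forall_sameCycle [Fintype H] [DecidableEq H] [Nonempty H] :
    (Finset.univ.filter fun σ : Equiv.Perm H => ∀ a b, σ.SameCycle a b).card =
      (Fintype.card H - 1)! := by
  obtain ⟨n, hn⟩ := Nat.exists_eq_succ_of_ne_zero (Fintype.card_ne_zero (α := H))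
  rw [hn, Nat.succ_sub_one, ← card_isTransitive n]
  have e : H ≃ Fin (n + 1) := Fintype.equivFinOfCardEq hn
  refine Finset.card_equiv (e.permCongr.trans (Equiv.funUnique Unit _).symm) fun σ => ?_
  simp only [Finset.mem_filter, Finset.mem_univ, true_and]
  have h := isTransitive_permCongr e fun _ : Unit => σ
  refine Iff.trans ?_ h.symm
  simp only [IsTransitive, sameOrbit_unit]

open Classical in
-- A permutation with prescribed orbits is an independent choice of one long cycle on each class.
theorem card_cycleSetoid_eq [Fintype H] [DecidableEq H] (r : Setoid H) :
    (Finset.univ.filter fun σ : Equiv.Perm H => cycleSetoid σ = r).card =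
      classProd r fun h => ((classSize r h : ℕ) - 1)! := by
  have hclass : ∀ q : Quotient r, Fintype.card {a // (⟦a⟧ : Quotient r) = q} =
      classSize r q.out := fun q => by
    rw [coe_classSize, ← Nat.card_eq_fintype_card]
    exact Nat.card_congr (Equiv.subtypeEquivRight fun b => Quotient.mk_eq_iff_out)
  have hne : ∀ q : Quotient r, Nonempty {a // (⟦a⟧ : Quotient r) = q} := fun q =>
    ⟨⟨q.out, Quotient.out_eq q⟩⟩
  have h1 : ∀ q : Quotient r, ((classSize r q.out : ℕ) - 1)! = (Finset.univ.filter
      fun τ : Equiv.Perm {a // (⟦a⟧ : Quotient r) = q} => ∀ a b, τ.SameCycle a b).card :=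
    fun q => by rw [card_forall_sameCycle, hclass]
  rw [classProd_eq_prod]
  simp_rw [h1]
  rw [← Fintype.card_piFinset]
  have hmem : ∀ σ : Equiv.Perm H, cycleSetoid σ = r → ∀ (q : Quotient r) a,
      (⟦σ a⟧ : Quotient r) = q ↔ (⟦a⟧ : Quotient r) = q := by
    rintro σ rfl q a
    rw [Quotient.sound (s := cycleSetoid σ) (a := σ a) (b := a)
      (Equiv.Perm.sameCycle_apply_left.2 (.refl σ a))]
  refine Finset.card_bij (fun σ hσ q => σ.subtypePerm (hmem σ (Finset.mem_filter.1 hσ).2 q))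
    ?_ ?_ ?_
  · intro σ hσ
    simp only [Fintype.mem_piFinset, Finset.mem_filter, Finset.mem_univ, true_and] at hσ ⊢
    rintro q ⟨a, ha⟩ ⟨b, hb⟩
    rw [Equiv.Perm.sameCycle_subtypePerm]
    have hab : r a b := Quotient.exact (ha.trans hb.symm)
    rw [← hσ] at hab
    exact hab
  · intro σ hσ σ' hσ' h
    ext a
    exact congrArg Subtype.val (DFunLike.congr_fun (congrFun h ⟦a⟧) ⟨a, rfl⟩)
  · intro τ hτ
    simp only [Fintype.mem_piFinset, Finset.mem_filter, Finset.mem_univ, true_and] at hτ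
    set σ : Equiv.Perm H := (Equiv.sigmaFiberEquiv (Quotient.mk r)).permCongr
      (Equiv.Perm.sigmaCongrRight τ) with hσ
    have hσa : ∀ (q : Quotient r) (a : {a // (⟦a⟧ : Quotient r) = q}), σ a = τ q a := by
      rintro q ⟨a, rfl⟩
      rfl
    have hq : ∀ (q : Quotient r) a, (⟦σ a⟧ : Quotient r) = q ↔ (⟦a⟧ : Quotient r) = q := by
      intro q a
      have h2 : (⟦σ a⟧ : Quotient r) = ⟦a⟧ := by
        rw [hσa ⟦a⟧ ⟨a, rfl⟩]
        exact (τ ⟦a⟧ ⟨a, rfl⟩).2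
      rw [h2]
    have hsub : ∀ q, σ.subtypePerm (hq q) = τ q := fun q => by
      ext a
      exact hσa q a
    refine ⟨σ, ?_, funext fun q => hsub q⟩
    simp only [Finset.mem_filter, Finset.mem_univ, true_and]
    ext a b
    constructor
    · intro h
      exact Quotient.exact (eq_of_sameCycle (σ := σ) (f := fun a => (⟦a⟧ : Quotient r))
        (fun a => (hq _ a).2 rfl) h)
    · intro h
      have h2 := hτ ⟦b⟧ ⟨a, Quotient.sound h⟩ ⟨b, rfl⟩
      rw [← hsub, Equiv.Perm.sameCycle_subtypePerm] at h2
      exact h2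

end Counting

/-! ### Ordinary graphs -/

section Ordinary

namespace Graph

variable {H H' : Type*}

theorem ext' {Γ Γ' : Graph H} (h : ∀ a b, Γ.vert a b ↔ Γ'.vert a b)
    (h' : ∀ a, Γ.flip a = Γ'.flip a) : Γ = Γ' := by
  obtain ⟨vert, flip, _, _⟩ := Γ
  obtain ⟨vert', flip', _, _⟩ := Γ'
  obtain rfl : vert = vert' := Setoid.ext h
  obtain rfl : flip = flip' := funext h'
  rfl

instance [Finite H] : Finite (Graph H) := by
  refine Finite.of_injective
    (fun Γ : Graph H => ((fun a b => Γ.vert a b, Γ.flip) : (H → H → Prop) × (H → H))) ?_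
  intro Γ Γ' h
  have h1 := congrArg Prod.fst h
  have h2 := congrArg Prod.snd h
  exact ext' (fun a b => iff_of_eq (congrFun (congrFun h1 a) b)) fun a => congrFun h2 a

instance : MulAction (Equiv.Perm H) (Graph H) where
  smul g Γ :=
    { vert := Γ.vert.comap g.symm
      flip := fun h => g (Γ.flip (g.symm h))
      flip_flip := fun h => by simp [Γ.flip_flip]
      flip_ne := fun h => by
        rw [Ne, ← Equiv.eq_symm_apply]
        exact Γ.flip_ne _ }
  one_smul Γ := rfl
  mul_smul g g' Γ := rfl

theorem smul_vert (g : Equiv.Perm H) (Γ : Graph H) (a b : H) :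
    (g • Γ).vert a b ↔ Γ.vert (g.symm a) (g.symm b) := Iff.rfl

theorem smul_flip (g : Equiv.Perm H) (Γ : Graph H) (h : H) :
    (g • Γ).flip h = g (Γ.flip (g.symm h)) := rfl

theorem smul_eq_iff (g : Equiv.Perm H) (Γ Γ' : Graph H) :
    g • Γ = Γ' ↔ (∀ a b, Γ.vert a b ↔ Γ'.vert (g a) (g b)) ∧
      ∀ a, g (Γ.flip a) = Γ'.flip (g a) := by
  constructor
  · rintro rfl
    exact ⟨fun a b => by simp [smul_vert], fun a => by simp [smul_flip]⟩
  · rintro ⟨h, h'⟩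
    exact ext' (fun a b => by rw [smul_vert, h, Equiv.apply_symm_apply, Equiv.apply_symm_apply])
      fun a => by rw [smul_flip, h', Equiv.apply_symm_apply]

theorem card_stabilizer (Γ : Graph H) :
    Nat.card (MulAction.stabilizer (Equiv.Perm H) Γ) = Nat.card (Γ.Iso Γ) :=
  Nat.card_congr (Equiv.subtypeEquivRight fun g => by
    rw [MulAction.mem_stabilizer_iff, smul_eq_iff])

theorem Iso.connected {Γ : Graph H} {Γ' : Graph H'} (f : Γ.Iso Γ') (h : Γ.Connected) :
    Γ'.Connected := by
  obtain ⟨⟨a⟩, h⟩ := h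
  refine ⟨⟨f.1 a⟩, fun b c => ?_⟩
  obtain ⟨b, rfl⟩ := f.1.surjective b
  obtain ⟨c, rfl⟩ := f.1.surjective c
  induction h b c with
  | rel a b h =>
    refine .rel _ _ (h.imp (fun h => (f.2.1 _ _).1 h) ?_)
    rintro rfl
    exact f.2.2 a
  | refl a => exact .refl _
  | symm a b _ ih => exact .symm _ _ ih
  | trans a b c _ _ ih ih' => exact .trans _ _ _ ih ih'

end Graph

variable {V : Type*} [NormedAddCommGroup V] [InnerProductSpace ℝ V]
variable {ι : Type*} [Fintype ι] [DecidableEq ι]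
variable {R : Type*} [CommRing R] [Algebra ℂ R]
variable {H H' : Type}

omit [InnerProductSpace ℝ V] in
theorem IsSymmetric.isCyclic [Module ℝ V] {S : Tensors V} (hS : IsSymmetric S) : IsCyclic S :=
  fun k X => hS k (finRotate k).symm X

theorem IsSymmetric.apply_equiv {S : Tensors V} (hS : IsSymmetric S) (k : ℕ+) {α : Type*}
    (E E' : Fin k ≃ α) (g : α → ℂ ⊗[ℝ] V) : (S k fun i => g (E i)) = S k fun i => g (E' i) := by
  rw [← hS k (E'.trans E.symm) fun i => g (E i)]
  simp

/-- The tensors `S_k / (k - 1)!`. -/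
def cyclicTensors (S : Tensors V) : Tensors V := fun k => (((k : ℕ) - 1)! : ℂ)⁻¹ • S k

theorem isCyclic_cyclicTensors {S : Tensors V} (hS : IsSymmetric S) : IsCyclic (cyclicTensors S) :=
  fun k X => by
    simp only [cyclicTensors, smul_apply]
    rw [hS.isCyclic]

/-- The reduction to the cyclic case changes neither the exponent nor the integral, because k ·
(k-1)! = k!. -/
theorem diag_cyclicTensors (S : Tensors V) (k : ℕ+) (v : V) :
    (cyclicTensors S).diag k v / (k : ℕ) = S.diag k v / ((k : ℕ)! : ℕ) := by
  rw [← Nat.mul_factorial_pred k.ne_zero, Tensors.diag, cyclicTensors, smul_apply,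
    Tensors.diag, smul_eq_mul]
  push_cast
  rw [mul_comm (k : ℂ), ← div_div, inv_mul_eq_div]

/-- By symmetry any enumeration of the half-edges at a vertex may be replaced by the one along its
cycle. -/
theorem graphValue_toGraph [Fintype H] [DecidableEq H] (e : Module.Basis ι ℝ V) {S : Tensors V}
    (hS : IsSymmetric S) (x : ℕ+ → R) (Γ : RibbonGraph H) :
    graphValue e S x Γ.toGraph = ribbonValue e S x Γ := by
  refine Finset.sum_congr rfl fun c _ => ?_
  congr 1
  refine finprod_congr fun v => ?_
  congr 2
  let E : Fin (Γ.toGraph.valence v) ≃ Γ.toGraph.Leg v :=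
    (finCongr (congrArg PNat.val (Γ.toGraph.valence_eq v))).trans
      ((cycleEquiv Γ.next (Quotient.out v)).trans (Equiv.subtypeEquivRight fun b =>
        (Quotient.mk_eq_iff_out (s := Γ.toGraph.vert)).symm))
  exact hS.apply_equiv (Γ.toGraph.valence v) (Finite.equivFin (Γ.toGraph.Leg v)).symm E
    fun h => (1 : ℂ) ⊗ₜ[ℝ] e (c h.1)

/-- The number of systems of cyclic orders is a product of factorials, hence positive. This
transfers facts about ribbon values to ordinary graphs. -/
theorem exists_toGraph_eq [Fintype H] [DecidableEq H] (Γ : Graph H) :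
    ∃ Γ' : RibbonGraph H, Γ'.toGraph = Γ := by
  classical
  have h : 0 < (Finset.univ.filter fun σ : Equiv.Perm H => cycleSetoid σ = Γ.vert).card := by
    rw [card_cycleSetoid_eq, classProd_eq_prod]
    exact Finset.prod_pos fun _ _ => Nat.factorial_pos _
  obtain ⟨σ, hσ⟩ := Finset.card_pos.1 h
  exact ⟨⟨σ, Γ.flip, Γ.flip_flip, Γ.flip_ne⟩, Graph.ext'
    (fun a b => by rw [← (Finset.mem_filter.1 hσ).2]; rfl) fun _ => rfl⟩

theorem graphValue_eq_prod [Fintype H] [DecidableEq H] (e : Module.Basis ι ℝ V) {S : Tensors V}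
    (hS : IsSymmetric S) (x : ℕ+ → R) (Γ : Graph H) :
    graphValue e S x Γ = ((classType Γ.vert).prod fun k n => x k ^ n) *
      algebraMap ℂ R (graphValue e S 1 Γ) := by
  obtain ⟨Γ, rfl⟩ := exists_toGraph_eq Γ
  rw [graphValue_toGraph e hS, graphValue_toGraph e hS, ribbonValue_eq_prod]

theorem graphValue_iso [Fintype H] [DecidableEq H] [Fintype H'] [DecidableEq H']
    (e : Module.Basis ι ℝ V) {S : Tensors V} (hS : IsSymmetric S) (x : ℕ+ → R) {Γ : Graph H}
    {Γ' : Graph H'} (f : Γ.Iso Γ') : graphValue e S x Γ = graphValue e S x Γ' := by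
  obtain ⟨G, rfl⟩ := exists_toGraph_eq Γ
  -- The cyclic orders chosen on `Γ` are transported along `f`, which makes `f` an isomorphism of
  -- ribbon graphs.
  let G' : RibbonGraph H' := ⟨f.1.permCongr G.next, Γ'.flip, Γ'.flip_flip, Γ'.flip_ne⟩
  have hG' : G'.toGraph = Γ' := by
    refine Graph.ext' (fun a b => ?_) fun _ => rfl
    obtain ⟨a, rfl⟩ := f.1.surjective a
    obtain ⟨b, rfl⟩ := f.1.surjective b
    exact (sameCycle_permCongr f.1 G.next a b).trans (f.2.1 a b)
  have hf : G.Iso G' := ⟨f.1, fun a => by simp [G'], f.2.2⟩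
  rw [← hG', graphValue_toGraph e hS, graphValue_toGraph e hS, ribbonValue_iso e hS.isCyclic x hf]

theorem ribbonValue_cyclicTensors [Fintype H] [DecidableEq H] (e : Module.Basis ι ℝ V)
    (S : Tensors V) (x : ℕ+ → R) (Γ : RibbonGraph H) :
    ribbonValue e (cyclicTensors S) x Γ = algebraMap ℂ R
      (classProd Γ.toGraph.vert fun h => (((classSize Γ.toGraph.vert h : ℕ) - 1)! : ℂ))⁻¹ *
      ribbonValue e S x Γ := by
  -- The scalars 1/(k-1)! are moved from the tensors into the parameters; the monomial dependence on
  -- the parameters then extracts them.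
  have h : ribbonValue e (cyclicTensors S) x Γ =
      ribbonValue e S (fun k => x k * algebraMap ℂ R ((((k : ℕ) - 1)! : ℂ)⁻¹)) Γ := by
    simp_rw [ribbonValue_eq_sum, colouredValue]
    refine Finset.sum_congr rfl fun c _ => ?_
    congr 1
    refine classProd_eq_of_rel fun h => ?_
    simp only [vertexValue, cyclicTensors, smul_apply, smul_eq_mul, map_mul]
    ring
  have h2 : (classProd Γ.toGraph.vert fun h => (((classSize Γ.toGraph.vert h : ℕ) - 1)! : ℂ))⁻¹ =
      (classType Γ.toGraph.vert).prod fun k n => ((((k : ℕ) - 1)! : ℂ)⁻¹) ^ n := by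
    rw [classProd_classSize Γ.toGraph.vert fun k : ℕ+ => (((k : ℕ) - 1)! : ℂ), Finsupp.prod,
      ← Finset.prod_inv_distrib]
    simp [Finsupp.prod]
  rw [h, h2, ribbonValue_eq_prod, ribbonValue_eq_prod e S x]
  simp_rw [mul_pow]
  rw [Finsupp.prod_mul, map_finsuppProd]
  simp_rw [map_pow]
  ring

open Classical in
-- All ribbon structures on `Γ` have the same value, and their number, the product of the (k-1)!
-- over the vertices, cancels the denominators of `cyclicTensors`.
theorem sum_toGraph_eq [Fintype H] [DecidableEq H] [Fintype (RibbonGraph H)]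
    (e : Module.Basis ι ℝ V) {S : Tensors V} (hS : IsSymmetric S) (x : ℕ+ → R) (Γ : Graph H) :
    ∑ Γ' : RibbonGraph H with Γ'.toGraph = Γ, ribbonValue e (cyclicTensors S) x Γ' =
      graphValue e S x Γ := by
  have h1 : ∀ Γ' : RibbonGraph H, Γ'.toGraph = Γ →
      ribbonValue e (cyclicTensors S) x Γ' = algebraMap ℂ R
        (classProd Γ.vert fun h => (((classSize Γ.vert h : ℕ) - 1)! : ℂ))⁻¹ *
        graphValue e S x Γ := by
    rintro Γ' rfl
    rw [ribbonValue_cyclicTensors, graphValue_toGraph e hS]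
  rw [Finset.sum_congr rfl fun Γ' hΓ' => h1 Γ' (Finset.mem_filter.1 hΓ').2, Finset.sum_const]
  have h2 : (Finset.univ.filter fun Γ' : RibbonGraph H => Γ'.toGraph = Γ).card =
      (Finset.univ.filter fun σ : Equiv.Perm H => cycleSetoid σ = Γ.vert).card := by
    refine Finset.card_bij (fun Γ' _ => Γ'.next) ?_ ?_ ?_
    · intro Γ' hΓ'
      simp only [Finset.mem_filter, Finset.mem_univ, true_and] at hΓ' ⊢
      rw [← hΓ']
      rfl
    · intro G hG G' hG' h
      simp only [Finset.mem_filter, Finset.mem_univ, true_and] at hG hG'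
      refine RibbonGraph.ext' (fun a => by rw [h]) fun a => ?_
      exact congrFun (congrArg Graph.flip (hG.trans hG'.symm)) a
    · intro σ hσ
      simp only [Finset.mem_filter, Finset.mem_univ, true_and] at hσ
      refine ⟨⟨σ, Γ.flip, Γ.flip_flip, Γ.flip_ne⟩, ?_, rfl⟩
      simp only [Finset.mem_filter, Finset.mem_univ, true_and]
      exact Graph.ext' (fun a b => by rw [← hσ]; rfl) fun _ => rfl
  rw [h2, card_cycleSetoid_eq, nsmul_eq_mul, ← mul_assoc, ← map_natCast (algebraMap ℂ R),
    ← map_mul]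
  have h3 : classProd Γ.vert (fun h => (((classSize Γ.vert h : ℕ) - 1)! : ℂ)) =
      ((classProd Γ.vert fun h => ((classSize Γ.vert h : ℕ) - 1)! : ℕ) : ℂ) :=
    (map_classProd (Nat.castRingHom ℂ) Γ.vert _).symm
  have h4 : (classProd Γ.vert fun h => ((classSize Γ.vert h : ℕ) - 1)!) ≠ 0 := by
    rw [classProd_eq_prod]
    exact (Finset.prod_pos fun _ _ => Nat.factorial_pos _).ne'
  rw [h3, mul_inv_cancel₀ (Nat.cast_ne_zero.2 h4), map_one, one_mul]

theorem graphSetoid_fst {p q : Σ n : ℕ, Graph (Fin n)} (h : graphSetoid p q) : p.1 = q.1 := by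
  obtain ⟨f⟩ := h
  simpa using Fintype.card_congr f.1

theorem graphSetoid_iff (n : ℕ) (a b : Graph (Fin n)) :
    graphSetoid ⟨n, a⟩ ⟨n, b⟩ ↔ ∃ g : Equiv.Perm (Fin n), g • a = b := by
  simp_rw [Graph.smul_eq_iff]
  exact ⟨fun ⟨f⟩ => ⟨f.1, f.2⟩, fun ⟨g, hg⟩ => ⟨⟨g, hg⟩⟩⟩

theorem coeff_graphValue [Fintype H] [DecidableEq H] (e : Module.Basis ι ℝ V)
    {S : Tensors V} (hS : IsSymmetric S) (Γ : Graph H) (m : ℕ+ →₀ ℕ) :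
    MvPowerSeries.coeff m (graphValue e S (fun k => (MvPowerSeries.X k : MvPowerSeries ℕ+ ℂ)) Γ) =
      if m = classType Γ.vert then graphValue e S 1 Γ else 0 := by
  obtain ⟨Γ, rfl⟩ := exists_toGraph_eq Γ
  rw [graphValue_toGraph e hS, graphValue_toGraph e hS, coeff_ribbonValue]

open Classical in
theorem finsum_graphTerm (e : Module.Basis ι ℝ V) {S : Tensors V} (hS : IsSymmetric S)
    (m : ℕ+ →₀ ℕ) :
    ∑ᶠ γ, MvPowerSeries.coeff m
      (graphTerm e S (fun k => (MvPowerSeries.X k : MvPowerSeries ℕ+ ℂ)) γ) =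
      MvPowerSeries.coeff m (connectedSeries e (cyclicTensors S)) := by
  set f : (Σ n : ℕ, Graph (Fin n)) → ℂ := fun p => if p.2.Connected then
    MvPowerSeries.coeff m
      (graphValue e S (fun k => (MvPowerSeries.X k : MvPowerSeries ℕ+ ℂ)) p.2) else 0 with hf
  have hinv : ∀ p q, graphSetoid p q → f p = f q := by
    rintro p q ⟨g⟩
    have hg : Nonempty (q.2.Iso p.2) := graphSetoid.symm' ⟨g⟩
    rw [hf]
    refine if_congr ⟨g.connected, hg.some.connected⟩ ?_ rfl
    rw [graphValue_iso e hS _ g]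
  have hn : ∀ p, f p ≠ 0 → p.1 = wt m := by
    intro p hp
    simp only [hf, coeff_graphValue e hS] at hp
    split_ifs at hp with h1 h2
    · rw [h2, wt_classType, Nat.card_fin]
    · exact absurd rfl hp
    · exact absurd rfl hp
  have key := finsum_isoClasses (fun p q => graphSetoid_fst) graphSetoid_iff hinv hn
  -- Labelled ribbon graphs are grouped by their underlying graph; connectedness depends only on the
  -- latter.
  have hsum : ∑ᶠ Γ : Graph (Fin (wt m)), f ⟨wt m, Γ⟩ = ∑ᶠ Γ : RibbonGraph (Fin (wt m)),
      if Γ.toGraph.Connected then MvPowerSeries.coeff m (ribbonValue e (cyclicTensors S)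
        (fun k => (MvPowerSeries.X k : MvPowerSeries ℕ+ ℂ)) Γ) else 0 := by
    have := Fintype.ofFinite (RibbonGraph (Fin (wt m)))
    have := Fintype.ofFinite (Graph (Fin (wt m)))
    rw [finsum_eq_sum_of_fintype, finsum_eq_sum_of_fintype,
      ← Finset.sum_fiberwise Finset.univ RibbonGraph.toGraph]
    refine Finset.sum_congr rfl fun Γ _ => ?_
    rw [Finset.sum_congr rfl fun Γ' hΓ' => by rw [(Finset.mem_filter.1 hΓ').2]]
    simp only [hf]
    split_ifs
    · rw [← sum_toGraph_eq e hS, map_sum]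
    · simp
  rw [coeff_connectedSeries, ← hsum, ← key]
  refine Eq.trans (finsum_congr fun γ => ?_) ((finsum_subtype_eq_finsum_cond
    (f := fun γ : Quotient graphSetoid => (Nat.card (γ.out.2.Iso γ.out.2) : ℂ)⁻¹ *
      MvPowerSeries.coeff m
        (graphValue e S (fun k => (MvPowerSeries.X k : MvPowerSeries ℕ+ ℂ)) γ.out.2))
    (p := fun γ => γ.out.2.Connected)).trans (finsum_congr fun γ => ?_))
  · rw [graphTerm, map_smul, smul_eq_mul]
    rfl
  · by_cases hγ : γ.out.2.Connected
    · simp only [hγ, hf, if_true, finsum_true, Graph.card_stabilizer]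
    · simp [hγ, hf]

end Ordinary

/-! ### Homogeneous parts -/

section HomPart

open MvPowerSeries

/-- The homogeneous part of degree `p` of a formal power series, evaluated at parameters that
vanish outside `s`. -/
def homPart (s : Finset ℕ+) (f : MvPowerSeries ℕ+ ℂ) (x : ℕ+ → ℂ) (p : ℕ) : ℂ :=
  ∑ m ∈ s.finsuppAntidiag p, coeff m f * m.prod fun k n => x k ^ n

variable {s : Finset ℕ+} {x : ℕ+ → ℂ}

theorem mem_finsuppAntidiag_iff {m : ℕ+ →₀ ℕ} {p : ℕ} :
    m ∈ s.finsuppAntidiag p ↔ m.degree = p ∧ m.support ⊆ s := by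
  rw [Finset.mem_finsuppAntidiag, and_congr_left_iff]
  intro h
  rw [Finsupp.degree_apply, Finset.sum_subset h]
  exact fun k _ hk => Finsupp.notMem_support_iff.1 hk

theorem prod_pow_eq_zero (hx : ∀ k ∉ s, x k = 0) {m : ℕ+ →₀ ℕ} (hm : ¬m.support ⊆ s) :
    (m.prod fun k n => x k ^ n) = 0 := by
  obtain ⟨k, hk, hks⟩ := Finset.not_subset.1 hm
  exact Finset.prod_eq_zero hk (by
    change x k ^ m k = 0
    rw [hx k hks, zero_pow (Finsupp.mem_support_iff.1 hk)])

theorem hasSubst_lineMap (hx : ∀ k ∉ s, x k = 0) :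
    HasSubst fun k => (PowerSeries.C (x k) * PowerSeries.X : PowerSeries ℂ) where
  const_coeff k := by
    change IsNilpotent (PowerSeries.constantCoeff (PowerSeries.C (x k) * PowerSeries.X))
    simp
  coeff_zero d := by
    refine s.finite_toSet.subset fun k hk => ?_
    by_contra hks
    refine hk ?_
    simp [hx k (by simpa using hks)]

/-- Restricting a series to the line through `x`, with coordinate `X`, collects its homogeneous
parts into a series in one variable. As substitution is compatible with composition, identities such
as Z = exp F pass to homogeneous parts. -/
theorem coeff_subst_line (hx : ∀ k ∉ s, x k = 0) (f : MvPowerSeries ℕ+ ℂ) (p : ℕ) :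
    PowerSeries.coeff p (subst (fun k => (PowerSeries.C (x k) * PowerSeries.X : PowerSeries ℂ)) f) =
      homPart s f x p := by
  have h1 : ∀ m : ℕ+ →₀ ℕ, (m.prod fun k n => (PowerSeries.C (x k) * PowerSeries.X :
      PowerSeries ℂ) ^ n) =
        PowerSeries.C (m.prod fun k n => x k ^ n) * PowerSeries.X ^ m.degree := by
    intro m
    simp_rw [mul_pow]
    rw [Finsupp.prod_mul, Finsupp.prod, Finsupp.prod, Finset.prod_pow_eq_pow_sum, map_finsuppProd]
    simp_rw [map_pow]
    rfl
  rw [PowerSeries.coeff, coeff_subst (hasSubst_lineMap hx), homPart]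
  have h2 : ∀ m : ℕ+ →₀ ℕ, coeff m f • coeff (Finsupp.single () p)
      (m.prod fun k n => (PowerSeries.C (x k) * PowerSeries.X : PowerSeries ℂ) ^ n) =
      if m.degree = p then coeff m f * m.prod (fun k n => x k ^ n) else 0 := by
    intro m
    rw [h1, show coeff (Finsupp.single () p) = PowerSeries.coeff (R := ℂ) p from rfl,
      PowerSeries.coeff_C_mul, PowerSeries.coeff_X_pow, smul_eq_mul]
    simp only [eq_comm (a := p)]
    split_ifs <;> simp
  simp_rw [h2]
  rw [finsum_eq_sum_of_support_subset (s := s.finsuppAntidiag p)]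
  · refine Finset.sum_congr rfl fun m hm => ?_
    rw [if_pos (mem_finsuppAntidiag_iff.1 hm).1]
  · intro m hm
    rw [Finset.mem_coe, mem_finsuppAntidiag_iff]
    rw [Function.mem_support] at hm
    by_contra h
    refine hm ?_
    split_ifs with hd
    · rw [prod_pow_eq_zero hx fun h' => h ⟨hd, h'⟩, mul_zero]
    · rfl

theorem subst_line_exp (hx : ∀ k ∉ s, x k = 0) {a : MvPowerSeries ℕ+ ℂ}
    (ha : constantCoeff a = 0) :
    subst (fun k => (PowerSeries.C (x k) * PowerSeries.X : PowerSeries ℂ))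
      ((PowerSeries.exp ℂ).subst a) = (PowerSeries.exp ℂ).subst
        (subst (fun k => (PowerSeries.C (x k) * PowerSeries.X : PowerSeries ℂ)) a) :=
  subst_comp_subst_apply (PowerSeries.HasSubst.of_constantCoeff_zero ha).const
    (hasSubst_lineMap hx) _

variable {V : Type*} [NormedAddCommGroup V] [InnerProductSpace ℝ V]

theorem potential_eq_sum (hx : ∀ k ∉ s, x k = 0) (T : Tensors V) (w : ℕ+ → ℂ) (v : V) :
    potential T w x v = ∑ k ∈ s, x k * (T.diag k v / w k) :=
  tsum_eq_sum fun k hk => by rw [hx k hk, zero_mul]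

theorem subst_line_potentialSeries (hx : ∀ k ∉ s, x k = 0) (T : Tensors V) (w : ℕ+ → ℂ) (v : V) :
    (subst (fun k => (PowerSeries.C (x k) * PowerSeries.X : PowerSeries ℂ))
      (potentialSeries T w v) : PowerSeries ℂ) = potential T w x v • PowerSeries.X := by
  ext p
  rw [coeff_subst_line hx, PowerSeries.coeff_smul, PowerSeries.coeff_X, homPart, smul_eq_mul,
    mul_ite, mul_one, mul_zero]
  split_ifs with hp
  · subst hp
    rw [potential_eq_sum hx]
    symm
    refine Finset.sum_of_injOn (fun k : ℕ+ => (Finsupp.single k 1 : ℕ+ →₀ ℕ))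
      single_pnat_injective.injOn ?_ ?_ ?_
    · intro k hk
      rw [Finset.mem_coe, mem_finsuppAntidiag_iff]
      refine ⟨by simp, Finsupp.support_single_subset.trans ?_⟩
      simpa using hk
    · intro m hm hm'
      rw [coeff_potentialSeries_eq_zero, zero_mul]
      rintro k rfl
      refine hm' ⟨k, ?_, rfl⟩
      have h := (mem_finsuppAntidiag_iff.1 hm).2
      rw [Finsupp.support_single k one_ne_zero] at h
      simpa using h
    · intro k _
      rw [coeff_potentialSeries_single]
      simp [mul_comm]
  · refine Finset.sum_eq_zero fun m hm => ?_
    rw [coeff_potentialSeries_eq_zero, zero_mul]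
    rintro k rfl
    exact hp (by rw [← (mem_finsuppAntidiag_iff.1 hm).1]; simp)

/-- On a line the potential is linear in the coordinate, so the exponential series takes its usual
coefficients. -/
theorem homPart_exp_potentialSeries (hx : ∀ k ∉ s, x k = 0) (T : Tensors V) (w : ℕ+ → ℂ) (v : V)
    (p : ℕ) : homPart s ((PowerSeries.exp ℂ).subst (potentialSeries T w v)) x p =
      potential T w x v ^ p / p ! := by
  rw [← coeff_subst_line hx, subst_line_exp hx (constantCoeff_potentialSeries T w v),
    subst_line_potentialSeries hx, ← PowerSeries.rescale_eq_subst, PowerSeries.coeff_rescale,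
    PowerSeries.coeff_exp]
  simp [div_eq_mul_inv]

variable [FiniteDimensional ℝ V] [MeasurableSpace V] [BorelSpace V]
variable {ι : Type*} [Fintype ι] [DecidableEq ι]

theorem homPart_partitionSeries (e : Module.Basis ι ℝ V) (hx : ∀ k ∉ s, x k = 0) (T : Tensors V)
    (p : ℕ) : homPart s (partitionSeries T fun k => ((k : ℕ) : ℂ)) x p =
      ∫ v, potential T (fun k => ((k : ℕ) : ℂ)) x v ^ p / p ! ∂(gaussian V) := by
  simp_rw [← homPart_exp_potentialSeries hx, homPart]
  rw [integral_finsetSum _ fun m _ => (integrable_coeff_exp_potentialSeries e T m).mul_const _]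
  refine Finset.sum_congr rfl fun m _ => ?_
  rw [integral_mul_const]
  rfl

theorem homPart_zero (f : MvPowerSeries ℕ+ ℂ) : homPart s f x 0 = constantCoeff f := by
  simp [homPart]

/-- Up to degree `N`, the homogeneous parts of the partition series are those of the exponential
of the free energy. -/
theorem homPart_partitionSeries_eq_coeff (e : Module.Basis ι ℝ V) (hx : ∀ k ∉ s, x k = 0)
    {T : Tensors V} (hT : IsCyclic T) {p N : ℕ} (hp : p < N) {q : Polynomial ℂ}
    (hq : ∀ i < N, q.coeff i = homPart s (connectedSeries e T) x i) :
    homPart s (partitionSeries T fun k => ((k : ℕ) : ℂ)) x p =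
      (∑ j ∈ Finset.range N, (j ! : ℂ)⁻¹ • q ^ j).coeff p := by
  set a := fun k => (PowerSeries.C (x k) * PowerSeries.X : PowerSeries ℂ)
  set L : PowerSeries ℂ := subst a (connectedSeries e T) with hL
  have hLc : ∀ i, PowerSeries.coeff i L = homPart s (connectedSeries e T) x i :=
    coeff_subst_line hx _
  have hL0 : PowerSeries.constantCoeff L = 0 := by
    rw [← PowerSeries.coeff_zero_eq_constantCoeff_apply, hLc, homPart_zero,
      constantCoeff_connectedSeries]
  -- Modulo `X ^ N` the free energy on the line may be replaced by the polynomial `q`. Powers `L ^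
  -- j` with `j ≥ N` do not reach degree `p`, as `L` has no constant term.
  have hdvd : ∀ j, PowerSeries.X ^ N ∣ L ^ j - (q : PowerSeries ℂ) ^ j := fun j => by
    refine dvd_trans ?_ (sub_dvd_pow_sub_pow _ _ j)
    rw [PowerSeries.X_pow_dvd_iff]
    intro i hi
    rw [map_sub, hLc, Polynomial.coeff_coe, hq i hi, sub_self]
  rw [← coeff_subst_line hx, partitionSeries_eq e hT,
    subst_line_exp hx (constantCoeff_connectedSeries e T),
    PowerSeries.coeff_subst' (PowerSeries.HasSubst.of_constantCoeff_zero' hL0),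
    finsum_eq_sum_of_support_subset (s := Finset.range N), Polynomial.finsetSum_coeff]
  · refine Finset.sum_congr rfl fun j _ => ?_
    have h := PowerSeries.X_pow_dvd_iff.1 (hdvd j) p hp
    rw [map_sub, sub_eq_zero, ← Polynomial.coe_pow, Polynomial.coeff_coe] at h
    rw [h, Polynomial.coeff_smul, PowerSeries.coeff_exp]
    simp
  · intro j hj
    rw [Finset.coe_range, Set.mem_Iio]
    by_contra h
    refine hj ?_
    have h1 : PowerSeries.X ^ j ∣ L ^ j := pow_dvd_pow_of_dvd (PowerSeries.X_dvd_iff.2 hL0) j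
    simp only
    rw [PowerSeries.X_pow_dvd_iff.1 h1 p (hp.trans_le (not_lt.1 h)), smul_zero]

end HomPart

/-! ### The asymptotic expansion of the partition function -/

section Taylor

theorem hasDerivAt_exp_sub_sum (N : ℕ) (z : ℂ) :
    HasDerivAt (fun z => Complex.exp z - ∑ p ∈ Finset.range (N + 1), z ^ p / (p ! : ℂ))
      (Complex.exp z - ∑ p ∈ Finset.range N, z ^ p / p !) z := by
  refine (Complex.hasDerivAt_exp z).sub ?_
  simp_rw [Finset.sum_range_succ']
  have h : HasDerivAt (fun z : ℂ => ∑ p ∈ Finset.range N, z ^ (p + 1) / (p + 1)!)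
      (∑ p ∈ Finset.range N, z ^ p / p !) z := by
    refine HasDerivAt.fun_sum fun p _ => ?_
    refine ((hasDerivAt_pow (p + 1) z).div_const _).congr_deriv ?_
    have h1 : (p ! : ℂ) ≠ 0 := Nat.cast_ne_zero.2 (Nat.factorial_ne_zero p)
    have h2 : (p : ℂ) + 1 ≠ 0 := by exact_mod_cast p.succ_ne_zero
    rw [Nat.factorial_succ, Nat.add_sub_cancel]
    push_cast
    field_simp
  simpa using h

/-- Taylor's formula for the exponential function, with a bound of the remainder in terms of the
real part. -/
theorem norm_exp_sub_sum_le (N : ℕ) (z : ℂ) :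
    ‖Complex.exp z - ∑ p ∈ Finset.range N, z ^ p / (p ! : ℂ)‖ ≤
      Real.exp (max 0 z.re) * ‖z‖ ^ N := by
  -- A convex set containing 0 and `z`, on which |exp| is at most `exp (max 0 z.re)`. Each remainder
  -- is the derivative of the next, so every application of the mean value inequality on `S` gains a
  -- factor `‖z‖`.
  set S : Set ℂ := {w | w.re ≤ max 0 z.re} ∩ Metric.closedBall 0 ‖z‖ with hS
  have hconv : Convex ℝ S :=
    (convex_halfSpace_re_le _).inter (convex_closedBall _ _)
  have h0 : (0 : ℂ) ∈ S := ⟨by simp, by simp⟩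
  have hz : z ∈ S := ⟨by simp, by simp⟩
  suffices h : ∀ N : ℕ, ∀ w ∈ S, ‖Complex.exp w - ∑ p ∈ Finset.range N, w ^ p / (p ! : ℂ)‖ ≤
      Real.exp (max 0 z.re) * ‖z‖ ^ N from h N z hz
  intro N
  induction N with
  | zero =>
    intro w hw
    simpa [Complex.norm_exp] using hw.1
  | succ N ih =>
    intro w hw
    have h := hconv.norm_image_sub_le_of_norm_hasDerivWithin_le
      (fun y _ => (hasDerivAt_exp_sub_sum N y).hasDerivWithinAt) ih h0 hw
    have h1 : Complex.exp 0 - ∑ p ∈ Finset.range (N + 1), (0 : ℂ) ^ p / p ! = 0 := by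
      rw [Finset.sum_range_succ']
      simp
    rw [h1, sub_zero, sub_zero] at h
    refine h.trans ?_
    rw [pow_succ, ← mul_assoc]
    refine mul_le_mul_of_nonneg_left ?_ (by positivity)
    simpa using hw.2

end Taylor

/-! ### Uniform bounds for the exponent and for the remainder of the partition function -/

section Bounds

variable {V : Type*} [NormedAddCommGroup V] [InnerProductSpace ℝ V]
variable {ι : Type*} [Fintype ι] [DecidableEq ι]

theorem exists_norm_diag_le (e : Module.Basis ι ℝ V) (T : Tensors V) (k : ℕ+) :
    ∃ c : ℝ, 0 ≤ c ∧ ∀ v, ‖T.diag k v‖ ≤ c * ‖v‖ ^ (k : ℕ) := by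
  refine ⟨∑ d : Fin k → ι, ‖T k fun i => (1 : ℂ) ⊗ₜ[ℝ] e (d i)‖ * ∏ i, ‖dualVector e (d i)‖,
    by positivity, fun v => ?_⟩
  rw [T.diag_eq_sum e, Finset.sum_mul]
  refine (norm_sum_le _ _).trans (Finset.sum_le_sum fun d _ => ?_)
  rw [norm_mul, mul_assoc]
  refine mul_le_mul_of_nonneg_left ?_ (norm_nonneg _)
  rw [norm_prod]
  calc ∏ i, ‖((e.repr v (d i) : ℝ) : ℂ)‖ ≤ ∏ i : Fin k, ‖dualVector e (d i)‖ * ‖v‖ := by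
        refine Finset.prod_le_prod (fun _ _ => norm_nonneg _) fun i _ => ?_
        rw [Complex.norm_real, ← inner_dualVector]
        exact norm_inner_le_norm _ _
    _ = _ := by simp [Finset.prod_mul_distrib]

theorem continuous_diag (e : Module.Basis ι ℝ V) (T : Tensors V) (k : ℕ+) :
    Continuous (T.diag k) := by
  rw [show T.diag k = _ from funext fun v => T.diag_eq_sum e k v]
  simp_rw [← inner_dualVector]
  fun_prop

/-- A polynomial bound of the exponent, uniform in the parameters. -/
theorem exists_norm_potential_le (e : Module.Basis ι ℝ V) (T : Tensors V) (w : ℕ+ → ℂ)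
    (s : Finset ℕ+) : ∃ (c : ℝ) (n : ℕ), 0 ≤ c ∧ ∀ x : ℕ+ → ℂ, (∀ k ∉ s, x k = 0) → ∀ v : V,
      ‖potential T w x v‖ ≤ (∑ k ∈ s, ‖x k‖) * (c * (1 + ‖v‖) ^ n) := by
  choose c hc0 hc using exists_norm_diag_le e T
  -- Sums over `s` dominate each single constant and each single exponent; the base `1 + ‖v‖ ≥ 1`
  -- allows the exponent to be enlarged.
  refine ⟨∑ k ∈ s, c k / ‖w k‖, ∑ k ∈ s, (k : ℕ),
    Finset.sum_nonneg fun k _ => div_nonneg (hc0 k) (norm_nonneg _), fun x hx v => ?_⟩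
  rw [potential_eq_sum hx, Finset.sum_mul]
  refine (norm_sum_le _ _).trans (Finset.sum_le_sum fun k hk => ?_)
  rw [norm_mul, norm_div]
  refine mul_le_mul_of_nonneg_left ?_ (norm_nonneg _)
  have h1 : ‖v‖ ^ (k : ℕ) ≤ (1 + ‖v‖) ^ ∑ k ∈ s, (k : ℕ) :=
    (pow_le_pow_left₀ (norm_nonneg v) (by linarith) _).trans
      (pow_le_pow_right₀ (by linarith [norm_nonneg v])
        (Finset.single_le_sum (f := fun k : ℕ+ => (k : ℕ)) (fun _ _ => Nat.zero_le _) hk))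
  calc ‖T.diag k v‖ / ‖w k‖ ≤ c k * ‖v‖ ^ (k : ℕ) / ‖w k‖ :=
        div_le_div_of_nonneg_right (hc k v) (norm_nonneg _)
    _ = c k / ‖w k‖ * ‖v‖ ^ (k : ℕ) := by ring
    _ ≤ _ := mul_le_mul (Finset.single_le_sum (f := fun k => c k / ‖w k‖)
        (fun k _ => div_nonneg (hc0 k) (norm_nonneg _)) hk) h1 (by positivity)
        (Finset.sum_nonneg fun k _ => div_nonneg (hc0 k) (norm_nonneg _))

theorem continuous_potential (e : Module.Basis ι ℝ V) (T : Tensors V) (w : ℕ+ → ℂ)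
    {s : Finset ℕ+} {x : ℕ+ → ℂ} (hx : ∀ k ∉ s, x k = 0) : Continuous (potential T w x) := by
  rw [show potential T w x = _ from funext fun v => potential_eq_sum hx T w v]
  exact continuous_finsetSum _ fun k _ => ((continuous_diag e T k).div_const _).const_mul _

variable [FiniteDimensional ℝ V] [MeasurableSpace V] [BorelSpace V]

theorem integrable_one_add_pow_mul_exp (n : ℕ) {a : ℝ} (ha : a < 1 / 2) :
    Integrable (fun v : V => (1 + ‖v‖) ^ n * Real.exp (a * ‖v‖ ^ 2)) (gaussian V) := by
  have h := ((integrable_pow_mul_exp (V := V) 0 ha).add (integrable_pow_mul_exp n ha)).const_mul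
    ((2 : ℝ) ^ (n - 1))
  refine h.mono' (by fun_prop) (.of_forall fun v => ?_)
  rw [Real.norm_of_nonneg (by positivity)]
  simp only [Pi.add_apply, pow_zero]
  rw [← add_mul, ← mul_assoc]
  refine mul_le_mul_of_nonneg_right ?_ (Real.exp_pos _).le
  simpa using add_pow_le zero_le_one (norm_nonneg v) n

theorem integrable_potential_pow (e : Module.Basis ι ℝ V) (T : Tensors V) (w : ℕ+ → ℂ)
    {s : Finset ℕ+} {x : ℕ+ → ℂ} (hx : ∀ k ∉ s, x k = 0) (p : ℕ) :
    Integrable (fun v => potential T w x v ^ p) (gaussian V) := by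
  obtain ⟨c, n, hc, h⟩ := exists_norm_potential_le e T w s
  have hi := (integrable_one_add_pow_mul_exp (V := V) (n * p) (a := 0) (by norm_num)).const_mul
    (((∑ k ∈ s, ‖x k‖) * c) ^ p)
  refine hi.mono' ((continuous_potential e T w hx).pow p).aestronglyMeasurable
    (.of_forall fun v => ?_)
  rw [norm_pow, zero_mul, Real.exp_zero, mul_one, pow_mul, ← mul_pow, mul_assoc]
  exact pow_le_pow_left₀ (norm_nonneg _) (h x hx v) p

/-- Integrate the pointwise Taylor bound. The domain condition controls the exponential and the
polynomial bound of the potential supplies |x|^N, so the constant does not depend on `x`. -/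
theorem norm_partitionIntegral_sub_le (e : Module.Basis ι ℝ V) (T : Tensors V)
    {s : Finset ℕ+} {D : Set (ℕ+ → ℂ)}
    (hD : IsConvergenceDomain T (fun k : ℕ+ => ((k : ℕ) : ℂ)) s D) (N : ℕ) :
    ∃ K : ℝ, ∀ x ∈ D, ‖partitionIntegral T (fun k : ℕ+ => ((k : ℕ) : ℂ)) x -
      ∑ p ∈ Finset.range N, homPart s (partitionSeries T fun k : ℕ+ => ((k : ℕ) : ℂ)) x p‖ ≤
        K * (∑ k ∈ s, ‖x k‖) ^ N := by
  obtain ⟨hs, a, ha, C, hC⟩ := hD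
  let w : ℕ+ → ℂ := fun k => ((k : ℕ) : ℂ)
  obtain ⟨c, n, hc, h⟩ := exists_norm_potential_le e T w s
  -- The remainder involves the positive part of the real part, so a negative `a` has to be replaced
  -- by 0.
  have ha' : max 0 a < 1 / 2 := max_lt (by norm_num) ha
  refine ⟨∫ v, Real.exp |C| * c ^ N * ((1 + ‖v‖) ^ (n * N) * Real.exp (max 0 a * ‖v‖ ^ 2))
    ∂(gaussian V), fun x hx => ?_⟩
  have hxs := hs x hx
  have hre : ∀ v, max 0 (potential T w x v).re ≤ |C| + max 0 a * ‖v‖ ^ 2 := fun v => by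
    refine max_le (by positivity) ((hC x hx v).trans (add_le_add (le_abs_self C) ?_))
    exact mul_le_mul_of_nonneg_right (le_max_right _ _) (by positivity)
  have hexp : Integrable (fun v => Complex.exp (potential T w x v)) (gaussian V) := by
    have hi := (integrable_one_add_pow_mul_exp (V := V) 0 ha').const_mul (Real.exp |C|)
    refine hi.mono' (Complex.continuous_exp.comp
      (continuous_potential e T w hxs)).aestronglyMeasurable (.of_forall fun v => ?_)
    rw [Complex.norm_exp, pow_zero, one_mul, ← Real.exp_add, Real.exp_le_exp]
    exact (le_max_right _ _).trans (hre v)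
  have hpow : ∀ p ∈ Finset.range N,
      Integrable (fun v => potential T w x v ^ p / p !) (gaussian V) := fun p _ =>
    (integrable_potential_pow e T w hxs p).div_const _
  rw [Finset.sum_congr rfl fun p _ => homPart_partitionSeries e hxs T p]
  rw [partitionIntegral, ← integral_finsetSum _ hpow,
    ← integral_sub hexp (integrable_finsetSum _ hpow), ← integral_mul_const]
  refine norm_integral_le_of_norm_le (((integrable_one_add_pow_mul_exp (n * N) ha').const_mul
    _).mul_const _) (.of_forall fun v => ?_)
  refine (norm_exp_sub_sum_le N _).trans ?_
  calc Real.exp (max 0 (potential T w x v).re) * ‖potential T w x v‖ ^ N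
      ≤ Real.exp (|C| + max 0 a * ‖v‖ ^ 2) *
          ((∑ k ∈ s, ‖x k‖) * (c * (1 + ‖v‖) ^ n)) ^ N :=
        mul_le_mul (Real.exp_le_exp.2 (hre v)) (pow_le_pow_left₀ (norm_nonneg _) (h x hxs v) N)
          (by positivity) (by positivity)
    _ = _ := by
        rw [Real.exp_add, mul_pow, mul_pow, ← pow_mul]
        ring

end Bounds

/-! ### The asymptotic expansion of the free energy -/

section Asymptotic

variable {s : Finset ℕ+} {D : Set (ℕ+ → ℂ)}

theorem tendsto_size (s : Finset ℕ+) (D : Set (ℕ+ → ℂ)) :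
    Tendsto (fun x : ℕ+ → ℂ => ∑ k ∈ s, ‖x k‖) (𝓝[D] 0) (𝓝 0) := by
  have h : Continuous fun x : ℕ+ → ℂ => ∑ k ∈ s, ‖x k‖ := by fun_prop
  simpa using (h.tendsto 0).mono_left nhdsWithin_le_nhds

theorem isBigO_size_pow {i j : ℕ} (h : i ≤ j) :
    (fun x : ℕ+ → ℂ => (∑ k ∈ s, ‖x k‖) ^ j) =O[𝓝[D] 0] fun x => (∑ k ∈ s, ‖x k‖) ^ i := by
  have h1 : (fun x : ℕ+ → ℂ => (∑ k ∈ s, ‖x k‖) ^ (j - i)) =O[𝓝[D] 0] fun _ => (1 : ℝ) :=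
    ((tendsto_size s D).pow (j - i)).isBigO_one ℝ
  have h2 := h1.mul (isBigO_refl (fun x : ℕ+ → ℂ => (∑ k ∈ s, ‖x k‖) ^ i) (𝓝[D] 0))
  simpa [← pow_add, Nat.sub_add_cancel h] using h2

theorem homPart_isBigO (f : MvPowerSeries ℕ+ ℂ) (p : ℕ) :
    (fun x => homPart s f x p) =O[𝓝[D] 0] fun x => (∑ k ∈ s, ‖x k‖) ^ p := by
  refine IsBigO.fun_sum fun m hm => IsBigO.const_mul_left ?_ _
  refine IsBigO.of_norm_le fun x => ?_
  obtain ⟨hd, hs⟩ := mem_finsuppAntidiag_iff.1 hm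
  rw [← hd, Finsupp.prod, norm_prod, Finsupp.degree_apply, ← Finset.prod_pow_eq_pow_sum]
  refine Finset.prod_le_prod (fun _ _ => norm_nonneg _) fun k hk => ?_
  rw [norm_pow]
  exact pow_le_pow_left₀ (norm_nonneg _)
    (Finset.single_le_sum (f := fun k => ‖x k‖) (fun _ _ => norm_nonneg _) (hs hk)) _

/-- Polynomials whose coefficients are functions of the parameters, the coefficient of degree `p`
being of order `p` in the parameters. -/
def IsGraded (s : Finset ℕ+) (D : Set (ℕ+ → ℂ)) (q : Polynomial ((ℕ+ → ℂ) → ℂ)) : Prop :=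
  ∀ p, q.coeff p =O[𝓝[D] 0] fun x => (∑ k ∈ s, ‖x k‖) ^ p

theorem IsGraded.mul {q q' : Polynomial ((ℕ+ → ℂ) → ℂ)} (h : IsGraded s D q)
    (h' : IsGraded s D q') : IsGraded s D (q * q') := by
  intro p
  rw [Polynomial.coeff_mul]
  refine IsBigO.sum fun i hi => ?_
  rw [← Finset.HasAntidiagonal.mem_antidiagonal.1 hi]
  simp_rw [pow_add]
  exact (h _).mul (h' _)

theorem IsGraded.pow {q : Polynomial ((ℕ+ → ℂ) → ℂ)} (h : IsGraded s D q) (n : ℕ) :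
    IsGraded s D (q ^ n) := by
  induction n with
  | zero =>
    intro p
    rw [pow_zero, Polynomial.coeff_one]
    split_ifs with hp
    · subst hp
      simp only [pow_zero]
      exact isBigO_const_const (1 : ℂ) one_ne_zero _
    · exact isBigO_zero _ _
  | succ n ih =>
    rw [pow_succ]
    exact ih.mul h

/-- Evaluating the grading variable at 1 and dropping the degrees below `N` leaves finitely many
terms, each of order at least `N`. -/
theorem IsGraded.isBigO_eval_sub {q : Polynomial ((ℕ+ → ℂ) → ℂ)} (h : IsGraded s D q) (N : ℕ) :
    (fun x => (q.eval 1) x - ∑ p ∈ Finset.range N, q.coeff p x) =O[𝓝[D] 0]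
      fun x => (∑ k ∈ s, ‖x k‖) ^ N := by
  have h1 : ∀ x, (q.eval 1) x - ∑ p ∈ Finset.range N, q.coeff p x =
      ∑ p ∈ Finset.Ico N (N + q.natDegree + 1), q.coeff p x := by
    intro x
    rw [Polynomial.eval_eq_sum_range' (n := N + q.natDegree + 1) (by lia), sub_eq_iff_eq_add',
      Finset.sum_range_add_sum_Ico _ (by lia)]
    simp
  simp_rw [h1]
  exact IsBigO.fun_sum fun p hp => (h p).trans (isBigO_size_pow (Finset.mem_Ico.1 hp).1)

variable {V : Type*} [NormedAddCommGroup V] [InnerProductSpace ℝ V] [FiniteDimensional ℝ V]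
  [MeasurableSpace V] [BorelSpace V]
variable {ι : Type*} [Fintype ι] [DecidableEq ι]

omit [FiniteDimensional ℝ V] [MeasurableSpace V] [BorelSpace V] in
theorem isBigO_sum_homPart (e : Module.Basis ι ℝ V) (T : Tensors V) (N : ℕ) :
    (fun x => ∑ p ∈ Finset.range N, homPart s (connectedSeries e T) x p) =O[𝓝[D] 0]
      fun x => ∑ k ∈ s, ‖x k‖ := by
  refine IsBigO.fun_sum fun p _ => ?_
  rcases Nat.eq_zero_or_pos p with rfl | hp
  · simp_rw [homPart_zero, constantCoeff_connectedSeries]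
    exact isBigO_zero _ _
  · simpa using (homPart_isBigO (connectedSeries e T) p).trans (isBigO_size_pow hp)

/-- The exponential of the truncated free energy is first replaced by its Taylor polynomial. As a
polynomial in a grading variable, this has the homogeneous parts of Z as coefficients below degree
`N`; everything else is of order `N`. -/
theorem exp_sum_homPart_isBigO (e : Module.Basis ι ℝ V) {T : Tensors V} (hT : IsCyclic T)
    (hD : ∀ x ∈ D, ∀ k ∉ s, x k = 0) (N : ℕ) :
    (fun x => Complex.exp (∑ p ∈ Finset.range N, homPart s (connectedSeries e T) x p) -
      ∑ p ∈ Finset.range N, homPart s (partitionSeries T fun k : ℕ+ => ((k : ℕ) : ℂ)) x p)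
      =O[𝓝[D] 0] fun x => (∑ k ∈ s, ‖x k‖) ^ N := by
  set y : (ℕ+ → ℂ) → ℂ := fun x => ∑ p ∈ Finset.range N, homPart s (connectedSeries e T) x p
    with hy
  have hyO : y =O[𝓝[D] 0] fun x => ∑ k ∈ s, ‖x k‖ := isBigO_sum_homPart e T N
  set q : Polynomial ((ℕ+ → ℂ) → ℂ) := ∑ p ∈ Finset.range N,
    Polynomial.monomial p fun x => homPart s (connectedSeries e T) x p with hq
  have hqc : ∀ p, q.coeff p = if p < N then fun x => homPart s (connectedSeries e T) x p
      else 0 := by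
    intro p
    simp [hq, Polynomial.finsetSum_coeff, Polynomial.coeff_monomial]
  have hqg : IsGraded s D q := by
    intro p
    rw [hqc]
    split_ifs
    · exact homPart_isBigO _ p
    · exact isBigO_zero _ _
  have hq1 : ∀ x, (q.eval 1) x = y x := fun x => by
    simp [hq, hy, Polynomial.eval_finsetSum]
  set Q := ∑ j ∈ Finset.range N, (j ! : ℂ)⁻¹ • q ^ j with hQ
  have hQg : IsGraded s D Q := by
    intro p
    rw [hQ, Polynomial.finsetSum_coeff]
    refine IsBigO.sum fun j _ => ?_
    rw [Polynomial.coeff_smul]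
    exact (hqg.pow j p).const_smul_left _
  -- Setting the grading variable to 1 recovers the Taylor polynomial of exp at `y x`.
  have hQ1 : ∀ x, (Q.eval 1) x = ∑ j ∈ Finset.range N, y x ^ j / j ! := fun x => by
    simp [hQ, Polynomial.eval_finsetSum, Polynomial.eval_smul, hq1, div_eq_inv_mul]
  have hQc : ∀ x ∈ D, ∀ p < N, Q.coeff p x =
      homPart s (partitionSeries T fun k : ℕ+ => ((k : ℕ) : ℂ)) x p := by
    intro x hx p hp
    rw [homPart_partitionSeries_eq_coeff e (hD x hx) hT hp
      (q := q.map (Pi.evalRingHom (fun _ : ℕ+ → ℂ => ℂ) x))]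
    · simp only [hQ, Polynomial.finsetSum_coeff, Polynomial.coeff_smul, ← Polynomial.map_pow,
        Polynomial.coeff_map, Finset.sum_apply, Pi.smul_apply]
      rfl
    · intro i hi
      simp [hqc, hi]
  have h1 : (fun x => Complex.exp (y x) - ∑ j ∈ Finset.range N, y x ^ j / j !) =O[𝓝[D] 0]
      fun x => (∑ k ∈ s, ‖x k‖) ^ N := by
    have hbd : (fun x => Real.exp (max 0 (y x).re)) =O[𝓝[D] 0] fun _ => (1 : ℝ) := by
      have h0 : Tendsto y (𝓝[D] 0) (𝓝 0) := hyO.trans_tendsto (tendsto_size s D)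
      have hc : Continuous fun z : ℂ => Real.exp (max 0 z.re) := by fun_prop
      exact ((hc.tendsto 0).comp h0).isBigO_one ℝ
    have h2 := hbd.mul (hyO.norm_left.pow N)
    simp only [one_mul] at h2
    refine IsBigO.trans (IsBigO.of_norm_le fun x => ?_) h2
    exact norm_exp_sub_sum_le N (y x)
  refine (h1.add (hQg.isBigO_eval_sub N)).congr' ?_ .rfl
  filter_upwards [self_mem_nhdsWithin] with x hx
  rw [hQ1, Finset.sum_congr rfl fun p hp => hQc x hx p (Finset.mem_range.1 hp)]
  ring

/-- Z and the exponential of the truncated free energy differ by O(|x|^N) and both tend to 1, where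
log is strictly differentiable and hence Lipschitz. -/
theorem log_partitionIntegral_isBigO (e : Module.Basis ι ℝ V) {T : Tensors V} (hT : IsCyclic T)
    (hD : IsConvergenceDomain T (fun k : ℕ+ => ((k : ℕ) : ℂ)) s D) (N : ℕ) :
    (fun x => Complex.log (partitionIntegral T (fun k : ℕ+ => ((k : ℕ) : ℂ)) x) -
      ∑ p ∈ Finset.range N, homPart s (connectedSeries e T) x p)
      =O[𝓝[D] 0] fun x => (∑ k ∈ s, ‖x k‖) ^ N := by
  have hZ : ∀ N, (fun x => partitionIntegral T (fun k : ℕ+ => ((k : ℕ) : ℂ)) x -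
      ∑ p ∈ Finset.range N, homPart s (partitionSeries T fun k : ℕ+ => ((k : ℕ) : ℂ)) x p)
      =O[𝓝[D] 0] fun x => (∑ k ∈ s, ‖x k‖) ^ N := by
    intro N
    obtain ⟨K, hK⟩ := norm_partitionIntegral_sub_le e T hD N
    refine IsBigO.of_bound K ?_
    filter_upwards [self_mem_nhdsWithin] with x hx
    rw [Real.norm_of_nonneg (by positivity)]
    exact hK x hx
  have hZ1 : Tendsto (fun x => partitionIntegral T (fun k : ℕ+ => ((k : ℕ) : ℂ)) x) (𝓝[D] 0)
      (𝓝 1) := by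
    -- The case `N = 1`: the only term subtracted is the constant term 1.
    have h := (hZ 1).trans_tendsto (by simpa using tendsto_size s D)
    simp only [Finset.sum_range_one, homPart_zero, constantCoeff_partitionSeries] at h
    simpa using h.add_const 1
  set y : (ℕ+ → ℂ) → ℂ := fun x => ∑ p ∈ Finset.range N, homPart s (connectedSeries e T) x p
    with hy
  have hy0 : Tendsto y (𝓝[D] 0) (𝓝 0) := (isBigO_sum_homPart e T N).trans_tendsto (tendsto_size s D)
  have hexp1 : Tendsto (fun x => Complex.exp (y x)) (𝓝[D] 0) (𝓝 1) := by
    simpa [Function.comp_def] using (Complex.continuous_exp.tendsto 0).comp hy0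
  -- Near 0 the imaginary part stays within (-π, π), so the principal logarithm inverts exp.
  have hlog : ∀ᶠ x in 𝓝[D] 0, Complex.log (Complex.exp (y x)) = y x := by
    filter_upwards [hy0.eventually (Metric.ball_mem_nhds 0 Real.pi_pos)] with x hx
    have h1 : |(y x).im| < Real.pi := (Complex.abs_im_le_norm _).trans_lt (by simpa using hx)
    exact Complex.log_exp (abs_lt.1 h1).1 (abs_lt.1 h1).2.le
  have hO := (Complex.hasStrictDerivAt_log Complex.one_mem_slitPlane).hasStrictFDerivAt.isBigO_sub
  have h2 := hO.comp_tendsto (hZ1.prodMk_nhds hexp1)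
  have h3 := (hZ N).sub (exp_sum_homPart_isBigO e hT hD.1 N)
  refine (h2.trans (h3.congr_left fun x => ?_)).congr' ?_ .rfl
  · simp only [Function.comp_apply]
    ring
  · filter_upwards [hlog] with x hx
    simp only [Function.comp_apply, hx]
    rfl

end Asymptotic

/-! ### Sums over isomorphism classes -/

section Sums

variable {G : Type*} {m : G → ℕ+ →₀ ℕ} {num : G → ℂ} {L : MvPowerSeries ℕ+ ℂ}

open Classical in
/-- If the terms of type `μ` add up to the coefficient of `L` at `μ`, then the terms of degree less
than `N` add up to the part of `L` of degree less than `N`. -/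
theorem finsum_degree_lt (hfin : ∀ μ, {γ | m γ = μ}.Finite)
    (hL : ∀ μ, ∑ᶠ γ, (if μ = m γ then num γ else 0) = MvPowerSeries.coeff μ L) {s : Finset ℕ+}
    {x : ℕ+ → ℂ} (hx : ∀ k ∉ s, x k = 0) (N : ℕ) :
    (Function.support fun γ : {γ // (m γ).degree < N} =>
        ((m γ).prod fun k n => x k ^ n) * num γ).Finite ∧
      ∑ᶠ γ : {γ // (m γ).degree < N}, ((m γ).prod fun k n => x k ^ n) * num γ =
        ∑ p ∈ Finset.range N, homPart s L x p := by
  -- The monomials of degree below `N` in the variables of `s`; all others either are excluded or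
  -- vanish at `x`. Only finitely many classes have their type in `A`, so the sum can be regrouped
  -- by type.
  set A : Finset (ℕ+ →₀ ℕ) := (Finset.range N).biUnion fun p => s.finsuppAntidiag p with hA
  have hmem : ∀ μ, μ ∈ A ↔ μ.degree < N ∧ μ.support ⊆ s := fun μ => by
    simp only [hA, Finset.mem_biUnion, Finset.mem_range, mem_finsuppAntidiag_iff]
    exact ⟨fun ⟨p, hp, h, h'⟩ => ⟨h ▸ hp, h'⟩, fun h => ⟨_, h.1, rfl, h.2⟩⟩
  have hB : {γ | m γ ∈ A}.Finite :=
    (A.finite_toSet.biUnion fun μ _ => hfin μ).subset fun γ hγ => by simpa using hγ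
  have hsupp : ∀ γ, (m γ).degree < N → ((m γ).prod fun k n => x k ^ n) * num γ ≠ 0 → m γ ∈ A := by
    intro γ h h'
    refine (hmem _).2 ⟨h, ?_⟩
    by_contra hs
    exact h' (by rw [prod_pow_eq_zero hx hs, zero_mul])
  refine ⟨(hB.preimage Subtype.val_injective.injOn).subset fun γ hγ => hsupp γ.1 γ.2 hγ, ?_⟩
  rw [finsum_subtype_eq_finsum_cond (f := fun γ => ((m γ).prod fun k n => x k ^ n) * num γ)
    (p := fun γ => (m γ).degree < N)]
  refine (finsum_mem_eq_sum_of_inter_support_eq (s := {γ | (m γ).degree < N}) (t := hB.toFinset) _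
    ?_).trans ?_
  · ext γ
    simp only [Set.mem_inter_iff, Set.mem_ofPred_eq, Function.mem_support, Finset.mem_coe,
      Set.Finite.mem_toFinset]
    exact and_congr_left fun h => ⟨fun h' => hsupp γ h' h, fun h' => ((hmem _).1 h').1⟩
  have hfiber : ∀ μ ∈ A, ∑ γ ∈ hB.toFinset with m γ = μ, ((m γ).prod fun k n => x k ^ n) * num γ =
      MvPowerSeries.coeff μ L * μ.prod fun k n => x k ^ n := by
    intro μ hμ
    rw [← hL, finsum_eq_sum_of_support_subset (s := hB.toFinset.filter fun γ => m γ = μ),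
      Finset.sum_mul]
    · refine Finset.sum_congr rfl fun γ hγ => ?_
      have h := (Finset.mem_filter.1 hγ).2
      rw [if_pos h.symm, h, mul_comm]
    · intro γ hγ
      have h : m γ = μ := by
        by_contra h
        exact hγ (if_neg fun h' => h h'.symm)
      simp [h, hμ]
  rw [← Finset.sum_fiberwise_of_maps_to (t := A) (g := m) (by simp), Finset.sum_congr rfl hfiber,
    hA, Finset.sum_biUnion]
  · rfl
  · intro p _ q _ hpq
    refine Finset.disjoint_left.2 fun μ hp hq => hpq ?_
    rw [← (mem_finsuppAntidiag_iff.1 hp).1, (mem_finsuppAntidiag_iff.1 hq).1]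

theorem isFormalSum_of_finite {a : G → MvPowerSeries ℕ+ ℂ} (hfin : ∀ μ, {γ | m γ = μ}.Finite)
    (ha : ∀ γ μ, μ ≠ m γ → MvPowerSeries.coeff μ (a γ) = 0)
    (hL : ∀ μ, ∑ᶠ γ, MvPowerSeries.coeff μ (a γ) = MvPowerSeries.coeff μ L) :
    IsFormalSum a L := fun μ =>
  ⟨(hfin μ).subset fun γ hγ => by_contra fun h => hγ (ha γ μ fun h' => h h'.symm), (hL μ).symm⟩

theorem isAsymptoticSum_of_finsum {a : (ℕ+ → ℂ) → G → ℂ} {deg : G → ℕ}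
    (hdeg : ∀ γ, deg γ = (m γ).degree) (hfin : ∀ μ, {γ | m γ = μ}.Finite)
    (ha : ∀ x γ, a x γ = ((m γ).prod fun k n => x k ^ n) * num γ) [DecidableEq (ℕ+ →₀ ℕ)]
    (hL : ∀ μ, ∑ᶠ γ, (if μ = m γ then num γ else 0) = MvPowerSeries.coeff μ L) {s : Finset ℕ+}
    {D : Set (ℕ+ → ℂ)} (hD : ∀ x ∈ D, ∀ k ∉ s, x k = 0) {F : (ℕ+ → ℂ) → ℂ}
    (hF : ∀ N, (fun x => F x - ∑ p ∈ Finset.range N, homPart s L x p) =O[𝓝[D] 0]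
      fun x => (∑ k ∈ s, ‖x k‖) ^ N) : IsAsymptoticSum s D deg a F := by
  obtain rfl : deg = fun γ => (m γ).degree := funext hdeg
  obtain rfl : a = fun x γ => ((m γ).prod fun k n => x k ^ n) * num γ :=
    funext fun x => funext (ha x)
  have key := fun x hx N => finsum_degree_lt hfin (L := L) (by convert hL) (x := x) (hD x hx) N
  refine fun N => ⟨fun x hx => (key x hx N).1, (hF N).congr' ?_ .rfl⟩
  filter_upwards [self_mem_nhdsWithin] with x hx
  rw [(key x hx N).2]

end Sums

/-! ### Types of isomorphism classes, and the passage from symmetric to cyclic tensors -/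

section Classes

variable {V : Type*} [NormedAddCommGroup V] [InnerProductSpace ℝ V]
variable {ι : Type*} [Fintype ι] [DecidableEq ι]

/-- The type determines the number of half-edges, and there are finitely many graphs on a given
finite set. -/
theorem ConnectedRibbonClass.finite_classType (μ : ℕ+ →₀ ℕ) :
    {γ : ConnectedRibbonClass | classType γ.rep.2.toGraph.vert = μ}.Finite := by
  refine ((finite_isoClasses (X := fun n => RibbonGraph (Fin n)) (s := ribbonSetoid)
    (wt μ)).preimage Subtype.val_injective.injOn).subset fun γ hγ => ?_
  have h : classType γ.1.out.2.toGraph.vert = μ := hγ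
  simp [← h, wt_classType]

theorem ConnectedGraphClass.finite_classType (μ : ℕ+ →₀ ℕ) :
    {γ : ConnectedGraphClass | classType γ.rep.2.vert = μ}.Finite := by
  refine ((finite_isoClasses (X := fun n => Graph (Fin n)) (s := graphSetoid)
    (wt μ)).preimage Subtype.val_injective.injOn).subset fun γ hγ => ?_
  have h : classType γ.1.out.2.vert = μ := hγ
  simp [← h, wt_classType]

theorem coeff_ribbonTerm (e : Module.Basis ι ℝ V) (T : Tensors V) (μ : ℕ+ →₀ ℕ)
    (γ : ConnectedRibbonClass) :
    MvPowerSeries.coeff μ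
      (ribbonTerm e T (fun k => (MvPowerSeries.X k : MvPowerSeries ℕ+ ℂ)) γ) =
      if μ = classType γ.rep.2.toGraph.vert then ribbonTerm e T 1 γ else 0 := by
  rw [ribbonTerm, map_smul, coeff_ribbonValue, smul_ite, smul_zero, ribbonTerm]

theorem coeff_graphTerm (e : Module.Basis ι ℝ V) {S : Tensors V} (hS : IsSymmetric S)
    (μ : ℕ+ →₀ ℕ) (γ : ConnectedGraphClass) :
    MvPowerSeries.coeff μ
      (graphTerm e S (fun k => (MvPowerSeries.X k : MvPowerSeries ℕ+ ℂ)) γ) =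
      if μ = classType γ.rep.2.vert then graphTerm e S 1 γ else 0 := by
  rw [graphTerm, map_smul, coeff_graphValue e hS, smul_ite, smul_zero, graphTerm]

theorem ribbonTerm_eq_prod (e : Module.Basis ι ℝ V) (T : Tensors V) (x : ℕ+ → ℂ)
    (γ : ConnectedRibbonClass) : ribbonTerm e T x γ =
      ((classType γ.rep.2.toGraph.vert).prod fun k n => x k ^ n) * ribbonTerm e T 1 γ := by
  rw [ribbonTerm, ribbonTerm, ribbonValue_eq_prod, mul_smul_comm]
  rfl

theorem graphTerm_eq_prod (e : Module.Basis ι ℝ V) {S : Tensors V} (hS : IsSymmetric S)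
    (x : ℕ+ → ℂ) (γ : ConnectedGraphClass) : graphTerm e S x γ =
      ((classType γ.rep.2.vert).prod fun k n => x k ^ n) * graphTerm e S 1 γ := by
  rw [graphTerm, graphTerm, graphValue_eq_prod e hS, mul_smul_comm]
  rfl

theorem potential_cyclicTensors (S : Tensors V) :
    potential (cyclicTensors S) (fun k => ((k : ℕ) : ℂ)) =
      potential S fun k => (((k : ℕ)! : ℕ) : ℂ) := by
  funext x v
  simp_rw [potential, diag_cyclicTensors]

theorem freeEnergySeries_cyclicTensors [FiniteDimensional ℝ V] [MeasurableSpace V] [BorelSpace V]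
    (S : Tensors V) : freeEnergySeries (cyclicTensors S) (fun k => ((k : ℕ) : ℂ)) =
      freeEnergySeries S fun k => (((k : ℕ)! : ℕ) : ℂ) := by
  have h : potentialSeries (cyclicTensors S) (fun k => ((k : ℕ) : ℂ)) =
      potentialSeries S fun k => (((k : ℕ)! : ℕ) : ℂ) := by
    funext v m
    simp only [potentialSeries, diag_cyclicTensors]
  unfold freeEnergySeries partitionSeries
  rw [h]

end Classes

end FeynmanGraph

end

/-! ### The expansion of the free energy, formal and asymptotic, in the cyclic and symmetric cases
-/

theorem mainTheorem5
    {V : Type*} [NormedAddCommGroup V] [InnerProductSpace ℝ V] [FiniteDimensional ℝ V]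
    [MeasurableSpace V] [BorelSpace V]
    {ι : Type*} [Fintype ι] [DecidableEq ι] (e : Module.Basis ι ℝ V) :
    (∀ T : FeynmanGraph.Tensors V, FeynmanGraph.IsCyclic T →
      FeynmanGraph.IsFormalSum
        (FeynmanGraph.ribbonTerm e T (fun k : ℕ+ => (MvPowerSeries.X k : MvPowerSeries ℕ+ ℂ)))
        (FeynmanGraph.freeEnergySeries T (fun k : ℕ+ => ((k : ℕ) : ℂ))) ∧
      ∀ (s : Finset ℕ+) (D : Set (ℕ+ → ℂ)),
        FeynmanGraph.IsConvergenceDomain T (fun k : ℕ+ => ((k : ℕ) : ℂ)) s D →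
        FeynmanGraph.IsAsymptoticSum s D FeynmanGraph.ConnectedRibbonClass.numVertices
          (FeynmanGraph.ribbonTerm e T)
          (fun x => Complex.log
            (FeynmanGraph.partitionIntegral T (fun k : ℕ+ => ((k : ℕ) : ℂ)) x))) ∧
    (∀ S : FeynmanGraph.Tensors V, FeynmanGraph.IsSymmetric S →
      FeynmanGraph.IsFormalSum
        (FeynmanGraph.graphTerm e S (fun k : ℕ+ => (MvPowerSeries.X k : MvPowerSeries ℕ+ ℂ)))
        (FeynmanGraph.freeEnergySeries S (fun k : ℕ+ => ((Nat.factorial (k : ℕ) : ℕ) : ℂ))) ∧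
      ∀ (s : Finset ℕ+) (D : Set (ℕ+ → ℂ)),
        FeynmanGraph.IsConvergenceDomain S
          (fun k : ℕ+ => ((Nat.factorial (k : ℕ) : ℕ) : ℂ)) s D →
        FeynmanGraph.IsAsymptoticSum s D FeynmanGraph.ConnectedGraphClass.numVertices
          (FeynmanGraph.graphTerm e S)
          (fun x => Complex.log
            (FeynmanGraph.partitionIntegral S
              (fun k : ℕ+ => ((Nat.factorial (k : ℕ) : ℕ) : ℂ)) x))) := by
  classical
  refine ⟨fun T hT => ⟨?_, fun s D hD => ?_⟩, fun S hS => ⟨?_, fun s D hD => ?_⟩⟩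
  · rw [FeynmanGraph.freeEnergySeries_eq e hT]
    exact FeynmanGraph.isFormalSum_of_finite FeynmanGraph.ConnectedRibbonClass.finite_classType
      (fun γ μ h => by rw [FeynmanGraph.coeff_ribbonTerm, if_neg h])
      (FeynmanGraph.finsum_ribbonTerm e hT)
  · exact FeynmanGraph.isAsymptoticSum_of_finsum
      (fun γ => (FeynmanGraph.degree_classType _).symm)
      FeynmanGraph.ConnectedRibbonClass.finite_classType (FeynmanGraph.ribbonTerm_eq_prod e T)
      (fun μ => by
        simp_rw [← FeynmanGraph.coeff_ribbonTerm]
        exact FeynmanGraph.finsum_ribbonTerm e hT μ)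
      hD.1 (FeynmanGraph.log_partitionIntegral_isBigO e hT hD)
  · rw [← FeynmanGraph.freeEnergySeries_cyclicTensors,
      FeynmanGraph.freeEnergySeries_eq e (FeynmanGraph.isCyclic_cyclicTensors hS)]
    exact FeynmanGraph.isFormalSum_of_finite FeynmanGraph.ConnectedGraphClass.finite_classType
      (fun γ μ h => by rw [FeynmanGraph.coeff_graphTerm e hS, if_neg h])
      (FeynmanGraph.finsum_graphTerm e hS)
  · unfold FeynmanGraph.IsConvergenceDomain at hD
    unfold FeynmanGraph.partitionIntegral
    -- The convergence domain and the integral depend on the tensors only through the potential, so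
    -- both pass to the cyclic tensors.
    rw [← FeynmanGraph.potential_cyclicTensors] at hD ⊢
    exact FeynmanGraph.isAsymptoticSum_of_finsum
      (fun γ => (FeynmanGraph.degree_classType _).symm)
      FeynmanGraph.ConnectedGraphClass.finite_classType (FeynmanGraph.graphTerm_eq_prod e hS)
      (fun μ => by
        simp_rw [← FeynmanGraph.coeff_graphTerm e hS]
        exact FeynmanGraph.finsum_graphTerm e hS μ)
      hD.1 (FeynmanGraph.log_partitionIntegral_isBigO e
        (FeynmanGraph.isCyclic_cyclicTensors hS) hD)
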